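/- **Setting.** All functions are rational functions over $\mathbb R$ in the variables $x_1,x_2,x_3,\dots$; two of them are identical, $f\equiv g$, if they are the same rational function. $\mathcal V(f)$ is the set of variables upon which $f$ depends, i.e. those $x_i$ for which $f$ takes different values at two points of its domain differing only in the $i$-th coordinate; $A\mathbin{\dot\cup}B$ denotes a union of disjoint sets. The set $\mathcal A$ of *arithmetic expressions* is the smallest set containing every atomic function $x_i$ and every $g\ast h$ with $\ast\in\{+,-,\times,\div\}$, $g,h\in\mathcal A$ and $\mathcal V(g)\mathbin{\dot\cup}\mathcal V(h)=\mathcal V(g\ast h)$. Write $f\cong g$ if $g$ is obtained from $f$ by a permutation of the variables. An $f\in\mathcal A$ is of the *first type* if $-f\notin\mathcal A$, of the *second type* if $-f\in\mathcal A$ and $f\not\cong -f$, and of the *third type* if $-f\in\mathcal A$ and $f\cong -f$. *Ends with.* $x_i$ ends with $\times$; for $i\ne j$, $x_i\ast x_j$ ends with $\ast$. Recursively, let $f\in\mathcal A$ with $|\mathcal V(f)|\ge 3$ and consider $g,h\in\mathcal A$ with $\mathcal V(g)\mathbin{\dot\cup}\mathcal V(h)=\mathcal V(f)$. Then $f$ ends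 with $+$ if $f\equiv g+h$ for some such $g,h$ each ending with $+$, $\times$ or $\div$; with $-$ if $f\equiv g-h$ for some such $g,h$ each ending with $+$, $\times$ or $\div$ and with $h$ of the first type; with $\times$ if $f\equiv gh$ for some such $g,h$ each ending with $+$, $-$ or $\times$; with $\div$ if $f\equiv g/h$ for some such $g,h$ each ending with $+$, $-$ or $\times$. $\mathcal A(\ast)$ is the set of $f\in\mathcal A$ that end with $\ast$, and $\mathcal A(\ast,\star,\dots)=\mathcal A(\ast)\cup\mathcal A(\star)\cup\cdots$. *Monic.* A polynomial is multilinear if each of its monomials is a constant times a product of distinct variables. It is monic if the coefficient of its first monomial is positive, where monomials, written with increasing indices, are ordered lexicographically as words (e.g. $x_1x_3$ before $x_2x_3x_4$, and $x_2$ before $x_2x_3$). A rational function $f$ is monic if $f\equiv F_1/F_2$ with $F_1,F_2$ multilinear, without common factor, and both monic. **Theorem (Fundamental Theorem of Arithmetic Expressions).** Every $f\in\mathcal A$ ends with exactly one of the operators $+,-,\times,\div$; that is, $\mathcal A=\mathcal A(+)\mathbin{\dot\cup}\mathcal A(-)\mathbin{\dot\cup}\mathcal A(\times)\mathbin{\dot\cup}\mathcal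 A(\div)$. Furthermore: (a) Every $f\in\mathcal A(+)$ can be expressed uniquely, up to the order of the summands, as $f\equiv f_1+\cdots+f_n$ with $n\ge2$, $\mathcal V(f_1)\mathbin{\dot\cup}\cdots\mathbin{\dot\cup}\mathcal V(f_n)=\mathcal V(f)$ and each $f_j\in\mathcal A(\times,\div)$. Moreover, (i) $f$ is of the first type iff every $f_j$ is of the first type; (ii) $f$ is of the third type iff each $f_j$ is of the second or third type and those $f_j$ that are of the second type can be grouped into pairs $f_{j'},f_{j''}$ with $f_{j'}\cong -f_{j''}$. (b) Every $f\in\mathcal A(-)$ can be expressed uniquely as $f\equiv g-h$ with $g,h\in\mathcal A(+,\times,\div)$, $\mathcal V(g)\mathbin{\dot\cup}\mathcal V(h)=\mathcal V(f)$ and $h$ of the first type. Moreover, $f$ is of the third type iff either $g\cong h$, or $g\cong G+h$ for some $G\in\mathcal A(+,\times,\div)$ of the third type with $\mathcal V(G)\cap\mathcal V(h)=\varnothing$. (c) Every $f\in\mathcal A(\times)$ can be expressed uniquely, up to the order of the factors, as $f\equiv\varepsilon f_1\cdots f_n$ with $n\ge1$, $\varepsilon\in\{1,-1\}$, $\mathcal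 V(f_1)\mathbin{\dot\cup}\cdots\mathbin{\dot\cup}\mathcal V(f_n)=\mathcal V(f)$, and each $f_j$ monic and either atomic or in $\mathcal A(+,-)$. Moreover, (i) $f$ is of the first type iff $\varepsilon=1$ and every $f_j$ is of the first type; (ii) $f$ is of the second type iff at least one $f_j$ is of the second type and the rest are of the first or second type; (iii) $f$ is of the third type iff at least one $f_j$ is of the third type. (d) Every $f\in\mathcal A(\div)$ can be expressed uniquely as $f\equiv\varepsilon(g/h)$ with $\varepsilon\in\{1,-1\}$, $g,h\in\mathcal A(+,-,\times)$ both monic and $\mathcal V(g)\mathbin{\dot\cup}\mathcal V(h)=\mathcal V(f)$. Moreover, (i) $f$ is of the first type iff $\varepsilon=1$ and both $g$ and $h$ are of the first type; (ii) $f$ is of the second type iff at least one of $g,h$ is of the second type and the other is of the first or second type; (iii) $f$ is of the third type iff at least one of $g,h$ is of the third type. -/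

import Mathlib

noncomputable section

namespace ArithExpr

/-- Real polynomials in the variables `x_0, x_1, x_2, …`. -/
abbrev Poly : Type := MvPolynomial ℕ ℝ

/-- The field of real rational functions in the variables `x_0, x_1, x_2, …`. Two rational
expressions are identical exactly when they are equal as elements of this field. -/
abbrev RatFun : Type := FractionRing Poly

/-- A polynomial, as a rational function. -/
def ofPoly (p : Poly) : RatFun := algebraMap Poly RatFun p

/-- The atomic function `x_i`. -/
def atom (i : ℕ) : RatFun := ofPoly (MvPolynomial.X i)

/-- The rational function `f` is defined at the point `a`, with value `c`: it can be written as a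
quotient `p / q` of polynomials with `q(a) ≠ 0` and `p(a) / q(a) = c`. -/
def HasValue (f : RatFun) (a : ℕ → ℝ) (c : ℝ) : Prop :=
  ∃ p q : Poly, MvPolynomial.eval a q ≠ 0 ∧ f = ofPoly p / ofPoly q ∧
    c = MvPolynomial.eval a p / MvPolynomial.eval a q

/-- `f` depends upon `x_i`: it takes different values at two points of its domain that differ only
in their `i`-th coordinate. -/
def DependsUpon (f : RatFun) (i : ℕ) : Prop :=
  ∃ (a b : ℕ → ℝ) (c d : ℝ), (∀ j, j ≠ i → a j = b j) ∧
    HasValue f a c ∧ HasValue f b d ∧ c ≠ d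

/-- The set `𝒱(f)` of (indices of) variables upon which `f` depends. -/
def vars (f : RatFun) : Set ℕ := {i | DependsUpon f i}

/-- `S` is the disjoint union of `A` and `B`. -/
def IsDisjUnion (A B S : Set ℕ) : Prop := Disjoint A B ∧ A ∪ B = S

/-- The four operators. -/
inductive Op : Type
  | plus
  | minus
  | times
  | divide

/-- `g ∗ h` for an operator `∗`. -/
def Op.apply : Op → RatFun → RatFun → RatFun
  | .plus, g, h => g + h
  | .minus, g, h => g - h
  | .times, g, h => g * h
  | .divide, g, h => g / h

/-- Arithmetic expressions: the atomic functions, and the functions `g ∗ h` with `g`, `h` arithmetic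
expressions in disjoint sets of variables. -/
inductive IsAE : RatFun → Prop
  | atom (i : ℕ) : IsAE (atom i)
  | op (o : Op) (g h : RatFun) (hg : IsAE g) (hh : IsAE h)
      (hV : IsDisjUnion (vars g) (vars h) (vars (o.apply g h))) : IsAE (o.apply g h)

/-- The action of a permutation of the variables: `x_i` is replaced by `x_{σ i}`. -/
def permute (σ : Equiv.Perm ℕ) : RatFun ≃+* RatFun :=
  IsFractionRing.ringEquivOfRingEquiv (MvPolynomial.renameEquiv ℝ σ).toRingEquiv

/-- `f` and `g` are isomorphic: one is obtained from the other by permuting the variables. -/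
def Iso (f g : RatFun) : Prop := ∃ σ : Equiv.Perm ℕ, permute σ f = g

/-- First type: `-f` is not an arithmetic expression. -/
def IsFirstType (f : RatFun) : Prop := IsAE f ∧ ¬ IsAE (-f)

/-- Second type: `-f` is an arithmetic expression that is not isomorphic to `f`. -/
def IsSecondType (f : RatFun) : Prop := IsAE f ∧ IsAE (-f) ∧ ¬ Iso f (-f)

/-- Third type: `-f` is an arithmetic expression that is isomorphic to `f`. -/
def IsThirdType (f : RatFun) : Prop := IsAE f ∧ IsAE (-f) ∧ Iso f (-f)

/-- `EndsWith o f`: the arithmetic expression `f` ends with the operator `o`. The cases of one and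
two variables are explicit; from three variables on, the definition is recursive in the number of
variables. -/
inductive EndsWith : Op → RatFun → Prop
  | atom (i : ℕ) : EndsWith .times (atom i)
  | pair (o : Op) (i j : ℕ) (hij : i ≠ j) : EndsWith o (o.apply (atom i) (atom j))
  | plus (f g h : RatFun) (o₁ o₂ : Op) (hf : IsAE f) (hcard : 3 ≤ (vars f).ncard)
      (hg : IsAE g) (hh : IsAE h) (hfgh : f = g + h)
      (hV : IsDisjUnion (vars g) (vars h) (vars f))
      (hog : EndsWith o₁ g) (hoh : EndsWith o₂ h)
      (ho₁ : o₁ = .plus ∨ o₁ = .times ∨ o₁ = .divide)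
      (ho₂ : o₂ = .plus ∨ o₂ = .times ∨ o₂ = .divide) : EndsWith .plus f
  | times (f g h : RatFun) (o₁ o₂ : Op) (hf : IsAE f) (hcard : 3 ≤ (vars f).ncard)
      (hg : IsAE g) (hh : IsAE h) (hfgh : f = g * h)
      (hV : IsDisjUnion (vars g) (vars h) (vars f))
      (hog : EndsWith o₁ g) (hoh : EndsWith o₂ h)
      (ho₁ : o₁ = .minus ∨ o₁ = .plus ∨ o₁ = .times)
      (ho₂ : o₂ = .minus ∨ o₂ = .plus ∨ o₂ = .times) : EndsWith .times f
  | divide (f g h : RatFun) (o₁ o₂ : Op) (hf : IsAE f) (hcard : 3 ≤ (vars f).ncard)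
      (hg : IsAE g) (hh : IsAE h) (hfgh : f = g / h)
      (hV : IsDisjUnion (vars g) (vars h) (vars f))
      (hog : EndsWith o₁ g) (hoh : EndsWith o₂ h)
      (ho₁ : o₁ = .plus ∨ o₁ = .minus ∨ o₁ = .times)
      (ho₂ : o₂ = .plus ∨ o₂ = .minus ∨ o₂ = .times) : EndsWith .divide f
  | minus (f g h : RatFun) (o₁ o₂ : Op) (hf : IsAE f) (hcard : 3 ≤ (vars f).ncard)
      (hg : IsAE g) (hh : IsAE h) (hfgh : f = g - h)
      (hV : IsDisjUnion (vars g) (vars h) (vars f))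
      (hog : EndsWith o₁ g) (hoh : EndsWith o₂ h)
      (ho₁ : o₁ = .plus ∨ o₁ = .times ∨ o₁ = .divide)
      (ho₂ : o₂ = .plus ∨ o₂ = .times ∨ o₂ = .divide)
      (hfirst : IsFirstType h) : EndsWith .minus f

/-- The set `𝒜` of arithmetic expressions. -/
def AE : Set RatFun := {f | IsAE f}

/-- The set `𝒜(o)` of arithmetic expressions that end with the operator `o`. -/
def AEop (o : Op) : Set RatFun := {f | IsAE f ∧ EndsWith o f}

/-- Every monomial of `P` is a constant times a product of distinct variables. -/
def IsMultilinear (P : Poly) : Prop := ∀ m ∈ P.support, ∀ i, m i ≤ 1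

/-- The word of a squarefree monomial: the increasing list of the indices of its variables. -/
def word (m : ℕ →₀ ℕ) : List ℕ := m.support.sort (· ≤ ·)

/-- The leading monomial of the multilinear polynomial `P`, which is the one whose word is first in
the lexicographic order (a proper prefix precedes the longer word), has a positive coefficient. -/
def IsMonicPoly (P : Poly) : Prop :=
  ∃ m ∈ P.support, (∀ m' ∈ P.support, m' ≠ m → word m < word m') ∧ 0 < P.coeff m

/-- `f = F₁ / F₂` is the multilinear form of `f`: a quotient of multilinear polynomials in lowest
terms with monic denominator (which determines `F₁` and `F₂` up to a common positive constant). -/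
def IsMultilinearForm (f : RatFun) (F₁ F₂ : Poly) : Prop :=
  IsMultilinear F₁ ∧ IsMultilinear F₂ ∧ IsRelPrime F₁ F₂ ∧ IsMonicPoly F₂ ∧
    f = ofPoly F₁ / ofPoly F₂

/-- `f` is monic: both polynomials of its multilinear form are monic. -/
def IsMonic (f : RatFun) : Prop := ∃ F₁ F₂ : Poly, IsMultilinearForm f F₁ F₂ ∧ IsMonicPoly F₁

/-- `S` is the disjoint union of the sets `𝒱(F j)`. -/
def IsVarPartition {n : ℕ} (F : Fin n → RatFun) (S : Set ℕ) : Prop :=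
  Pairwise (fun i j => Disjoint (vars (F i)) (vars (F j))) ∧ (⋃ j, vars (F j)) = S

/-- Canonical form of `f ∈ 𝒜(+)`. -/
def IsSumForm (f : RatFun) (n : ℕ) (F : Fin n → RatFun) : Prop :=
  2 ≤ n ∧ f = ∑ j, F j ∧ IsVarPartition F (vars f) ∧ ∀ j, F j ∈ AEop .times ∪ AEop .divide

/-- Canonical form of `f ∈ 𝒜(-)`. -/
def IsDiffForm (f g h : RatFun) : Prop :=
  f = g - h ∧ IsDisjUnion (vars g) (vars h) (vars f) ∧
    g ∈ AEop .plus ∪ AEop .times ∪ AEop .divide ∧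
    h ∈ AEop .plus ∪ AEop .times ∪ AEop .divide ∧ IsFirstType h

/-- Canonical form of `f ∈ 𝒜(×)`. -/
def IsProdForm (f ε : RatFun) (n : ℕ) (F : Fin n → RatFun) : Prop :=
  1 ≤ n ∧ (ε = 1 ∨ ε = -1) ∧ f = ε * ∏ j, F j ∧ IsVarPartition F (vars f) ∧
    ∀ j, IsMonic (F j) ∧ ((∃ i, F j = atom i) ∨ F j ∈ AEop .plus ∪ AEop .minus)

/-- Canonical form of `f ∈ 𝒜(÷)`. -/
def IsQuotForm (f ε g h : RatFun) : Prop :=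
  (ε = 1 ∨ ε = -1) ∧ f = ε * (g / h) ∧ IsDisjUnion (vars g) (vars h) (vars f) ∧
    (g ∈ AEop .plus ∪ AEop .minus ∪ AEop .times ∧ IsMonic g) ∧
    (h ∈ AEop .plus ∪ AEop .minus ∪ AEop .times ∧ IsMonic h)

/-- The members of second type of the family `F` can be grouped into pairs `F j, F (τ j)` with
`F j ≅ -F (τ j)`; here `τ` sends an index to its partner. -/
def SecondTypesPair {n : ℕ} (F : Fin n → RatFun) : Prop :=
  ∃ τ : Fin n → Fin n, ∀ j, IsSecondType (F j) →
    IsSecondType (F (τ j)) ∧ τ (τ j) = j ∧ τ j ≠ j ∧ Iso (F j) (-F (τ j))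

end ArithExpr

end

open ArithExpr

noncomputable section

namespace ArithExpr

/-! ### Reduced fractions and partial derivatives of rational functions -/

/-! The parts of a sum or a product in disjoint variables can be recovered from derivatives. Join i
and j by an edge when ∂_i∂_j f ≠ 0. For f = g + h no edge crosses between the two sets of variables,
while for f = g * h every crossing pair is an edge, because ∂_i∂_j f = ∂_i g · ∂_j h. With the
logarithmic derivative ∂_j f / f in place of ∂_j f the roles are exchanged. So no function is
decomposable both as a sum and as a product. An expression that is not a sum has a connected graph,
and one that is not a product has a connected logarithmic graph. The (logarithmic) gradients of the
indecomposable parts of f are then the connected blocks of that of f (`match_of_conn`), which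
determines summands up to additive constants and factors up to multiplicative ones.

Rigidity (`IsAE.affine_rigid`) removes the constants: if f and a f + c with a ≠ 0 are both
arithmetic expressions, then c = 0 and a = ±1. It follows by induction on the number of variables
from the same matching. Hence the set of indecomposable summands is unique (`IsSumOf.unique`), and
the factors in numerator and denominator are unique up to sign (`IsFracOf.match`).

The last operator can now be read off (`Cls`): + if there are several summands, all of them
expressions; - if some summand is an expression and another is one only after negation; × and ÷ if f
is not a sum, according to whether factors occur in the denominator. Three invariants, `AddDec`,
`AllPos` and `AllNum`, separate the four cases, and the recursive definition agrees with this
description (`mem_AEop_iff`).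

For the types, -f is an expression exactly if -X is one for some summand X, or for some factor X
when f is a quotient of products of factors. An expression whose negative is not one has a
multilinear form with nonnegative coefficients and so is monic; therefore the monic one of f and -f
is always an expression, which normalises factors and makes ε unique. A permutation taking f to -f
permutes summands, or factors up to sign; for products, a choice of one sign in each isomorphism
class up to sign shows that some factor must be isomorphic to its own negative. -/

theorem ofPoly_injective : Function.Injective ofPoly :=
  IsFractionRing.injective Poly RatFun

theorem ofPoly_ne_zero {p : Poly} (hp : p ≠ 0) : ofPoly p ≠ 0 := fun h =>
  hp (ofPoly_injective (h.trans (map_zero (algebraMap Poly RatFun)).symm))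

theorem ofPoly_mul (p q : Poly) : ofPoly (p * q) = ofPoly p * ofPoly q := map_mul _ _ _

theorem ofPoly_add (p q : Poly) : ofPoly (p + q) = ofPoly p + ofPoly q := map_add _ _ _

theorem ofPoly_sub (p q : Poly) : ofPoly (p - q) = ofPoly p - ofPoly q := map_sub _ _ _

theorem ofPoly_neg (p : Poly) : ofPoly (-p) = -ofPoly p := map_neg _ _

theorem ofPoly_zero : ofPoly 0 = 0 := map_zero _

theorem ofPoly_one : ofPoly 1 = 1 := map_one _

theorem ofPoly_div_eq_iff {p q p' q' : Poly} (hq : q ≠ 0) (hq' : q' ≠ 0) :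
    ofPoly p / ofPoly q = ofPoly p' / ofPoly q' ↔ p * q' = p' * q := by
  rw [div_eq_div_iff (ofPoly_ne_zero hq) (ofPoly_ne_zero hq'), ← ofPoly_mul, ← ofPoly_mul,
    ofPoly_injective.eq_iff]

theorem exists_reduced (f : RatFun) :
    ∃ p q : Poly, IsRelPrime p q ∧ q ≠ 0 ∧ f = ofPoly p / ofPoly q := by
  obtain ⟨p, q, h, e⟩ := IsFractionRing.exists_reduced_fraction (A := Poly) (K := RatFun) f
  refine ⟨p, q, h, nonZeroDivisors.ne_zero q.2, ?_⟩
  rw [← e, IsFractionRing.mk'_eq_div]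
  rfl

/-- The ring homomorphism `p ↦ φ p + ε d p` given by a derivation `d` along `φ`. -/
def dualHom {A K : Type*} [CommRing A] [CommRing K] (φ : A →+* K) (d : A →+ K)
    (h1 : d 1 = 0) (hd : ∀ p q, d (p * q) = φ p * d q + φ q * d p) : A →+* DualNumber K where
  toFun p := TrivSqZeroExt.inl (φ p) + TrivSqZeroExt.inr (d p)
  map_one' := by ext <;> simp [h1]
  map_zero' := by ext <;> simp
  map_add' p q := by ext <;> simp
  map_mul' p q := by
    ext
    · simp
    · simp [hd]; ring

/-- A derivation from a domain to its fraction field extends to the fraction field. -/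
theorem exists_extend_derivation {A K : Type*} [CommRing A] [IsDomain A] [Field K] [Algebra A K]
    [IsFractionRing A K] (d : A →+ K) (h1 : d 1 = 0)
    (hd : ∀ p q, d (p * q) = algebraMap A K p * d q + algebraMap A K q * d p) :
    ∃ D : K →+ K, (∀ p, D (algebraMap A K p) = d p) ∧ ∀ f g, D (f * g) = f * D g + g * D f := by
  -- A derivation along φ is the same thing as a ring homomorphism p ↦ φ p + ε d p to the dual
  -- numbers. A dual number with nonzero first component is a unit, so the homomorphism extends to
  -- the fraction field, and its ε-part is the extended derivation.
  set ψ := dualHom (algebraMap A K) d h1 hd with hψ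
  have hfst : ∀ p, (ψ p).fst = algebraMap A K p := fun p => by simp [hψ, dualHom]
  have hsnd : ∀ p, (ψ p).snd = d p := fun p => by simp [hψ, dualHom]
  have hu : ∀ y : nonZeroDivisors A, IsUnit (ψ y) := by
    intro y
    rw [TrivSqZeroExt.isUnit_iff_isUnit_fst, hfst, isUnit_iff_ne_zero]
    exact IsFractionRing.to_map_ne_zero_of_mem_nonZeroDivisors y.2
  set Φ : K →+* DualNumber K := IsLocalization.lift hu with hΦ
  have hΦA : ∀ p, Φ (algebraMap A K p) = ψ p := fun p => IsLocalization.lift_eq _ _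
  have hΦ1 : ∀ f, (Φ f).fst = f := by
    intro f
    have h : ((TrivSqZeroExt.fstHom K K K).toRingHom.comp Φ) = RingHom.id K := by
      apply IsLocalization.ringHom_ext (nonZeroDivisors A)
      ext p
      simp [hΦA, hfst]
    exact congrArg (fun φ : K →+* K => φ f) h
  refine ⟨⟨⟨fun f => (Φ f).snd, by simp⟩, fun f g => by simp⟩, fun p => ?_, fun f g => ?_⟩
  · simp [hΦA, hsnd]
  · simp [hΦ1]
    ring

theorem exists_der (i : ℕ) : ∃ D : RatFun →+ RatFun,
    (∀ p, D (ofPoly p) = ofPoly (MvPolynomial.pderiv i p)) ∧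
      ∀ f g, D (f * g) = f * D g + g * D f := by
  refine exists_extend_derivation (A := Poly)
    ((algebraMap Poly RatFun).toAddMonoidHom.comp
      (MvPolynomial.pderiv (R := ℝ) i).toLinearMap.toAddMonoidHom) ?_ ?_
  · change algebraMap Poly RatFun (MvPolynomial.pderiv i 1) = 0
    rw [MvPolynomial.pderiv_one, map_zero]
  · intro p q
    change algebraMap Poly RatFun (MvPolynomial.pderiv i (p * q)) = algebraMap Poly RatFun p *
      algebraMap Poly RatFun (MvPolynomial.pderiv i q) + algebraMap Poly RatFun q *
      algebraMap Poly RatFun (MvPolynomial.pderiv i p)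
    rw [MvPolynomial.pderiv_mul, map_add, map_mul, map_mul, add_comm, mul_comm (algebraMap _ _ q)]

/-- The partial derivative `∂/∂x_i` of rational functions. -/
def der (i : ℕ) : RatFun →+ RatFun := (exists_der i).choose

theorem der_ofPoly (i : ℕ) (p : Poly) : der i (ofPoly p) = ofPoly (MvPolynomial.pderiv i p) :=
  (exists_der i).choose_spec.1 p

theorem der_mul (i : ℕ) (f g : RatFun) : der i (f * g) = f * der i g + g * der i f :=
  (exists_der i).choose_spec.2 f g

theorem der_inv (i : ℕ) (f : RatFun) : der i f⁻¹ = -(der i f / f ^ 2) := by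
  by_cases hf : f = 0
  · simp [hf]
  have h1 : der i 1 = 0 := by
    rw [← ofPoly_one, der_ofPoly, MvPolynomial.pderiv_one, ofPoly_zero]
  have h := der_mul i f f⁻¹
  rw [mul_inv_cancel₀ hf, h1] at h
  field_simp at h ⊢
  linear_combination -h

theorem der_div (i : ℕ) {f g : RatFun} (hg : g ≠ 0) :
    der i (f / g) = (g * der i f - f * der i g) / g ^ 2 := by
  rw [div_eq_mul_inv, der_mul, der_inv]
  field_simp
  ring

/-- The commutator of two derivations is a derivation, and this one kills every generator. -/
theorem pderiv_comm (i j : ℕ) (p : Poly) : MvPolynomial.pderiv i (MvPolynomial.pderiv j p) =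
    MvPolynomial.pderiv j (MvPolynomial.pderiv i p) := by
  have : ⁅MvPolynomial.pderiv (R := ℝ) i, MvPolynomial.pderiv (R := ℝ) j⁆ = 0 := by
    apply MvPolynomial.derivation_ext
    intro k
    simp [Derivation.commutator_apply, MvPolynomial.pderiv_X, Pi.single_apply, apply_ite]
  have h := congrArg (fun d => d p) this
  simpa [Derivation.commutator_apply, sub_eq_zero] using h

theorem der_comm (i j : ℕ) (f : RatFun) : der i (der j f) = der j (der i f) := by
  obtain ⟨p, q, -, hq, hf⟩ := exists_reduced f
  have hq0 := ofPoly_ne_zero hq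
  have hqf : ofPoly q * f = ofPoly p := by rw [hf, mul_div_cancel₀ _ hq0]
  -- Both orders agree on `ofPoly q * f`, which is a polynomial. Expanding by the product rule, the
  -- cross terms cancel and `ofPoly q` times the commutator at f remains.
  have h : der i (der j (ofPoly q * f)) = der j (der i (ofPoly q * f)) := by
    rw [hqf, der_ofPoly, der_ofPoly, der_ofPoly, der_ofPoly, pderiv_comm]
  simp only [der_mul, map_add, der_ofPoly, pderiv_comm j i] at h
  have h2 : ofPoly q * (der i (der j f) - der j (der i f)) = 0 := by linear_combination h
  exact sub_eq_zero.1 ((mul_eq_zero.1 h2).resolve_left hq0)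

/-- The constant rational function with value `c`. -/
def const (c : ℝ) : RatFun := ofPoly (MvPolynomial.C c)

theorem der_const (i : ℕ) (c : ℝ) : der i (const c) = 0 := by
  simp [const, der_ofPoly, ofPoly_zero]

theorem notMem_vars_of_pderiv_eq_zero {i : ℕ} {p : Poly} (h : MvPolynomial.pderiv i p = 0) :
    i ∉ p.vars := by
  intro hi
  obtain ⟨m, hm, him⟩ := (MvPolynomial.mem_vars_iff_mem_support i).1 hi
  have h1 := MvPolynomial.coeff_pderiv (i := i) p (m - Finsupp.single i 1)
  have h2 : m - Finsupp.single i 1 + Finsupp.single i 1 = m := by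
    apply tsub_add_cancel_of_le
    simpa using Nat.one_le_iff_ne_zero.2 (Finsupp.mem_support_iff.1 him)
  rw [h, h2, MvPolynomial.coeff_zero] at h1
  rcases mul_eq_zero.1 h1.symm with h3 | h3
  · exact (MvPolynomial.mem_support_iff.1 hm) h3
  · exact Nat.cast_add_one_ne_zero _ h3

/-- A nonzero multiple of q has at least the degree of q in x_i, and differentiation lowers that
degree. -/
theorem pderiv_eq_zero_of_dvd {i : ℕ} {q : Poly} (h : q ∣ MvPolynomial.pderiv i q) :
    MvPolynomial.pderiv i q = 0 := by
  by_contra hne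
  obtain ⟨r, hr⟩ := h
  have hq : q ≠ 0 := by rintro rfl; simp at hne
  have hr0 : r ≠ 0 := by rintro rfl; simp [hr] at hne
  have hle : MvPolynomial.degreeOf i q ≤ MvPolynomial.degreeOf i (MvPolynomial.pderiv i q) := by
    rw [hr, MvPolynomial.degreeOf_mul_eq hq hr0]
    exact Nat.le_add_right _ _
  have hlt : MvPolynomial.degreeOf i (MvPolynomial.pderiv i q) < MvPolynomial.degreeOf i q := by
    rw [MvPolynomial.degreeOf_lt_iff]
    · intro m hm
      have h1 := MvPolynomial.coeff_pderiv (i := i) q m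
      have h2 : m + Finsupp.single i 1 ∈ q.support := by
        rw [MvPolynomial.mem_support_iff] at hm ⊢
        intro h3
        exact hm (by rw [h1, h3, zero_mul])
      have := MvPolynomial.monomial_le_degreeOf i h2
      simp at this
      omega
    · rw [Nat.pos_iff_ne_zero]
      intro h0
      apply hne
      apply MvPolynomial.pderiv_eq_zero_of_notMem_vars
      rw [MvPolynomial.mem_vars_iff_degreeOf_ne_zero, not_not, h0]
  omega

/-- A vanishing derivative means q ∂p = p ∂q. Coprimality gives q ∣ ∂q, hence ∂q = 0, and then ∂p =
0. -/
theorem notMem_vars_of_reduced {i : ℕ} {p q : Poly} (hpq : IsRelPrime p q) (hq : q ≠ 0)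
    (h : der i (ofPoly p / ofPoly q) = 0) : i ∉ p.vars ∧ i ∉ q.vars := by
  have hq0 := ofPoly_ne_zero hq
  rw [der_div i hq0, div_eq_zero_iff, or_iff_left (pow_ne_zero 2 hq0), der_ofPoly, der_ofPoly,
    ← ofPoly_mul, ← ofPoly_mul, sub_eq_zero, ofPoly_injective.eq_iff] at h
  have h1 : MvPolynomial.pderiv i q = 0 := by
    apply pderiv_eq_zero_of_dvd
    exact hpq.symm.dvd_of_dvd_mul_left (Dvd.intro _ h)
  rw [h1, mul_zero, mul_eq_zero, or_iff_right hq] at h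
  exact ⟨notMem_vars_of_pderiv_eq_zero h, notMem_vars_of_pderiv_eq_zero h1⟩

theorem eq_const_of_der_eq_zero {f : RatFun} (h : ∀ i, der i f = 0) : ∃ c, f = const c := by
  obtain ⟨p, q, hpq, hq, rfl⟩ := exists_reduced f
  have h1 := fun i => notMem_vars_of_reduced hpq hq (h i)
  have h2 : p.vars = ∅ := Finset.eq_empty_of_forall_notMem fun i => (h1 i).1
  have h3 : q.vars = ∅ := Finset.eq_empty_of_forall_notMem fun i => (h1 i).2
  rw [MvPolynomial.vars_eq_empty_iff_eq_C] at h2 h3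
  obtain ⟨a, rfl⟩ : ∃ a, p = MvPolynomial.C a := ⟨_, h2⟩
  obtain ⟨b, rfl⟩ : ∃ b, q = MvPolynomial.C b := ⟨_, h3⟩
  have hb : b ≠ 0 := by rintro rfl; simp at hq
  refine ⟨a / b, ?_⟩
  rw [const, div_eq_iff (ofPoly_ne_zero hq), ← ofPoly_mul, ← MvPolynomial.C_mul,
    div_mul_cancel₀ _ hb]

/-! ### The variables of a rational function -/

theorem eval_eq_of_notMem_vars {i : ℕ} {p : Poly} (hp : i ∉ p.vars) {a b : ℕ → ℝ}
    (hab : ∀ j, j ≠ i → a j = b j) : MvPolynomial.eval a p = MvPolynomial.eval b p := by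
  apply MvPolynomial.eval₂Hom_congr' rfl _ rfl
  intro j hj _
  exact hab j fun h => hp (h ▸ hj)

/-- Restriction of a polynomial to a line parallel to the `i`-th axis. -/
def restrictLine (a : ℕ → ℝ) (i : ℕ) : Poly →ₐ[ℝ] Polynomial ℝ :=
  MvPolynomial.aeval (fun j => if j = i then Polynomial.X else Polynomial.C (a j))

theorem eval_restrictLine (a : ℕ → ℝ) (i : ℕ) (t : ℝ) (p : Poly) :
    (restrictLine a i p).eval t = MvPolynomial.eval (Function.update a i t) p := by
  induction p using MvPolynomial.induction_on with
  | C r => simp [restrictLine]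
  | add p q hp hq => simp [hp, hq]
  | mul_X p j hp =>
    rw [map_mul, map_mul, Polynomial.eval_mul, hp]
    congr 1
    by_cases h : j = i <;> simp [restrictLine, h]

theorem derivative_restrictLine (a : ℕ → ℝ) (i : ℕ) (p : Poly) :
    Polynomial.derivative (restrictLine a i p) = restrictLine a i (MvPolynomial.pderiv i p) := by
  induction p using MvPolynomial.induction_on with
  | C r => simp [restrictLine]
  | add p q hp hq => simp [hp, hq]
  | mul_X p j hp =>
    rw [map_mul, Polynomial.derivative_mul, hp, MvPolynomial.pderiv_mul, map_add, map_mul, map_mul]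
    congr 2
    classical
    by_cases h : j = i
    · subst h; simp [restrictLine]
    · simp [restrictLine, h, MvPolynomial.pderiv_X_of_ne h]

/-- This replaces dependence, defined through values at points, by a purely algebraic criterion;
from here on points are no longer needed. -/
theorem mem_vars_iff {f : RatFun} {i : ℕ} : i ∈ vars f ↔ der i f ≠ 0 := by
  constructor
  · rintro ⟨a, b, c, d, hab, hc, hd, hcd⟩ h
    obtain ⟨p, q, hpq, hq, rfl⟩ := exists_reduced f
    obtain ⟨h1, h2⟩ := notMem_vars_of_reduced hpq hq h
    -- The denominator q of the reduced fraction divides every other denominator, so wherever f has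
    -- a value, the reduced fraction computes it.
    have key : ∀ {a : ℕ → ℝ} {c : ℝ}, HasValue (ofPoly p / ofPoly q) a c →
        c = MvPolynomial.eval a p / MvPolynomial.eval a q := by
      rintro a c ⟨p', q', hq', he, rfl⟩
      have hq'0 : q' ≠ 0 := by rintro rfl; simp at hq'
      rw [ofPoly_div_eq_iff hq hq'0] at he
      have hd : q ∣ q' := hpq.symm.dvd_of_dvd_mul_left (Dvd.intro_left _ he.symm)
      have hqa : MvPolynomial.eval a q ≠ 0 := by
        obtain ⟨r, rfl⟩ := hd
        rw [map_mul] at hq'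
        exact left_ne_zero_of_mul hq'
      rw [div_eq_div_iff hq' hqa, ← map_mul, ← map_mul, he]
    apply hcd
    rw [key hc, key hd, eval_eq_of_notMem_vars h1 hab, eval_eq_of_notMem_vars h2 hab]
  · intro h
    by_contra hdep
    apply h
    obtain ⟨p, q, -, hq, rfl⟩ := exists_reduced f
    rw [der_div i (ofPoly_ne_zero hq), der_ofPoly, der_ofPoly, ← ofPoly_mul, ← ofPoly_mul,
      ← ofPoly_sub]
    suffices hW : q * MvPolynomial.pderiv i p - p * MvPolynomial.pderiv i q = 0 by
      rw [hW, ofPoly_zero, zero_div]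
    -- The extra factor q makes the claim trivial at the zeros of q, so only points in the domain of
    -- p / q matter.
    refine (mul_eq_zero.1 (?_ : _ * q = 0)).resolve_right hq
    apply MvPolynomial.funext
    intro a
    rw [map_mul, map_zero]
    by_cases hqa : MvPolynomial.eval a q = 0
    · rw [hqa, mul_zero]
    set P := restrictLine a i p with hP
    set Q := restrictLine a i q with hQ
    set c := MvPolynomial.eval a p / MvPolynomial.eval a q with hc
    have hQ0 : Q ≠ 0 := by
      intro h0
      apply hqa
      have := eval_restrictLine a i (a i) q
      rw [← hQ, h0, Function.update_eq_self] at this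
      simpa using this.symm
    -- Independence of x_i makes f constant on the line through a parallel to the i-th axis, away
    -- from the zeros of Q; hence P = cQ as polynomials in one variable.
    have hPQ : P = Polynomial.C c * Q := by
      rw [← sub_eq_zero]
      refine (mul_eq_zero.1 (?_ : _ * Q = 0)).resolve_right hQ0
      apply Polynomial.funext
      intro t
      rw [Polynomial.eval_mul, Polynomial.eval_zero]
      by_cases ht : Q.eval t = 0
      · rw [ht, mul_zero]
      rw [Polynomial.eval_sub, Polynomial.eval_mul, Polynomial.eval_C]
      have : P.eval t / Q.eval t = c := by
        by_contra hne
        apply hdep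
        refine ⟨Function.update a i t, a, P.eval t / Q.eval t, c,
          fun j hj => Function.update_of_ne hj _ _, ⟨p, q, ?_, rfl, ?_⟩, ⟨p, q, hqa, rfl, rfl⟩, hne⟩
        · rwa [hQ, eval_restrictLine] at ht
        · rw [hP, hQ, eval_restrictLine, eval_restrictLine]
      rw [div_eq_iff ht] at this
      rw [this, sub_self, zero_mul]
    have hd : Polynomial.derivative P = Polynomial.C c * Polynomial.derivative Q := by
      rw [hPQ]; simp
    have h1 : ∀ r : Poly, MvPolynomial.eval a r = (restrictLine a i r).eval (a i) := by
      intro r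
      rw [eval_restrictLine, Function.update_eq_self]
    rw [map_sub, map_mul, map_mul, h1, h1, h1, h1, ← derivative_restrictLine,
      ← derivative_restrictLine, ← hP, ← hQ, hd, hPQ]
    simp
    left
    ring

theorem notMem_vars_iff {f : RatFun} {i : ℕ} : i ∉ vars f ↔ der i f = 0 := by
  rw [mem_vars_iff, not_not]

theorem vars_subset_of_reduced {p q : Poly} (hpq : IsRelPrime p q) (hq : q ≠ 0) :
    ↑(p.vars ∪ q.vars) ⊆ vars (ofPoly p / ofPoly q) := by
  intro i hi
  rw [mem_vars_iff]
  intro h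
  have := notMem_vars_of_reduced hpq hq h
  simp [this] at hi

theorem vars_subset (p q : Poly) : vars (ofPoly p / ofPoly q) ⊆ ↑(p.vars ∪ q.vars) := by
  intro i hi
  rw [mem_vars_iff] at hi
  by_contra h
  simp only [Finset.coe_union, Set.mem_union, Finset.mem_coe, not_or] at h
  apply hi
  by_cases hq : q = 0
  · simp [hq, ofPoly_zero]
  rw [der_div i (ofPoly_ne_zero hq), der_ofPoly, der_ofPoly,
    MvPolynomial.pderiv_eq_zero_of_notMem_vars h.1, MvPolynomial.pderiv_eq_zero_of_notMem_vars h.2]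
  simp [ofPoly_zero]

theorem vars_finite (f : RatFun) : (vars f).Finite := by
  obtain ⟨p, q, -, -, rfl⟩ := exists_reduced f
  exact (Finset.finite_toSet _).subset (vars_subset p q)

theorem vars_atom (i : ℕ) : vars (atom i) = {i} := by
  ext j
  rw [mem_vars_iff, atom, der_ofPoly, Set.mem_singleton_iff]
  constructor
  · intro h
    by_contra hne
    exact h (by rw [MvPolynomial.pderiv_X_of_ne (Ne.symm hne), ofPoly_zero])
  · rintro rfl
    rw [MvPolynomial.pderiv_X_self, ofPoly_one]
    exact one_ne_zero

theorem vars_neg (f : RatFun) : vars (-f) = vars f := by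
  ext i; simp [mem_vars_iff]

theorem vars_inv (f : RatFun) : vars f⁻¹ = vars f := by
  ext i
  simp only [mem_vars_iff, der_inv]
  by_cases hf : f = 0
  · simp [hf]
  · simp [hf]

theorem vars_const (c : ℝ) : vars (const c) = ∅ := by
  ext i; simp [mem_vars_iff, der_const]

theorem ne_zero_of_vars_nonempty {f : RatFun} (h : (vars f).Nonempty) : f ≠ 0 := by
  rintro rfl
  obtain ⟨i, hi⟩ := h
  simp [mem_vars_iff] at hi

theorem vars_add {f g : RatFun} (h : Disjoint (vars f) (vars g)) :
    vars (f + g) = vars f ∪ vars g := by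
  ext i
  rw [Set.mem_union, mem_vars_iff, map_add]
  by_cases hf : i ∈ vars f
  · have hg := Set.disjoint_left.1 h hf
    simp [hf, notMem_vars_iff.1 hg, mem_vars_iff.1 hf]
  · simp [hf, notMem_vars_iff.1 hf, mem_vars_iff]

theorem vars_sub {f g : RatFun} (h : Disjoint (vars f) (vars g)) :
    vars (f - g) = vars f ∪ vars g := by
  rw [sub_eq_add_neg, vars_add (by rwa [vars_neg]), vars_neg]

theorem vars_mul {f g : RatFun} (hf0 : f ≠ 0) (hg0 : g ≠ 0) (h : Disjoint (vars f) (vars g)) :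
    vars (f * g) = vars f ∪ vars g := by
  ext i
  rw [Set.mem_union, mem_vars_iff, der_mul]
  by_cases hf : i ∈ vars f
  · have hg := Set.disjoint_left.1 h hf
    simp [hf, notMem_vars_iff.1 hg, mem_vars_iff.1 hf, hg0]
  · simp [hf, notMem_vars_iff.1 hf, mem_vars_iff, hf0]

theorem vars_div {f g : RatFun} (hf0 : f ≠ 0) (hg0 : g ≠ 0) (h : Disjoint (vars f) (vars g)) :
    vars (f / g) = vars f ∪ vars g := by
  rw [div_eq_mul_inv, vars_mul hf0 (inv_ne_zero hg0) (by rwa [vars_inv]), vars_inv]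

/-! ### Permutations of the variables -/

theorem permute_ofPoly (σ : Equiv.Perm ℕ) (p : Poly) :
    permute σ (ofPoly p) = ofPoly (MvPolynomial.rename σ p) := by
  simp only [permute, ofPoly]
  rw [IsFractionRing.ringEquivOfRingEquiv_algebraMap]
  simp

theorem permute_atom (σ : Equiv.Perm ℕ) (i : ℕ) : permute σ (atom i) = atom (σ i) := by
  rw [atom, permute_ofPoly, MvPolynomial.rename_X, atom]

/-- The numerator and denominator of the reduced fraction contain no variables outside `vars f`. -/
theorem permute_congr {σ τ : Equiv.Perm ℕ} {f : RatFun} (h : ∀ i ∈ vars f, σ i = τ i) :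
    permute σ f = permute τ f := by
  obtain ⟨p, q, hpq, hq, rfl⟩ := exists_reduced f
  have hs := vars_subset_of_reduced hpq hq
  have key : ∀ r : Poly, r.vars ⊆ p.vars ∪ q.vars →
      MvPolynomial.rename σ r = MvPolynomial.rename τ r := by
    intro r hr
    have hr' : ∀ ρ : Equiv.Perm ℕ, MvPolynomial.rename ρ r =
        MvPolynomial.eval₂Hom MvPolynomial.C (MvPolynomial.X ∘ ρ) r := fun ρ => by
      have : (MvPolynomial.rename ρ : Poly →ₐ[ℝ] Poly) = MvPolynomial.aeval (MvPolynomial.X ∘ ρ) := by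
        ext i
        simp
      rw [this]
      rfl
    rw [hr', hr']
    refine MvPolynomial.eval₂Hom_congr' rfl ?_ rfl
    intro i hi _
    simp only [Function.comp_apply]
    rw [h i (hs (hr hi))]
  rw [map_div₀, map_div₀, permute_ofPoly, permute_ofPoly, permute_ofPoly, permute_ofPoly,
    key p Finset.subset_union_left, key q Finset.subset_union_right]

theorem permute_mul (σ τ : Equiv.Perm ℕ) (f : RatFun) :
    permute (σ * τ) f = permute σ (permute τ f) := by
  obtain ⟨p, q, -, -, rfl⟩ := exists_reduced f
  simp only [map_div₀, permute_ofPoly, MvPolynomial.rename_rename]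
  rfl

theorem permute_one (f : RatFun) : permute 1 f = f := by
  obtain ⟨p, q, -, -, rfl⟩ := exists_reduced f
  simp only [map_div₀, permute_ofPoly, Equiv.Perm.coe_one, MvPolynomial.rename_id, AlgHom.id_apply]

theorem permute_inv_permute (σ : Equiv.Perm ℕ) (f : RatFun) : permute σ⁻¹ (permute σ f) = f := by
  rw [← permute_mul, inv_mul_cancel, permute_one]

theorem permute_permute_inv (σ : Equiv.Perm ℕ) (f : RatFun) : permute σ (permute σ⁻¹ f) = f := by
  rw [← permute_mul, mul_inv_cancel, permute_one]

theorem der_permute (σ : Equiv.Perm ℕ) (i : ℕ) (f : RatFun) :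
    der (σ i) (permute σ f) = permute σ (der i f) := by
  obtain ⟨p, q, -, hq, rfl⟩ := exists_reduced f
  have hq' : MvPolynomial.rename σ q ≠ 0 := by
    rwa [Ne, map_eq_zero_iff _ (MvPolynomial.rename_injective σ σ.injective)]
  rw [map_div₀, permute_ofPoly, permute_ofPoly, der_div _ (ofPoly_ne_zero hq'),
    der_div _ (ofPoly_ne_zero hq)]
  simp only [der_ofPoly, MvPolynomial.pderiv_rename σ.injective, map_div₀, map_sub, map_mul,
    map_pow, permute_ofPoly]

theorem vars_permute (σ : Equiv.Perm ℕ) (f : RatFun) : vars (permute σ f) = σ '' vars f := by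
  ext i
  obtain ⟨i, rfl⟩ := σ.surjective i
  rw [mem_vars_iff, der_permute, σ.injective.mem_set_image, mem_vars_iff]
  simp

theorem Iso.refl (f : RatFun) : Iso f f := ⟨1, permute_one f⟩

theorem Iso.symm {f g : RatFun} (h : Iso f g) : Iso g f := by
  obtain ⟨σ, rfl⟩ := h
  exact ⟨σ⁻¹, permute_inv_permute σ f⟩

theorem Iso.trans {f g h : RatFun} (h₁ : Iso f g) (h₂ : Iso g h) : Iso f h := by
  obtain ⟨σ, rfl⟩ := h₁
  obtain ⟨τ, rfl⟩ := h₂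
  exact ⟨τ * σ, permute_mul τ σ f⟩

theorem Iso.neg {f g : RatFun} (h : Iso f g) : Iso (-f) (-g) := by
  obtain ⟨σ, rfl⟩ := h
  exact ⟨σ, map_neg _ _⟩

theorem iso_neg_comm {f g : RatFun} : Iso f (-g) ↔ Iso (-f) g :=
  ⟨fun h => by simpa using h.neg, fun h => by simpa using h.neg⟩

/-- Isomorphisms between the members of two families of functions in disjoint sets of variables
are induced by a single permutation. -/
theorem exists_permute_family {ι : Type} [Finite ι] {F G : ι → RatFun}
    (hF : Pairwise fun i j => Disjoint (vars (F i)) (vars (F j)))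
    (hG : Pairwise fun i j => Disjoint (vars (G i)) (vars (G j)))
    (h : ∀ i, Iso (F i) (G i)) : ∃ σ : Equiv.Perm ℕ, ∀ i, permute σ (F i) = G i := by
  choose τ hτ using h
  set s : Set ℕ := ⋃ i, vars (F i) with hs
  have hfin : s.Finite := Set.finite_iUnion fun i => vars_finite _
  choose k hk using fun x : s => Set.mem_iUnion.1 x.2
  have hmem : ∀ x : s, τ (k x) x ∈ vars (G (k x)) := fun x => by
    rw [← hτ, vars_permute]
    exact Set.mem_image_of_mem _ (hk x)
  -- The given permutations are glued along the disjoint sets `vars (F i)`. The result is injective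
  -- since the sets `vars (G i)` are disjoint too, and an injection of a finite set into ℕ extends
  -- to a permutation of ℕ.
  let φ : s ↪ ℕ := ⟨fun x => τ (k x) x, by
    intro x y hxy
    have hkk : k x = k y := by
      by_contra hne
      refine Set.disjoint_left.1 (hG hne) (hmem x) ?_
      simp only at hxy
      rw [hxy]
      exact hmem y
    simp only [hkk] at hxy
    exact Subtype.ext ((τ (k y)).injective hxy)⟩
  obtain ⟨σ, hσ⟩ := Cardinal.extend_function_of_lt φ
    (by
      have := hfin.to_subtype
      exact (Cardinal.mk_lt_aleph0).trans_le (Cardinal.aleph0_le_mk ℕ)) ⟨Equiv.refl ℕ⟩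
  refine ⟨σ, fun i => ?_⟩
  rw [← hτ i]
  apply permute_congr
  intro x hx
  have hxs : x ∈ s := Set.mem_iUnion.2 ⟨i, hx⟩
  have hki : k ⟨x, hxs⟩ = i := by
    by_contra hne
    exact Set.disjoint_left.1 (hF hne) (hk ⟨x, hxs⟩) hx
  have h1 : σ x = τ (k ⟨x, hxs⟩) x := hσ ⟨x, hxs⟩
  rw [h1, hki]

/-! ### Arithmetic expressions: basic facts -/

theorem IsAE.vars_nonempty {f : RatFun} (hf : IsAE f) : (vars f).Nonempty := by
  induction hf with
  | atom i => simp [vars_atom]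
  | op o g h _ _ hV ihg _ => rw [← hV.2]; exact ihg.inl

theorem IsAE.ne_zero {f : RatFun} (hf : IsAE f) : f ≠ 0 :=
  ne_zero_of_vars_nonempty hf.vars_nonempty

theorem IsAE.add {g h : RatFun} (hg : IsAE g) (hh : IsAE h) (hd : Disjoint (vars g) (vars h)) :
    IsAE (g + h) :=
  IsAE.op .plus g h hg hh ⟨hd, (vars_add hd).symm⟩

theorem IsAE.sub {g h : RatFun} (hg : IsAE g) (hh : IsAE h) (hd : Disjoint (vars g) (vars h)) :
    IsAE (g - h) :=
  IsAE.op .minus g h hg hh ⟨hd, (vars_sub hd).symm⟩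

theorem IsAE.mul {g h : RatFun} (hg : IsAE g) (hh : IsAE h) (hd : Disjoint (vars g) (vars h)) :
    IsAE (g * h) :=
  IsAE.op .times g h hg hh ⟨hd, (vars_mul hg.ne_zero hh.ne_zero hd).symm⟩

theorem IsAE.div {g h : RatFun} (hg : IsAE g) (hh : IsAE h) (hd : Disjoint (vars g) (vars h)) :
    IsAE (g / h) :=
  IsAE.op .divide g h hg hh ⟨hd, (vars_div hg.ne_zero hh.ne_zero hd).symm⟩

theorem disjoint_vars_permute {f g : RatFun} (σ : Equiv.Perm ℕ) (h : Disjoint (vars f) (vars g)) :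
    Disjoint (vars (permute σ f)) (vars (permute σ g)) := by
  rw [vars_permute, vars_permute]
  exact (Set.disjoint_image_iff σ.injective).2 h

theorem IsAE.permute {f : RatFun} (hf : IsAE f) (σ : Equiv.Perm ℕ) :
    IsAE (ArithExpr.permute σ f) := by
  induction hf with
  | atom i => rw [permute_atom]; exact IsAE.atom _
  | op o g h _ _ hV ihg ihh =>
    have hd := disjoint_vars_permute σ hV.1
    cases o <;> simp only [Op.apply, map_add, map_sub, map_mul, map_div₀]
    · exact ihg.add ihh hd
    · exact ihg.sub ihh hd
    · exact ihg.mul ihh hd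
    · exact ihg.div ihh hd

theorem isAE_permute_iff {f : RatFun} (σ : Equiv.Perm ℕ) : IsAE (permute σ f) ↔ IsAE f :=
  ⟨fun h => by simpa [permute_inv_permute] using h.permute σ⁻¹, fun h => h.permute σ⟩

theorem Iso.isAE_iff {f g : RatFun} (h : Iso f g) : IsAE f ↔ IsAE g := by
  obtain ⟨σ, rfl⟩ := h
  exact (isAE_permute_iff σ).symm

/-- The middle clause of the definition is automatic, as isomorphisms preserve arithmetic
expressions. -/
theorem isThirdType_iff {f : RatFun} : IsThirdType f ↔ IsAE f ∧ Iso f (-f) :=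
  ⟨fun h => ⟨h.1, h.2.2⟩, fun h => ⟨h.1, h.2.isAE_iff.1 h.1, h.2⟩⟩

/-- `f` is a sum of two nonconstant functions in disjoint sets of variables. -/
def AddDec (f : RatFun) : Prop :=
  ∃ g h : RatFun, f = g + h ∧ Disjoint (vars g) (vars h) ∧ (vars g).Nonempty ∧ (vars h).Nonempty

/-- `f` is a product of two nonconstant functions in disjoint sets of variables. -/
def MulDec (f : RatFun) : Prop :=
  ∃ g h : RatFun, f = g * h ∧ Disjoint (vars g) (vars h) ∧ (vars g).Nonempty ∧ (vars h).Nonempty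

theorem IsAE.atom_or_dec {f : RatFun} (hf : IsAE f) :
    (∃ i, f = ArithExpr.atom i) ∨ AddDec f ∨ MulDec f := by
  cases hf with
  | atom i => exact Or.inl ⟨i, rfl⟩
  | op o g h hg hh hV =>
    right
    cases o
    · exact Or.inl ⟨g, h, rfl, hV.1, hg.vars_nonempty, hh.vars_nonempty⟩
    · exact Or.inl ⟨g, -h, sub_eq_add_neg _ _, by rw [vars_neg]; exact hV.1, hg.vars_nonempty,
        by rw [vars_neg]; exact hh.vars_nonempty⟩
    · exact Or.inr ⟨g, h, rfl, hV.1, hg.vars_nonempty, hh.vars_nonempty⟩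
    · exact Or.inr ⟨g, h⁻¹, div_eq_mul_inv _ _, by rw [vars_inv]; exact hV.1, hg.vars_nonempty,
        by rw [vars_inv]; exact hh.vars_nonempty⟩

theorem AddDec.nontrivial {f : RatFun} (hf : AddDec f) : (vars f).Nontrivial := by
  obtain ⟨g, h, rfl, hd, ⟨i, hi⟩, ⟨j, hj⟩⟩ := hf
  rw [vars_add hd]
  exact ⟨i, Or.inl hi, j, Or.inr hj, fun e => Set.disjoint_left.1 hd hi (e ▸ hj)⟩

theorem MulDec.nontrivial {f : RatFun} (hf : MulDec f) : (vars f).Nontrivial := by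
  obtain ⟨g, h, rfl, hd, hg, hh⟩ := hf
  rw [vars_mul (ne_zero_of_vars_nonempty hg) (ne_zero_of_vars_nonempty hh) hd]
  obtain ⟨i, hi⟩ := hg
  obtain ⟨j, hj⟩ := hh
  exact ⟨i, Or.inl hi, j, Or.inr hj, fun e => Set.disjoint_left.1 hd hi (e ▸ hj)⟩

theorem not_addDec_atom (i : ℕ) : ¬ AddDec (atom i) := fun h => by
  simpa [vars_atom] using h.nontrivial

theorem not_mulDec_atom (i : ℕ) : ¬ MulDec (atom i) := fun h => by
  simpa [vars_atom] using h.nontrivial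

theorem IsAE.eq_atom {f : RatFun} {i : ℕ} (hf : IsAE f) (hi : vars f = {i}) :
    f = ArithExpr.atom i := by
  rcases hf.atom_or_dec with ⟨j, rfl⟩ | h | h
  · rw [vars_atom, Set.singleton_eq_singleton_iff] at hi
    rw [hi]
  · simpa [hi] using h.nontrivial
  · simpa [hi] using h.nontrivial

theorem AddDec.neg {f : RatFun} (hf : AddDec f) : AddDec (-f) := by
  obtain ⟨g, h, rfl, hd, hg, hh⟩ := hf
  exact ⟨-g, -h, by ring, by simpa [vars_neg] using hd, by rwa [vars_neg], by rwa [vars_neg]⟩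

theorem addDec_neg_iff {f : RatFun} : AddDec (-f) ↔ AddDec f :=
  ⟨fun h => by simpa using h.neg, AddDec.neg⟩

theorem MulDec.neg {f : RatFun} (hf : MulDec f) : MulDec (-f) := by
  obtain ⟨g, h, rfl, hd, hg, hh⟩ := hf
  exact ⟨-g, h, by ring, by simpa [vars_neg] using hd, by rwa [vars_neg], hh⟩

theorem mulDec_neg_iff {f : RatFun} : MulDec (-f) ↔ MulDec f :=
  ⟨fun h => by simpa using h.neg, MulDec.neg⟩

theorem AddDec.permute {f : RatFun} (hf : AddDec f) (σ : Equiv.Perm ℕ) :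
    AddDec (ArithExpr.permute σ f) := by
  obtain ⟨g, h, rfl, hd, hg, hh⟩ := hf
  refine ⟨ArithExpr.permute σ g, ArithExpr.permute σ h, map_add _ _ _,
    disjoint_vars_permute σ hd, ?_, ?_⟩ <;> rw [vars_permute]
  exacts [hg.image _, hh.image _]

theorem addDec_permute_iff {f : RatFun} (σ : Equiv.Perm ℕ) : AddDec (permute σ f) ↔ AddDec f :=
  ⟨fun h => by simpa [permute_inv_permute] using h.permute σ⁻¹, fun h => h.permute σ⟩

theorem MulDec.permute {f : RatFun} (hf : MulDec f) (σ : Equiv.Perm ℕ) :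
    MulDec (ArithExpr.permute σ f) := by
  obtain ⟨g, h, rfl, hd, hg, hh⟩ := hf
  refine ⟨ArithExpr.permute σ g, ArithExpr.permute σ h, map_mul _ _ _,
    disjoint_vars_permute σ hd, ?_, ?_⟩ <;> rw [vars_permute]
  exacts [hg.image _, hh.image _]

theorem mulDec_permute_iff {f : RatFun} (σ : Equiv.Perm ℕ) : MulDec (permute σ f) ↔ MulDec f :=
  ⟨fun h => by simpa [permute_inv_permute] using h.permute σ⁻¹, fun h => h.permute σ⟩

/-! ### Constants -/

theorem const_injective : Function.Injective const := fun _ _ h =>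
  MvPolynomial.C_injective _ _ (ofPoly_injective h)

theorem const_zero : const 0 = 0 := by rw [const, MvPolynomial.C_0, ofPoly_zero]

theorem const_one : const 1 = 1 := by rw [const, MvPolynomial.C_1, ofPoly_one]

theorem const_mul (a b : ℝ) : const (a * b) = const a * const b := by
  rw [const, MvPolynomial.C_mul, ofPoly_mul, const, const]

theorem const_neg (a : ℝ) : const (-a) = -const a := by
  rw [const, MvPolynomial.C_neg, ofPoly_neg, const]

theorem const_ne_zero {a : ℝ} (ha : a ≠ 0) : const a ≠ 0 := fun h =>
  ha (const_injective (h.trans const_zero.symm))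

theorem two_ne_zero_ratFun : (2 : RatFun) ≠ 0 := by
  have := const_ne_zero (two_ne_zero (α := ℝ))
  rwa [← one_add_one_eq_two, const, MvPolynomial.C_add, MvPolynomial.C_1, ofPoly_add,
    ofPoly_one, one_add_one_eq_two] at this

theorem der_const_mul (i : ℕ) (a : ℝ) (f : RatFun) :
    der i (const a * f) = const a * der i f := by
  rw [der_mul, der_const, mul_zero, add_zero]

theorem der_affine (i : ℕ) (a c : ℝ) (f : RatFun) :
    der i (const a * f + const c) = const a * der i f := by
  rw [map_add, der_const_mul, der_const, add_zero]

theorem vars_affine {a : ℝ} (ha : a ≠ 0) (c : ℝ) (f : RatFun) :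
    vars (const a * f + const c) = vars f := by
  ext i
  simp [mem_vars_iff, der_affine, const_ne_zero ha]

theorem vars_const_mul {a : ℝ} (ha : a ≠ 0) (f : RatFun) : vars (const a * f) = vars f := by
  simpa [const_zero] using vars_affine ha 0 f

/-! ### Connectedness of the graph of mixed derivatives -/

/-- The graph on `V` whose edges are given by the nonvanishing of `∂ v_j / ∂ x_i` is connected. -/
def Conn (V : Set ℕ) (v : ℕ → RatFun) : Prop :=
  ∀ T : Set ℕ, (∃ i ∈ V, i ∈ T) → (∃ j ∈ V, j ∉ T) →
    ∃ i ∈ V, ∃ j ∈ V, i ∈ T ∧ j ∉ T ∧ der i (v j) ≠ 0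

/-- The logarithmic derivative. -/
def lder (i : ℕ) (f : RatFun) : RatFun := der i f / f

/-- A graph that contains the complete bipartite graph on two nonempty parts is connected. -/
theorem conn_of_cross {A B : Set ℕ} (hA : A.Nonempty) (hB : B.Nonempty)
    {v : ℕ → RatFun} (h : ∀ i ∈ A, ∀ j ∈ B, der i (v j) ≠ 0 ∧ der j (v i) ≠ 0) :
    Conn (A ∪ B) v := by
  obtain ⟨a, ha⟩ := hA
  obtain ⟨b, hb⟩ := hB
  intro T hT hT'
  have key : ∃ i ∈ A, ∃ j ∈ B, (i ∈ T ∧ j ∉ T) ∨ (j ∈ T ∧ i ∉ T) := by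
    obtain ⟨t, ht, htT⟩ := hT
    obtain ⟨s, hs, hsT⟩ := hT'
    by_cases haT : a ∈ T <;> by_cases hbT : b ∈ T
    · rcases hs with hs | hs
      · exact ⟨s, hs, b, hb, Or.inr ⟨hbT, hsT⟩⟩
      · exact ⟨a, ha, s, hs, Or.inl ⟨haT, hsT⟩⟩
    · exact ⟨a, ha, b, hb, Or.inl ⟨haT, hbT⟩⟩
    · exact ⟨a, ha, b, hb, Or.inr ⟨hbT, haT⟩⟩
    · rcases ht with ht | ht
      · exact ⟨t, ht, b, hb, Or.inl ⟨htT, hbT⟩⟩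
      · exact ⟨a, ha, t, ht, Or.inr ⟨htT, haT⟩⟩
  obtain ⟨i, hi, j, hj, ⟨h1, h2⟩ | ⟨h1, h2⟩⟩ := key
  · exact ⟨i, Or.inl hi, j, Or.inr hj, h1, h2, (h i hi j hj).1⟩
  · exact ⟨j, Or.inr hj, i, Or.inl hi, h1, h2, (h i hi j hj).2⟩

theorem Conn.congr {V : Set ℕ} {v w : ℕ → RatFun} (h : Conn V v) (hvw : ∀ i, v i = w i) :
    Conn V w := by
  rwa [← funext hvw]

theorem Conn.const_mul {V : Set ℕ} {v : ℕ → RatFun} (h : Conn V v) {a : ℝ} (ha : a ≠ 0) :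
    Conn V fun i => const a * v i := by
  intro T hT hT'
  obtain ⟨i, hi, j, hj, h1, h2, h3⟩ := h T hT hT'
  refine ⟨i, hi, j, hj, h1, h2, ?_⟩
  rw [der_const_mul]
  exact mul_ne_zero (const_ne_zero ha) h3

theorem conn_singleton (i : ℕ) (v : ℕ → RatFun) : Conn {i} v := by
  rintro T ⟨a, rfl, ha⟩ ⟨b, rfl, hb⟩
  exact absurd ha hb

theorem der_der_eq_zero {f : RatFun} {i : ℕ} (j : ℕ) (h : i ∉ vars f) : der i (der j f) = 0 := by
  rw [der_comm, notMem_vars_iff.1 h, map_zero]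

theorem der_lder_eq_zero {f : RatFun} {i : ℕ} (j : ℕ) (h : i ∉ vars f) : der i (lder j f) = 0 := by
  rw [lder, div_eq_mul_inv, der_mul, der_inv, der_der_eq_zero j h, notMem_vars_iff.1 h]
  simp

theorem lder_mul {f g : RatFun} (hf : f ≠ 0) (hg : g ≠ 0) (i : ℕ) :
    lder i (f * g) = lder i f + lder i g := by
  simp only [lder, der_mul]
  field_simp
  ring

theorem lder_inv {f : RatFun} (hf : f ≠ 0) (i : ℕ) : lder i f⁻¹ = -lder i f := by
  simp only [lder, der_inv]
  field_simp

theorem lder_const_mul {a : ℝ} (ha : a ≠ 0) (f : RatFun) (i : ℕ) :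
    lder i (const a * f) = lder i f := by
  rw [lder, lder, der_const_mul, mul_div_mul_left _ _ (const_ne_zero ha)]

theorem lder_eq_zero {f : RatFun} {i : ℕ} (h : i ∉ vars f) : lder i f = 0 := by
  rw [lder, notMem_vars_iff.1 h, zero_div]

theorem lder_ne_zero {f : RatFun} {i : ℕ} (h : i ∈ vars f) : lder i f ≠ 0 :=
  div_ne_zero (mem_vars_iff.1 h) (ne_zero_of_vars_nonempty ⟨i, h⟩)

theorem der_lder_add_const {g h : RatFun} {c : ℝ} (hd : Disjoint (vars g) (vars h))
    (h0 : g * h + const c ≠ 0) {i j : ℕ} (hi : i ∈ vars g) (hj : j ∈ vars h) :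
    der i (lder j (g * h + const c)) =
      const c * (der i g * der j h) / (g * h + const c) ^ 2 := by
  have h1 : der i h = 0 := notMem_vars_iff.1 (Set.disjoint_left.1 hd hi)
  have h2 : der j g = 0 := notMem_vars_iff.1 (Set.disjoint_right.1 hd hj)
  have h3 : der i (der j h) = 0 := der_der_eq_zero j (Set.disjoint_left.1 hd hi)
  have h4 : der j (g * h + const c) = g * der j h := by
    rw [map_add, der_const, der_mul, h2, mul_zero, add_zero, add_zero]
  have h5 : der i (g * h + const c) = h * der i g := by
    rw [map_add, der_const, der_mul, h1, mul_zero, zero_add, add_zero]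
  rw [lder, der_div i h0, h4, h5, der_mul, h3]
  congr 1
  ring

/-- Across the two factors the mixed derivative is ∂_i g · ∂_j h, which never vanishes. -/
theorem MulDec.conn_der {f : RatFun} (hf : MulDec f) : Conn (vars f) fun j => der j f := by
  obtain ⟨g, h, rfl, hd, hg, hh⟩ := hf
  rw [vars_mul (ne_zero_of_vars_nonempty hg) (ne_zero_of_vars_nonempty hh) hd]
  refine conn_of_cross hg hh fun i hi j hj => ?_
  have h1 : der i h = 0 := notMem_vars_iff.1 (Set.disjoint_left.1 hd hi)
  have h2 : der j g = 0 := notMem_vars_iff.1 (Set.disjoint_right.1 hd hj)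
  have h3 : der i (der j (g * h)) ≠ 0 := by
    rw [der_mul j, h2, mul_zero, add_zero, der_mul, der_der_eq_zero j (notMem_vars_iff.2 h1),
      mul_zero, zero_add]
    exact mul_ne_zero (mem_vars_iff.1 hj) (mem_vars_iff.1 hi)
  exact ⟨h3, by rwa [der_comm]⟩

/-- It serves rigidity: a product shifted by a nonzero constant cannot again be a product, whose
logarithmic graph is disconnected. -/
theorem MulDec.conn_lder_add_const {f : RatFun} (hf : MulDec f) {c : ℝ} (hc : c ≠ 0) :
    Conn (vars f) fun j => lder j (f + const c) := by
  have hne : f + const c ≠ 0 := by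
    intro h0
    obtain ⟨i, hi⟩ := hf.nontrivial.nonempty
    apply mem_vars_iff.1 hi
    have := congrArg (der i) h0
    rwa [map_add, der_const, add_zero, map_zero] at this
  obtain ⟨g, h, rfl, hd, hg, hh⟩ := hf
  rw [vars_mul (ne_zero_of_vars_nonempty hg) (ne_zero_of_vars_nonempty hh) hd]
  refine conn_of_cross hg hh fun i hi j hj => ?_
  have hi' := mem_vars_iff.1 hi
  have hj' := mem_vars_iff.1 hj
  constructor
  · rw [der_lder_add_const hd hne hi hj]
    exact div_ne_zero (mul_ne_zero (const_ne_zero hc) (mul_ne_zero hi' hj')) (pow_ne_zero 2 hne)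
  · rw [mul_comm g h] at hne ⊢
    rw [der_lder_add_const hd.symm hne hj hi]
    exact div_ne_zero (mul_ne_zero (const_ne_zero hc) (mul_ne_zero hj' hi')) (pow_ne_zero 2 hne)

theorem der_lder_add {g h : RatFun} (hd : Disjoint (vars g) (vars h)) (h0 : g + h ≠ 0) {i j : ℕ}
    (hi : i ∈ vars g) (hj : j ∈ vars h) :
    der i (lder j (g + h)) = -(der i g * der j h) / (g + h) ^ 2 := by
  have h1 : der i h = 0 := notMem_vars_iff.1 (Set.disjoint_left.1 hd hi)
  have h2 : der j g = 0 := notMem_vars_iff.1 (Set.disjoint_right.1 hd hj)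
  have h3 : der i (der j h) = 0 := der_der_eq_zero j (Set.disjoint_left.1 hd hi)
  rw [lder, map_add, h2, zero_add, der_div i h0, map_add, h1, h3]
  congr 1
  ring

theorem AddDec.conn_lder {f : RatFun} (hf : AddDec f) : Conn (vars f) fun j => lder j f := by
  have hne := ne_zero_of_vars_nonempty hf.nontrivial.nonempty
  obtain ⟨g, h, rfl, hd, hg, hh⟩ := hf
  rw [vars_add hd]
  refine conn_of_cross hg hh fun i hi j hj => ?_
  have hi' := mem_vars_iff.1 hi
  have hj' := mem_vars_iff.1 hj
  constructor
  · rw [der_lder_add hd hne hi hj]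
    exact div_ne_zero (neg_ne_zero.2 (mul_ne_zero hi' hj')) (pow_ne_zero 2 hne)
  · rw [add_comm g h] at hne ⊢
    rw [der_lder_add hd.symm hne hj hi]
    exact div_ne_zero (neg_ne_zero.2 (mul_ne_zero hj' hi')) (pow_ne_zero 2 hne)

/-- It serves `IsFactor.lder_ne_neg`: the inverse of a sum, even after scaling, is not a sum. -/
theorem AddDec.conn_der_inv {f : RatFun} (hf : AddDec f) : Conn (vars f) fun j => der j f⁻¹ := by
  have hne := ne_zero_of_vars_nonempty hf.nontrivial.nonempty
  obtain ⟨g, h, rfl, hd, hg, hh⟩ := hf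
  rw [vars_add hd]
  refine conn_of_cross hg hh fun i hi j hj => ?_
  have h1 : der i h = 0 := notMem_vars_iff.1 (Set.disjoint_left.1 hd hi)
  have h2 : der j g = 0 := notMem_vars_iff.1 (Set.disjoint_right.1 hd hj)
  have h3 : der i (der j h) = 0 := der_der_eq_zero j (Set.disjoint_left.1 hd hi)
  have h4 : der i (der j (g + h)⁻¹) = 2 * (der i g * der j h) / (g + h) ^ 3 := by
    rw [der_inv, map_neg, der_div i (pow_ne_zero 2 hne), pow_two, der_mul, map_add, map_add, map_add,
      h2, h1, h3, map_zero]
    field_simp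
    ring
  have h5 : der i (der j (g + h)⁻¹) ≠ 0 := by
    rw [h4]
    exact div_ne_zero (mul_ne_zero two_ne_zero_ratFun
      (mul_ne_zero (mem_vars_iff.1 hi) (mem_vars_iff.1 hj))) (pow_ne_zero 3 hne)
  exact ⟨h5, by rwa [der_comm]⟩

/-- No edge leaves the variables of one summand. -/
theorem AddDec.not_conn_der {f : RatFun} (hf : AddDec f) : ¬ Conn (vars f) fun j => der j f := by
  obtain ⟨g, h, rfl, hd, ⟨a, ha⟩, ⟨b, hb⟩⟩ := hf
  rw [vars_add hd]
  intro hc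
  obtain ⟨i, -, j, hj, hi, hjg, hij⟩ := hc (vars g) ⟨a, Or.inl ha, ha⟩
    ⟨b, Or.inr hb, Set.disjoint_right.1 hd hb⟩
  apply hij
  simp only
  rw [map_add, notMem_vars_iff.1 hjg, zero_add, der_der_eq_zero j (Set.disjoint_left.1 hd hi)]

theorem MulDec.not_conn_lder {f : RatFun} (hf : MulDec f) : ¬ Conn (vars f) fun j => lder j f := by
  obtain ⟨g, h, rfl, hd, hg, hh⟩ := hf
  have hg0 := ne_zero_of_vars_nonempty hg
  have hh0 := ne_zero_of_vars_nonempty hh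
  rw [vars_mul hg0 hh0 hd]
  obtain ⟨a, ha⟩ := hg
  obtain ⟨b, hb⟩ := hh
  intro hc
  obtain ⟨i, -, j, hj, hi, hjg, hij⟩ := hc (vars g) ⟨a, Or.inl ha, ha⟩
    ⟨b, Or.inr hb, Set.disjoint_right.1 hd hb⟩
  apply hij
  simp only
  rw [lder_mul hg0 hh0, lder_eq_zero hjg, zero_add, der_lder_eq_zero j (Set.disjoint_left.1 hd hi)]

theorem AddDec.not_mulDec {f : RatFun} (hf : AddDec f) : ¬ MulDec f := fun h =>
  h.not_conn_lder hf.conn_lder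

/-! ### Families of functions in disjoint sets of variables -/

/-- The members of `S` are functions in disjoint sets of variables. -/
def DisjVars (S : Finset RatFun) : Prop := (S : Set RatFun).PairwiseDisjoint vars

theorem DisjVars.subset {S T : Finset RatFun} (h : DisjVars T) (hST : S ⊆ T) : DisjVars S :=
  Set.PairwiseDisjoint.subset h (Finset.coe_subset.2 hST)

theorem DisjVars.disjoint {S : Finset RatFun} (h : DisjVars S) {X Y : RatFun} (hX : X ∈ S)
    (hY : Y ∈ S) (hne : X ≠ Y) : Disjoint (vars X) (vars Y) := h hX hY hne

theorem DisjVars.eq_of_mem {S : Finset RatFun} (h : DisjVars S) {X Y : RatFun} (hX : X ∈ S)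
    (hY : Y ∈ S) {i : ℕ} (hiX : i ∈ vars X) (hiY : i ∈ vars Y) : X = Y := by
  by_contra hne
  exact Set.disjoint_left.1 (h.disjoint hX hY hne) hiX hiY

theorem DisjVars.eq_of_vars {S : Finset RatFun} (h : DisjVars S) {X Y : RatFun} (hX : X ∈ S)
    (hY : Y ∈ S) (hn : (vars X).Nonempty) (he : vars X = vars Y) : X = Y := by
  obtain ⟨i, hi⟩ := hn
  exact h.eq_of_mem hX hY hi (he ▸ hi)

theorem disjVars_singleton (X : RatFun) : DisjVars {X} := by
  simp [DisjVars]

theorem disjVars_insert {S : Finset RatFun} [DecidableEq RatFun] {X : RatFun} (hX : X ∉ S) :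
    DisjVars (insert X S) ↔ DisjVars S ∧ ∀ Y ∈ S, Disjoint (vars X) (vars Y) := by
  rw [DisjVars, Finset.coe_insert, Set.pairwiseDisjoint_insert_of_notMem (by simpa using hX)]
  rfl

theorem vars_sum {S : Finset RatFun} (h : DisjVars S) :
    vars (∑ X ∈ S, X) = ⋃ X ∈ S, vars X := by
  classical
  induction S using Finset.induction_on with
  | empty => simpa [const_zero] using vars_const 0
  | insert X S hX ih =>
    obtain ⟨h1, h2⟩ := (disjVars_insert hX).1 h
    rw [Finset.sum_insert hX, vars_add, ih h1, Finset.set_biUnion_insert]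
    rw [ih h1]
    simpa using h2

theorem vars_prod {S : Finset RatFun} (h : DisjVars S) (h0 : ∀ X ∈ S, X ≠ 0) :
    vars (∏ X ∈ S, X) = ⋃ X ∈ S, vars X := by
  classical
  induction S using Finset.induction_on with
  | empty => simpa [const_one] using vars_const 1
  | insert X S hX ih =>
    obtain ⟨h1, h2⟩ := (disjVars_insert hX).1 h
    have h3 := ih h1 fun Y hY => h0 Y (Finset.mem_insert_of_mem hY)
    rw [Finset.prod_insert hX, vars_mul (h0 X (Finset.mem_insert_self _ _)), h3,
      Finset.set_biUnion_insert]
    · exact Finset.prod_ne_zero_iff.2 fun Y hY => h0 Y (Finset.mem_insert_of_mem hY)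
    · rw [h3]
      simpa using h2

theorem disjoint_biUnion_vars {S T : Finset RatFun} [DecidableEq RatFun]
    (h : DisjVars (S ∪ T)) (hd : Disjoint S T) :
    Disjoint (⋃ X ∈ S, vars X) (⋃ X ∈ T, vars X) := by
  simp only [Set.disjoint_iUnion_left, Set.disjoint_iUnion_right]
  intro Y hY X hX
  exact h.disjoint (Finset.mem_union_left _ hX) (Finset.mem_union_right _ hY)
    fun e => Finset.disjoint_left.1 hd hX (e ▸ hY)

theorem DisjVars.union {S T : Finset RatFun} [DecidableEq RatFun] (hS : DisjVars S)
    (hT : DisjVars T) (h : Disjoint (⋃ X ∈ S, vars X) (⋃ X ∈ T, vars X)) : DisjVars (S ∪ T) := by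
  simp only [Set.disjoint_iUnion_left, Set.disjoint_iUnion_right] at h
  intro X hX Y hY hne
  rcases Finset.mem_union.1 hX with hX | hX <;> rcases Finset.mem_union.1 hY with hY | hY
  · exact hS hX hY hne
  · exact h Y hY X hX
  · exact (h X hX Y hY).symm
  · exact hT hX hY hne

theorem disjoint_of_disjoint_biUnion_vars {S T : Finset RatFun}
    (hS : ∀ X ∈ S, (vars X).Nonempty)
    (h : Disjoint (⋃ X ∈ S, vars X) (⋃ X ∈ T, vars X)) : Disjoint S T := by
  rw [Finset.disjoint_left]
  intro X hX hX'
  obtain ⟨i, hi⟩ := hS X hX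
  exact Set.disjoint_left.1 h (Set.mem_biUnion hX hi) (Set.mem_biUnion hX' hi)

theorem sum_eq_of_mem {S : Finset RatFun} (hS : DisjVars S) {v : RatFun → ℕ → RatFun}
    (hv : ∀ X ∈ S, ∀ i, i ∉ vars X → v X i = 0) {X : RatFun} (hX : X ∈ S) {i : ℕ}
    (hi : i ∈ vars X) : ∑ Y ∈ S, v Y i = v X i := by
  apply Finset.sum_eq_single_of_mem X hX
  intro Y hY hne
  exact hv Y hY i fun h => hne (hS.eq_of_mem hY hX h hi)

/-- A family of vectors `v X`, with connected graphs on the disjoint sets `𝒱(X)`, is determined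
by the sum of its members. -/
theorem match_of_conn {S S' : Finset RatFun} {v v' : RatFun → ℕ → RatFun}
    (hS : DisjVars S) (hS' : DisjVars S') (hne : ∀ X ∈ S, (vars X).Nonempty)
    (hv : ∀ X ∈ S, ∀ i, v X i ≠ 0 ↔ i ∈ vars X) (hv' : ∀ X ∈ S', ∀ i, v' X i ≠ 0 ↔ i ∈ vars X)
    (hd : ∀ X ∈ S, ∀ i j, i ∉ vars X → der i (v X j) = 0)
    (hd' : ∀ X ∈ S', ∀ i j, i ∉ vars X → der i (v' X j) = 0)
    (hc : ∀ X ∈ S, Conn (vars X) (v X)) (hc' : ∀ X ∈ S', Conn (vars X) (v' X))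
    (hsum : ∀ i, ∑ X ∈ S, v X i = ∑ X ∈ S', v' X i) :
    ∀ X ∈ S, ∃ X' ∈ S', vars X' = vars X ∧ ∀ i, v' X' i = v X i := by
  have h0 : ∀ {S : Finset RatFun} {v : RatFun → ℕ → RatFun},
      (∀ X ∈ S, ∀ i, v X i ≠ 0 ↔ i ∈ vars X) → ∀ X ∈ S, ∀ i, i ∉ vars X → v X i = 0 :=
    fun h X hX i hi => not_not.1 (mt (h X hX i).1 hi)
  -- Suppose `vars X` meets `vars X'` without lying inside it. Connectedness gives an edge from some
  -- i inside `vars X'` to some j outside. At j the second sum is the entry of a single member Y,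
  -- which must depend on x_i for the edge to exist; then Y = X', contradicting the choice of j.
  have key : ∀ {S S' : Finset RatFun} {v v' : RatFun → ℕ → RatFun},
      DisjVars S → DisjVars S' → (∀ X ∈ S, ∀ i, v X i ≠ 0 ↔ i ∈ vars X) →
      (∀ X ∈ S', ∀ i, v' X i ≠ 0 ↔ i ∈ vars X) →
      (∀ X ∈ S', ∀ i j, i ∉ vars X → der i (v' X j) = 0) →
      (∀ X ∈ S, Conn (vars X) (v X)) →
      (∀ i, ∑ X ∈ S, v X i = ∑ X ∈ S', v' X i) →
      ∀ X ∈ S, ∀ X' ∈ S', (∃ i, i ∈ vars X ∧ i ∈ vars X') → vars X ⊆ vars X' := by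
    intro S S' v v' hS hS' hv hv' hd' hc hsum X hX X' hX' ⟨a, haX, haX'⟩
    by_contra hsub
    obtain ⟨b, hbX, hbX'⟩ := Set.not_subset.1 hsub
    obtain ⟨i, hi, j, hj, hiT, hjT, hij⟩ := hc X hX (vars X') ⟨a, haX, haX'⟩ ⟨b, hbX, hbX'⟩
    have h1 := sum_eq_of_mem hS (h0 hv) hX hj
    have h2 : ∑ Y ∈ S', v' Y j ≠ 0 := by
      rw [← hsum, h1]
      exact (hv X hX j).2 hj
    obtain ⟨Y, hY, hYj⟩ := Finset.exists_ne_zero_of_sum_ne_zero h2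
    have hjY := (hv' Y hY j).1 hYj
    have h3 := sum_eq_of_mem hS' (h0 hv') hY hjY
    rw [← h1, hsum, h3] at hij
    refine hij (hd' Y hY i j fun hiY => ?_)
    rw [hS'.eq_of_mem hX' hY hiT hiY] at hjT
    exact hjT hjY
  intro X hX
  obtain ⟨i, hi⟩ := hne X hX
  have h2 : ∑ Y ∈ S', v' Y i ≠ 0 := by
    rw [← hsum, sum_eq_of_mem hS (h0 hv) hX hi]
    exact (hv X hX i).2 hi
  obtain ⟨X', hX', hne'⟩ := Finset.exists_ne_zero_of_sum_ne_zero h2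
  have hiX' := (hv' X' hX' i).1 hne'
  have he : vars X' = vars X := Set.Subset.antisymm
    (key hS' hS hv' hv hd hc' (fun i => (hsum i).symm) X' hX' X hX ⟨i, hiX', hi⟩)
    (key hS hS' hv hv' hd' hc hsum X hX X' hX' ⟨i, hi, hiX'⟩)
  refine ⟨X', hX', he, fun j => ?_⟩
  by_cases hj : j ∈ vars X
  · rw [← sum_eq_of_mem hS (h0 hv) hX hj, hsum, sum_eq_of_mem hS' (h0 hv') hX' (he ▸ hj)]
  · rw [h0 hv X hX j hj, h0 hv' X' hX' j (by rwa [he])]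

open scoped Classical

/-! ### Decompositions into summands and factors -/

/-- A summand is, up to sign, an arithmetic expression that is not additively decomposable. -/
def IsSummand (X : RatFun) : Prop := (IsAE X ∨ IsAE (-X)) ∧ ¬ AddDec X

/-- A factor is an arithmetic expression that is not multiplicatively decomposable. -/
def IsFactor (X : RatFun) : Prop := IsAE X ∧ ¬ MulDec X

theorem isFactor_atom (i : ℕ) : IsFactor (atom i) := ⟨IsAE.atom i, not_mulDec_atom i⟩

theorem IsSummand.neg {X : RatFun} (hX : IsSummand X) : IsSummand (-X) :=
  ⟨by simpa using hX.1.symm, by rw [addDec_neg_iff]; exact hX.2⟩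

theorem IsSummand.permute {X : RatFun} (hX : IsSummand X) (σ : Equiv.Perm ℕ) :
    IsSummand (permute σ X) := by
  refine ⟨?_, by rw [addDec_permute_iff]; exact hX.2⟩
  rw [← map_neg, isAE_permute_iff, isAE_permute_iff]
  exact hX.1

theorem IsSummand.vars_nonempty {X : RatFun} (hX : IsSummand X) : (vars X).Nonempty := by
  rcases hX.1 with h | h
  · exact h.vars_nonempty
  · simpa [vars_neg] using h.vars_nonempty

/-- A summand either has a single variable, so that its graph is one vertex, or is a product. -/
theorem IsSummand.conn {X : RatFun} (hX : IsSummand X) : Conn (vars X) fun j => der j X := by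
  have key : ∀ Y : RatFun, IsAE Y → ¬ AddDec Y → vars Y = vars X → (∃ i, vars X = {i}) ∨ MulDec Y := by
    intro Y hY hYd hv
    rcases hY.atom_or_dec with ⟨i, rfl⟩ | h | h
    · exact Or.inl ⟨i, by rw [← hv, vars_atom]⟩
    · exact absurd h hYd
    · exact Or.inr h
  have h : (∃ i, vars X = {i}) ∨ MulDec X := by
    rcases hX.1 with h | h
    · exact key X h hX.2 rfl
    · simpa only [mulDec_neg_iff] using key (-X) h (by rw [addDec_neg_iff]; exact hX.2) (vars_neg X)
  rcases h with ⟨i, hi⟩ | h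
  · rw [hi]
    exact conn_singleton _ _
  · exact h.conn_der

theorem IsFactor.atom_or_addDec {X : RatFun} (hX : IsFactor X) : (∃ i, X = atom i) ∨ AddDec X := by
  rcases hX.1.atom_or_dec with h | h | h
  exacts [Or.inl h, Or.inr h, absurd h hX.2]

theorem IsFactor.conn {X : RatFun} (hX : IsFactor X) : Conn (vars X) fun j => lder j X := by
  rcases hX.atom_or_addDec with ⟨i, rfl⟩ | h
  · rw [vars_atom]
    exact conn_singleton _ _
  · exact h.conn_lder

/-- `f` is the sum of the set `S` of summands in disjoint sets of variables. -/
structure IsSumOf (f : RatFun) (S : Finset RatFun) : Prop where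
  disj : DisjVars S
  summand : ∀ X ∈ S, IsSummand X
  eq : f = ∑ X ∈ S, X

/-- `f` is the product of the set `P` of factors divided by that of the set `N` of factors, all of
them in disjoint sets of variables. -/
structure IsFracOf (f : RatFun) (P N : Finset RatFun) : Prop where
  disj : DisjVars (P ∪ N)
  disjoint : Disjoint P N
  factor : ∀ X ∈ P ∪ N, IsFactor X
  eq : f = (∏ X ∈ P, X) / ∏ X ∈ N, X

theorem IsSumOf.vars_eq {f : RatFun} {S : Finset RatFun} (h : IsSumOf f S) :
    vars f = ⋃ X ∈ S, vars X := by
  rw [h.eq, vars_sum h.disj]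

theorem IsSumOf.singleton {X : RatFun} (hX : IsSummand X) : IsSumOf X {X} :=
  ⟨disjVars_singleton X, by simpa using hX, by simp⟩

theorem IsSumOf.disjoint {f g : RatFun} {S T : Finset RatFun} (hf : IsSumOf f S)
    (hg : IsSumOf g T) (hd : Disjoint (vars f) (vars g)) : Disjoint S T := by
  rw [hf.vars_eq, hg.vars_eq] at hd
  exact disjoint_of_disjoint_biUnion_vars (fun X hX => (hf.summand X hX).vars_nonempty) hd

theorem IsSumOf.add {f g : RatFun} {S T : Finset RatFun} (hf : IsSumOf f S)
    (hg : IsSumOf g T) (hd : Disjoint (vars f) (vars g)) : IsSumOf (f + g) (S ∪ T) := by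
  refine ⟨hf.disj.union hg.disj (by rwa [← hf.vars_eq, ← hg.vars_eq]), fun X hX => ?_, ?_⟩
  · rcases Finset.mem_union.1 hX with h | h
    exacts [hf.summand X h, hg.summand X h]
  · rw [Finset.sum_union (hf.disjoint hg hd), ← hf.eq, ← hg.eq]

theorem IsSumOf.neg {f : RatFun} {S : Finset RatFun} (hf : IsSumOf f S) :
    IsSumOf (-f) (S.image fun X => -X) := by
  refine ⟨?_, ?_, ?_⟩
  · intro X hX Y hY hne
    obtain ⟨X, hXS, rfl⟩ := Finset.mem_image.1 hX
    obtain ⟨Y, hYS, rfl⟩ := Finset.mem_image.1 hY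
    simp only [Function.onFun, vars_neg]
    exact hf.disj.disjoint hXS hYS fun e => hne (by rw [e])
  · intro X hX
    obtain ⟨X, hXS, rfl⟩ := Finset.mem_image.1 hX
    exact (hf.summand X hXS).neg
  · rw [Finset.sum_image (by simp), hf.eq, Finset.sum_neg_distrib]

theorem IsSumOf.permute {f : RatFun} {S : Finset RatFun} (hf : IsSumOf f S) (σ : Equiv.Perm ℕ) :
    IsSumOf (permute σ f) (S.image (permute σ)) := by
  refine ⟨?_, ?_, ?_⟩
  · intro X hX Y hY hne
    obtain ⟨X, hXS, rfl⟩ := Finset.mem_image.1 hX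
    obtain ⟨Y, hYS, rfl⟩ := Finset.mem_image.1 hY
    exact disjoint_vars_permute σ (hf.disj.disjoint hXS hYS fun e => hne (by rw [e]))
  · intro X hX
    obtain ⟨X, hXS, rfl⟩ := Finset.mem_image.1 hX
    exact (hf.summand X hXS).permute σ
  · rw [Finset.sum_image (by simp), hf.eq, map_sum]

theorem IsSumOf.subset {f : RatFun} {S T : Finset RatFun} (hf : IsSumOf f S) (hT : T ⊆ S) :
    IsSumOf (∑ X ∈ T, X) T :=
  ⟨hf.disj.subset hT, fun X hX => hf.summand X (hT hX), rfl⟩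

theorem IsFracOf.singleton {X : RatFun} (hX : IsFactor X) : IsFracOf X {X} ∅ :=
  ⟨by simpa using disjVars_singleton X, by simp, by simpa using hX, by simp⟩

theorem IsFracOf.ne_zero {f : RatFun} {P N : Finset RatFun} (h : IsFracOf f P N) :
    ∀ X ∈ P ∪ N, X ≠ 0 := fun X hX => (h.factor X hX).1.ne_zero

theorem IsFracOf.prod_ne_zero {f : RatFun} {P N : Finset RatFun} (h : IsFracOf f P N) :
    ∏ X ∈ P, X ≠ 0 ∧ ∏ X ∈ N, X ≠ 0 :=
  ⟨Finset.prod_ne_zero_iff.2 fun X hX => h.ne_zero X (Finset.mem_union_left _ hX),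
    Finset.prod_ne_zero_iff.2 fun X hX => h.ne_zero X (Finset.mem_union_right _ hX)⟩

theorem IsFracOf.vars_eq {f : RatFun} {P N : Finset RatFun} (h : IsFracOf f P N) :
    vars f = ⋃ X ∈ P ∪ N, vars X := by
  have h1 := vars_prod (h.disj.subset Finset.subset_union_left)
    fun X hX => h.ne_zero X (Finset.mem_union_left _ hX)
  have h2 := vars_prod (h.disj.subset Finset.subset_union_right)
    fun X hX => h.ne_zero X (Finset.mem_union_right _ hX)
  rw [h.eq, vars_div h.prod_ne_zero.1 h.prod_ne_zero.2, h1, h2, Finset.set_biUnion_union]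
  rw [h1, h2]
  exact disjoint_biUnion_vars h.disj h.disjoint

theorem IsFracOf.inv {f : RatFun} {P N : Finset RatFun} (h : IsFracOf f P N) :
    IsFracOf f⁻¹ N P := by
  refine ⟨?_, h.disjoint.symm, ?_, ?_⟩
  · rw [Finset.union_comm]; exact h.disj
  · rw [Finset.union_comm]; exact h.factor
  · rw [h.eq, inv_div]

theorem IsFracOf.mul {f g : RatFun} {P N P' N' : Finset RatFun} (hf : IsFracOf f P N)
    (hg : IsFracOf g P' N') (hd : Disjoint (vars f) (vars g)) :
    IsFracOf (f * g) (P ∪ P') (N ∪ N') := by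
  have hu : (P ∪ P') ∪ (N ∪ N') = (P ∪ N) ∪ (P' ∪ N') := by
    ext; simp only [Finset.mem_union]; tauto
  have hdd : Disjoint (P ∪ N) (P' ∪ N') := by
    apply disjoint_of_disjoint_biUnion_vars fun X hX => (hf.factor X hX).1.vars_nonempty
    rwa [← hf.vars_eq, ← hg.vars_eq]
  refine ⟨?_, ?_, ?_, ?_⟩
  · rw [hu]
    exact hf.disj.union hg.disj (by rwa [← hf.vars_eq, ← hg.vars_eq])
  · simp only [Finset.disjoint_union_left, Finset.disjoint_union_right] at hdd ⊢
    exact ⟨⟨hf.disjoint, hdd.1.2.symm⟩, hdd.2.1, hg.disjoint⟩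
  · rw [hu]
    intro X hX
    rcases Finset.mem_union.1 hX with h | h
    exacts [hf.factor X h, hg.factor X h]
  · simp only [Finset.disjoint_union_left, Finset.disjoint_union_right] at hdd
    rw [Finset.prod_union hdd.1.1, Finset.prod_union hdd.2.2, hf.eq, hg.eq]
    exact div_mul_div_comm _ _ _ _

theorem IsFracOf.div {f g : RatFun} {P N P' N' : Finset RatFun} (hf : IsFracOf f P N)
    (hg : IsFracOf g P' N') (hd : Disjoint (vars f) (vars g)) :
    IsFracOf (f / g) (P ∪ N') (N ∪ P') := by
  rw [div_eq_mul_inv]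
  exact hf.mul hg.inv (by rwa [vars_inv])

theorem IsFracOf.num {f : RatFun} {P N P' : Finset RatFun} (h : IsFracOf f P N)
    (hP : P' ⊆ P ∪ N) : IsFracOf (∏ X ∈ P', X) P' ∅ :=
  ⟨by simpa using h.disj.subset hP, by simp, by simpa using fun X hX => h.factor X (hP hX),
    by simp⟩

theorem IsFracOf.permute {f : RatFun} {P N : Finset RatFun} (h : IsFracOf f P N)
    (σ : Equiv.Perm ℕ) : IsFracOf (ArithExpr.permute σ f) (P.image (ArithExpr.permute σ))
      (N.image (ArithExpr.permute σ)) := by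
  refine ⟨?_, ?_, ?_, ?_⟩
  · rw [← Finset.image_union]
    intro X hX Y hY hne
    obtain ⟨X, hXS, rfl⟩ := Finset.mem_image.1 hX
    obtain ⟨Y, hYS, rfl⟩ := Finset.mem_image.1 hY
    exact ArithExpr.disjoint_vars_permute σ (h.disj.disjoint hXS hYS fun e => hne (by rw [e]))
  · exact (Finset.disjoint_image (ArithExpr.permute σ).injective).2 h.disjoint
  · rw [← Finset.image_union]
    intro X hX
    obtain ⟨X, hXS, rfl⟩ := Finset.mem_image.1 hX
    exact ⟨(h.factor X hXS).1.permute σ, by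
      rw [mulDec_permute_iff]; exact (h.factor X hXS).2⟩
  · rw [Finset.prod_image (by simp), Finset.prod_image (by simp), h.eq, map_div₀, map_prod,
      map_prod]

/-- Subtraction makes some summands expressions only up to sign, but the leftmost one is always a
genuine expression. By `IsSumOf.isAE` this condition is also sufficient. -/
theorem IsAE.exists_isSumOf {f : RatFun} (hf : IsAE f) :
    ∃ S, IsSumOf f S ∧ ∃ X ∈ S, IsAE X := by
  induction hf with
  | atom i =>
    exact ⟨_, IsSumOf.singleton ⟨Or.inl (IsAE.atom i), not_addDec_atom i⟩, _,
      Finset.mem_singleton_self _, IsAE.atom i⟩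
  | op o g h hg hh hV ihg ihh =>
    obtain ⟨S, hS, X, hX, hXA⟩ := ihg
    obtain ⟨T, hT, -⟩ := ihh
    have hf := IsAE.op o g h hg hh hV
    have hmul : MulDec (o.apply g h) → ∃ S, IsSumOf (o.apply g h) S ∧ ∃ X ∈ S, IsAE X :=
      fun hm => ⟨_, IsSumOf.singleton ⟨Or.inl hf, fun ha => ha.not_mulDec hm⟩, _,
        Finset.mem_singleton_self _, hf⟩
    cases o
    · exact ⟨_, hS.add hT hV.1, X, Finset.mem_union_left _ hX, hXA⟩
    · refine ⟨_, ?_, X, Finset.mem_union_left (T.image fun X => -X) hX, hXA⟩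
      simp only [Op.apply, sub_eq_add_neg]
      exact hS.add hT.neg (by rw [vars_neg]; exact hV.1)
    · exact hmul ⟨g, h, rfl, hV.1, hg.vars_nonempty, hh.vars_nonempty⟩
    · exact hmul ⟨g, h⁻¹, div_eq_mul_inv _ _, by rw [vars_inv]; exact hV.1, hg.vars_nonempty,
        by rw [vars_inv]; exact hh.vars_nonempty⟩

/-- Nonemptiness of the numerator plays the part that a genuine summand plays for sums; it suffices
by `IsFracOf.isAE`. -/
theorem IsAE.exists_isFracOf {f : RatFun} (hf : IsAE f) :
    ∃ P N, IsFracOf f P N ∧ P.Nonempty := by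
  induction hf with
  | atom i => exact ⟨_, _, IsFracOf.singleton (isFactor_atom i), Finset.singleton_nonempty _⟩
  | op o g h hg hh hV ihg ihh =>
    obtain ⟨P, N, hPN, hP⟩ := ihg
    obtain ⟨P', N', hPN', hP'⟩ := ihh
    have hf := IsAE.op o g h hg hh hV
    have hadd : AddDec (o.apply g h) → ∃ P N, IsFracOf (o.apply g h) P N ∧ P.Nonempty :=
      fun ha => ⟨_, _, IsFracOf.singleton ⟨hf, ha.not_mulDec⟩, Finset.singleton_nonempty _⟩
    cases o
    · exact hadd ⟨g, h, rfl, hV.1, hg.vars_nonempty, hh.vars_nonempty⟩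
    · exact hadd ⟨g, -h, sub_eq_add_neg _ _, by rw [vars_neg]; exact hV.1, hg.vars_nonempty,
        by rw [vars_neg]; exact hh.vars_nonempty⟩
    · exact ⟨_, _, hPN.mul hPN' hV.1, hP.mono Finset.subset_union_left⟩
    · exact ⟨_, _, hPN.div hPN' hV.1, hP.mono Finset.subset_union_left⟩

/-- Starting from g, each further summand is added, or its negative is subtracted. -/
theorem IsAE.add_sum {g : RatFun} (hg : IsAE g) {S : Finset RatFun} (hS : DisjVars S)
    (hSA : ∀ X ∈ S, IsAE X ∨ IsAE (-X)) (hd : ∀ X ∈ S, Disjoint (vars g) (vars X)) :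
    IsAE (g + ∑ X ∈ S, X) := by
  induction S using Finset.induction_on generalizing g with
  | empty => simpa using hg
  | insert X S hX ih =>
    obtain ⟨h1, h2⟩ := (disjVars_insert hX).1 hS
    have hXd := hd X (Finset.mem_insert_self _ _)
    rw [Finset.sum_insert hX, ← add_assoc]
    apply ih _ h1 fun Y hY => hSA Y (Finset.mem_insert_of_mem hY)
    · intro Y hY
      rw [vars_add hXd, Set.disjoint_union_left]
      exact ⟨hd Y (Finset.mem_insert_of_mem hY), h2 Y hY⟩
    · rcases hSA X (Finset.mem_insert_self _ _) with h | h
      · exact hg.add h hXd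
      · simpa using hg.sub h (by rwa [vars_neg])

theorem IsSumOf.isAE {f : RatFun} {S : Finset RatFun} (h : IsSumOf f S) {X : RatFun}
    (hX : X ∈ S) (hXA : IsAE X) : IsAE f := by
  rw [h.eq, ← Finset.add_sum_erase S _ hX]
  apply hXA.add_sum (h.disj.subset (Finset.erase_subset _ _))
  · exact fun Y hY => (h.summand Y (Finset.mem_of_mem_erase hY)).1
  · exact fun Y hY => h.disj.disjoint hX (Finset.mem_of_mem_erase hY) (Finset.ne_of_mem_erase hY).symm

theorem isAE_prod {S : Finset RatFun} (hS : DisjVars S) (hSA : ∀ X ∈ S, IsAE X)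
    (hne : S.Nonempty) : IsAE (∏ X ∈ S, X) := by
  induction hne using Finset.Nonempty.cons_induction with
  | singleton X => simpa using hSA
  | cons X S hX _ ih =>
    rw [Finset.cons_eq_insert] at hS hSA
    obtain ⟨h1, h2⟩ := (disjVars_insert hX).1 hS
    have h3 : ∀ Y ∈ S, IsAE Y := fun Y hY => hSA Y (Finset.mem_insert_of_mem hY)
    rw [Finset.prod_cons]
    apply (hSA X (Finset.mem_insert_self _ _)).mul (ih h1 h3)
    rw [vars_prod h1 fun Y hY => (h3 Y hY).ne_zero]
    simpa using h2

theorem IsFracOf.isAE {f : RatFun} {P N : Finset RatFun} (h : IsFracOf f P N)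
    (hP : P.Nonempty) : IsAE f := by
  have h1 := isAE_prod (h.disj.subset Finset.subset_union_left)
    (fun X hX => (h.factor X (Finset.mem_union_left _ hX)).1) hP
  rcases N.eq_empty_or_nonempty with rfl | hN
  · rw [h.eq]
    simpa using h1
  have h2 := isAE_prod (h.disj.subset Finset.subset_union_right)
    (fun X hX => (h.factor X (Finset.mem_union_right _ hX)).1) hN
  rw [h.eq]
  apply h1.div h2
  rw [vars_prod (h.disj.subset Finset.subset_union_left)
      fun X hX => h.ne_zero X (Finset.mem_union_left _ hX),
    vars_prod (h.disj.subset Finset.subset_union_right)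
      fun X hX => h.ne_zero X (Finset.mem_union_right _ hX)]
  exact disjoint_biUnion_vars h.disj h.disjoint

/-! ### Rigidity -/

theorem sub_eq_const {f g : RatFun} (h : ∀ i, der i f = der i g) : ∃ c, f = g + const c := by
  obtain ⟨c, hc⟩ := eq_const_of_der_eq_zero (f := f - g) fun i => by rw [map_sub, h, sub_self]
  exact ⟨c, by rw [← hc]; ring⟩

theorem eq_const_mul_of_lder {f g : RatFun} (hf : f ≠ 0) (hg : g ≠ 0)
    (h : ∀ i, lder i f = lder i g) : ∃ k, k ≠ 0 ∧ f = const k * g := by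
  obtain ⟨k, hk⟩ := eq_const_of_der_eq_zero (f := f / g) fun i => by
    have h1 := h i
    rw [lder, lder, div_eq_div_iff hf hg] at h1
    rw [der_div i hg, div_eq_zero_iff]
    left
    linear_combination h1
  have hfk : f = const k * g := by rw [← hk, div_mul_cancel₀ _ hg]
  refine ⟨k, ?_, hfk⟩
  rintro rfl
  rw [const_zero, zero_mul] at hfk
  exact hf hfk

/-- The summands are matched by their gradients, and functions with equal gradients differ by a
constant. -/
theorem IsSumOf.match {f F : RatFun} {S S' : Finset RatFun} (h : IsSumOf f S)
    (h' : IsSumOf F S') {a : ℝ} (ha : a ≠ 0) (hd : ∀ i, der i F = const a * der i f) :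
    ∀ X ∈ S, ∃ X' ∈ S', vars X' = vars X ∧ ∃ c, X' = const a * X + const c := by
  intro X hX
  obtain ⟨X', hX', hv, he⟩ := match_of_conn (S := S) (S' := S')
    (v := fun X i => const a * der i X) (v' := fun X i => der i X) h.disj h'.disj
    (fun X hX => (h.summand X hX).vars_nonempty)
    (fun X _ i => by simp [mem_vars_iff, const_ne_zero ha])
    (fun X _ i => by simp [mem_vars_iff])
    (fun X _ i j hi => by rw [der_const_mul, der_der_eq_zero j hi, mul_zero])
    (fun X _ i j hi => der_der_eq_zero j hi)
    (fun X hX => (h.summand X hX).conn.const_mul ha)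
    (fun X hX => (h'.summand X hX).conn)
    (fun i => by rw [← Finset.mul_sum, ← map_sum, ← map_sum, ← h.eq, ← h'.eq, hd]) X hX
  refine ⟨X', hX', hv, sub_eq_const fun i => ?_⟩
  rw [he, der_const_mul]

theorem lder_prod {S : Finset RatFun} (hS : ∀ X ∈ S, X ≠ 0) (i : ℕ) :
    lder i (∏ X ∈ S, X) = ∑ X ∈ S, lder i X := by
  induction S using Finset.induction_on with
  | empty =>
    rw [Finset.prod_empty, Finset.sum_empty, ← const_one]
    exact lder_eq_zero (by simp [vars_const])
  | insert X S hX ih =>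
    have h1 : ∀ Y ∈ S, Y ≠ 0 := fun Y hY => hS Y (Finset.mem_insert_of_mem hY)
    rw [Finset.prod_insert hX, Finset.sum_insert hX,
      lder_mul (hS X (Finset.mem_insert_self _ _)) (Finset.prod_ne_zero_iff.2 h1), ih h1]

theorem IsFracOf.lder_eq {f : RatFun} {P N : Finset RatFun} (h : IsFracOf f P N) (i : ℕ) :
    lder i f = ∑ X ∈ P ∪ N, if X ∈ P then lder i X else -lder i X := by
  have h1 : ∑ X ∈ P, lder i X = ∑ X ∈ P, if X ∈ P then lder i X else -lder i X :=
    Finset.sum_congr rfl fun X hX => by rw [if_pos hX]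
  have h2 : ∑ X ∈ N, -lder i X = ∑ X ∈ N, if X ∈ P then lder i X else -lder i X :=
    Finset.sum_congr rfl fun X hX => by rw [if_neg (Finset.disjoint_right.1 h.disjoint hX)]
  rw [Finset.sum_union h.disjoint, ← h1, ← h2, h.eq, div_eq_mul_inv,
    lder_mul h.prod_ne_zero.1 (inv_ne_zero h.prod_ne_zero.2), lder_inv h.prod_ne_zero.2,
    lder_prod fun X hX => h.ne_zero X (Finset.mem_union_left _ hX),
    lder_prod fun X hX => h.ne_zero X (Finset.mem_union_right _ hX), Finset.sum_neg_distrib]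

/-- A factor is not proportional to the inverse of a factor. -/
theorem IsFactor.lder_ne_neg {X Y : RatFun} (hX : IsFactor X) (hY : IsFactor Y)
    (h : ∀ i, lder i X = -lder i Y) : False := by
  have hX0 := hX.1.ne_zero
  have hY0 := hY.1.ne_zero
  obtain ⟨k, hk, rfl⟩ := eq_const_mul_of_lder hX0 (inv_ne_zero hY0) fun i => by
    rw [h, lder_inv hY0]
  have hv : vars (const k * Y⁻¹) = vars Y := by rw [vars_const_mul hk, vars_inv]
  rcases hY.atom_or_addDec with ⟨i, rfl⟩ | hYa
  · have h1 := hX.1.eq_atom (hv.trans (vars_atom i))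
    -- With one variable both factors are x_i, so proportionality to the inverse would make x_i²
    -- constant.
    have h2 : const k = atom i * atom i := by
      rw [← div_eq_mul_inv, div_eq_iff hY0] at h1
      exact h1
    have h3 := congrArg (der i) h2
    have h4 : der i (atom i) ≠ 0 := mem_vars_iff.1 (by rw [vars_atom]; rfl)
    rw [der_const, der_mul, ← two_mul] at h3
    exact mul_ne_zero two_ne_zero_ratFun (mul_ne_zero hY0 h4) h3.symm
  · rcases hX.atom_or_addDec with ⟨i, hi⟩ | hXa
    · have := hYa.nontrivial
      rw [← hv, hi, vars_atom] at this
      simp at this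
    -- X is a sum, so the graph of its second derivatives is disconnected, whereas that of the
    -- scaled inverse of the sum Y is connected.
    · apply hXa.not_conn_der
      rw [hv]
      exact (hYa.conn_der_inv.const_mul hk).congr fun i => (der_const_mul i k _).symm

/-- Logarithmic derivatives enter with sign + for P and - for N. The matching of these signed
vectors cannot pair a numerator with a denominator, by `IsFactor.lder_ne_neg`. -/
theorem IsFracOf.match_const {f F : RatFun} {P N P' N' : Finset RatFun} (h : IsFracOf f P N)
    (h' : IsFracOf F P' N') (hd : ∀ i, lder i F = lder i f) :
    (∀ X ∈ P, ∃ X' ∈ P', vars X' = vars X ∧ ∃ k, k ≠ 0 ∧ X' = const k * X) ∧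
      ∀ X ∈ N, ∃ X' ∈ N', vars X' = vars X ∧ ∃ k, k ≠ 0 ∧ X' = const k * X := by
  have side : ∀ {f : RatFun} {P N : Finset RatFun}, IsFracOf f P N → ∀ X ∈ P ∪ N, ∀ i,
      (if X ∈ P then lder i X else -lder i X) ≠ 0 ↔ i ∈ vars X := by
    intro f P N h X hX i
    have : lder i X ≠ 0 ↔ i ∈ vars X := ⟨fun h1 => by_contra fun h2 => h1 (lder_eq_zero h2),
      lder_ne_zero⟩
    split_ifs
    · exact this
    · rw [neg_ne_zero, this]
  have side2 : ∀ {P : Finset RatFun} (X : RatFun), ∀ i j, i ∉ vars X →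
      der i (if X ∈ P then lder j X else -lder j X) = 0 := by
    intro P X i j hi
    split_ifs
    · exact der_lder_eq_zero j hi
    · rw [map_neg, der_lder_eq_zero j hi, neg_zero]
  have side3 : ∀ {f : RatFun} {P N : Finset RatFun}, IsFracOf f P N → ∀ X ∈ P ∪ N,
      Conn (vars X) fun i => if X ∈ P then lder i X else -lder i X := by
    intro f P N h X hX
    have h1 := (h.factor X hX).conn
    split_ifs
    · exact h1
    · exact (h1.const_mul (a := -1) (by norm_num)).congr fun i => by
        rw [const_neg, const_one, neg_one_mul]
  have hm := match_of_conn (S := P ∪ N) (S' := P' ∪ N')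
    (v := fun X i => if X ∈ P then lder i X else -lder i X)
    (v' := fun X i => if X ∈ P' then lder i X else -lder i X) h.disj h'.disj
    (fun X hX => (h.factor X hX).1.vars_nonempty) (side h) (side h')
    (fun X _ => side2 X) (fun X _ => side2 X) (side3 h) (side3 h')
    (fun i => by rw [← h.lder_eq, ← h'.lder_eq, hd])
  constructor
  · intro X hX
    have hXu := Finset.mem_union_left N hX
    obtain ⟨X', hX', hv, he⟩ := hm X hXu
    simp only [if_pos hX] at he
    by_cases hP : X' ∈ P'
    · simp only [if_pos hP] at he
      exact ⟨X', hP, hv, eq_const_mul_of_lder (h'.ne_zero X' hX') (h.ne_zero X hXu) he⟩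
    · simp only [if_neg hP] at he
      exact ((h.factor X hXu).lder_ne_neg (h'.factor X' hX') fun i => (he i).symm).elim
  · intro X hX
    have hXu := Finset.mem_union_right P hX
    obtain ⟨X', hX', hv, he⟩ := hm X hXu
    simp only [if_neg (Finset.disjoint_right.1 h.disjoint hX)] at he
    by_cases hP : X' ∈ P'
    · simp only [if_pos hP] at he
      exact ((h'.factor X' hX').lder_ne_neg (h.factor X hXu) he).elim
    · simp only [if_neg hP, neg_inj] at he
      exact ⟨X', (Finset.mem_union.1 hX').resolve_left hP, hv,
        eq_const_mul_of_lder (h'.ne_zero X' hX') (h.ne_zero X hXu) he⟩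

theorem prod_eq_or_eq_neg {S : Finset RatFun} {φ : RatFun → RatFun}
    (h : ∀ X ∈ S, φ X = X ∨ φ X = -X) :
    ∏ X ∈ S, φ X = ∏ X ∈ S, X ∨ ∏ X ∈ S, φ X = -∏ X ∈ S, X := by
  induction S using Finset.induction_on with
  | empty => simp
  | insert X S hX ih =>
    rw [Finset.prod_insert hX, Finset.prod_insert hX]
    rcases h X (Finset.mem_insert_self _ _) with h1 | h1 <;>
      rcases ih fun Y hY => h Y (Finset.mem_insert_of_mem hY) with h2 | h2 <;> rw [h1, h2]
    · exact Or.inl rfl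
    · exact Or.inr (mul_neg _ _)
    · exact Or.inr (neg_mul _ _)
    · exact Or.inl (neg_mul_neg _ _)

/-- The member of `S'` that equals `X` up to sign. -/
def signIn (S' : Finset RatFun) (X : RatFun) : RatFun := if X ∈ S' then X else -X

theorem signIn_eq (S' : Finset RatFun) (X : RatFun) : signIn S' X = X ∨ signIn S' X = -X := by
  unfold signIn
  split_ifs <;> simp

theorem vars_signIn (S' : Finset RatFun) (X : RatFun) : vars (signIn S' X) = vars X := by
  rcases signIn_eq S' X with h | h <;> rw [h]
  exact vars_neg X

/-- Members of S' are determined by their variables, so agreement of S with S' up to sign, together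
with a match of variable sets, makes the sign choice onto. -/
theorem image_signIn {S S' : Finset RatFun} (hS' : DisjVars S')
    (hne : ∀ X ∈ S', (vars X).Nonempty) (h : ∀ X ∈ S, ∃ X' ∈ S', X' = X ∨ X' = -X)
    (h' : ∀ X' ∈ S', ∃ X ∈ S, vars X = vars X') : S.image (signIn S') = S' := by
  have hm : ∀ X ∈ S, signIn S' X ∈ S' := by
    intro X hX
    unfold signIn
    split_ifs with h1
    · exact h1
    · obtain ⟨X', hX', rfl | rfl⟩ := h X hX
      exacts [absurd hX' h1, hX']
  apply Finset.Subset.antisymm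
  · rw [Finset.image_subset_iff]
    exact hm
  · intro X' hX'
    obtain ⟨X, hX, hv⟩ := h' X' hX'
    rw [Finset.mem_image]
    exact ⟨X, hX, (hS'.eq_of_vars hX' (hm X hX) (hne X' hX')
      (by rw [vars_signIn, hv])).symm⟩

theorem signIn_injOn {S : Finset RatFun} (S' : Finset RatFun) (hS : DisjVars S)
    (hne : ∀ X ∈ S, (vars X).Nonempty) : Set.InjOn (signIn S') S := by
  intro X hX Y hY hXY
  apply hS.eq_of_vars hX hY (hne X hX)
  rw [← vars_signIn S' X, hXY, vars_signIn]

theorem prod_eq_or_eq_neg_of_match {S S' : Finset RatFun} (hS : DisjVars S) (hS' : DisjVars S')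
    (hn : ∀ X ∈ S, (vars X).Nonempty) (hn' : ∀ X ∈ S', (vars X).Nonempty)
    (h : ∀ X ∈ S, ∃ X' ∈ S', X' = X ∨ X' = -X)
    (h' : ∀ X' ∈ S', ∃ X ∈ S, vars X = vars X') :
    ∏ X ∈ S', X = ∏ X ∈ S, X ∨ ∏ X ∈ S', X = -∏ X ∈ S, X := by
  rw [← image_signIn hS' hn' h h', Finset.prod_image (signIn_injOn S' hS hn)]
  exact prod_eq_or_eq_neg fun X _ => signIn_eq _ X

/-- The proof is by induction on the number of variables. For a sum, each summand X is matched with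
some a X + c', and induction gives c' = 0 and a = ±1. For a product, the graphs exclude c ≠ 0; the
factors are then matched up to constants, which are ±1 by induction. -/
theorem IsAE.affine_rigid {f F : RatFun} (hf : IsAE f) (hF : IsAE F) {a c : ℝ} (ha : a ≠ 0)
    (h : F = const a * f + const c) : c = 0 ∧ (a = 1 ∨ a = -1) := by
  obtain ⟨n, hn⟩ : ∃ n, (vars f).ncard = n := ⟨_, rfl⟩
  induction n using Nat.strong_induction_on generalizing f F a c with
  | _ n ih =>
  -- Summands are expressions only up to sign, so the induction hypothesis is extended by moving
  -- signs into a and c.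
  have ih' : ∀ {X X' : RatFun} {a c : ℝ}, (IsAE X ∨ IsAE (-X)) → (IsAE X' ∨ IsAE (-X')) →
      vars X ⊂ vars f → a ≠ 0 → X' = const a * X + const c → c = 0 ∧ (a = 1 ∨ a = -1) := by
    intro X X' a c hX hX' hlt ha he
    have hlt' := Set.ncard_lt_ncard hlt (vars_finite f)
    rw [hn] at hlt'
    rcases hX with hX | hX <;> rcases hX' with hX' | hX'
    · exact ih _ hlt' hX hX' ha he rfl
    · have := ih _ hlt' hX hX' (a := -a) (c := -c) (neg_ne_zero.2 ha)
        (by rw [he, const_neg, const_neg]; ring) rfl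
      rw [neg_eq_zero, neg_inj, neg_eq_iff_eq_neg] at this
      exact ⟨this.1, this.2.symm⟩
    · have := ih _ hlt' hX hX' (a := -a) (c := c) (neg_ne_zero.2 ha)
        (by rw [he, const_neg]; ring) (by rw [vars_neg])
      rw [neg_inj, neg_eq_iff_eq_neg] at this
      exact ⟨this.1, this.2.symm⟩
    · have := ih _ hlt' hX hX' (a := a) (c := -c) ha
        (by rw [he, const_neg]; ring) (by rw [vars_neg])
      rw [neg_eq_zero] at this
      exact this
  have hder : ∀ i, der i F = const a * der i f := fun i => by rw [h, der_affine]
  have hvars : vars F = vars f := by rw [h, vars_affine ha]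
  rcases hf.atom_or_dec with ⟨i, rfl⟩ | hfa | hfm
  · have hFi := hF.eq_atom (hvars.trans (vars_atom i))
    have h1 := hder i
    have h2 : der i (ArithExpr.atom i) ≠ 0 := mem_vars_iff.1 (by rw [vars_atom]; rfl)
    rw [hFi] at h1 h
    have h3 : const a = const 1 := by
      rw [const_one]
      exact mul_right_cancel₀ h2 (by rw [← h1, one_mul])
    have h4 := const_injective h3
    refine ⟨const_injective ?_, Or.inl h4⟩
    rw [h4, const_one, one_mul] at h
    rw [const_zero]
    linear_combination -h
  · obtain ⟨S, hS, X₀, hX₀, -⟩ := hf.exists_isSumOf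
    obtain ⟨S', hS', -⟩ := hF.exists_isSumOf
    have hm := hS.match hS' ha hder
    -- A summand with all the variables of f would be the only summand, making f indecomposable.
    have hlt : ∀ X ∈ S, vars X ⊂ vars f := by
      intro X hX
      refine ⟨by rw [hS.vars_eq]; exact Set.subset_biUnion_of_mem hX, fun hsub => ?_⟩
      apply (hS.summand X hX).2
      have : S = {X} := by
        refine Finset.eq_singleton_iff_unique_mem.2 ⟨hX, fun Y hY => ?_⟩
        obtain ⟨j, hj⟩ := (hS.summand Y hY).vars_nonempty
        refine hS.disj.eq_of_mem hY hX hj (hsub ?_)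
        rw [hS.vars_eq]
        exact Set.mem_biUnion hY hj
      rwa [hS.eq, this, Finset.sum_singleton] at hfa
    have hc : ∀ X ∈ S, const a * X ∈ S' ∧ (a = 1 ∨ a = -1) := by
      intro X hX
      obtain ⟨X', hX', -, c', rfl⟩ := hm X hX
      obtain ⟨h0, h1⟩ := ih' (hS.summand X hX).1 (hS'.summand _ hX').1 (hlt X hX) ha rfl
      rw [h0, const_zero, add_zero] at hX'
      exact ⟨hX', h1⟩
    refine ⟨?_, (hc X₀ hX₀).2⟩
    -- Matching backwards with a⁻¹ shows that no summand of F is missed, so F = a f and c = 0.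
    have himg : S' = S.image fun X => const a * X := by
      apply Finset.Subset.antisymm
      · intro X' hX'
        obtain ⟨X, hX, hv, -⟩ := hS'.match hS (a := a⁻¹) (inv_ne_zero ha) (fun i => by
          rw [hder, ← mul_assoc, ← const_mul, inv_mul_cancel₀ ha, const_one, one_mul]) X' hX'
        rw [Finset.mem_image]
        exact ⟨X, hX, (hS'.disj.eq_of_vars hX' (hc X hX).1 (hS'.summand X' hX').vars_nonempty
          (by rw [vars_const_mul ha, hv])).symm⟩
      · rw [Finset.image_subset_iff]
        exact fun X hX => (hc X hX).1
    have h1 : F = const a * f := by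
      rw [hS'.eq, himg, Finset.sum_image fun X _ Y _ hXY => mul_left_cancel₀ (const_ne_zero ha) hXY,
        ← Finset.mul_sum, ← hS.eq]
    apply const_injective
    rw [const_zero]
    rw [h1] at h
    linear_combination -h
  -- For c ≠ 0 nothing is left for F: if F were a sum, its connected graph, proportional to that of
  -- f, forbids it; if a product, the connected logarithmic graph of f + c/a does; and F has too
  -- many variables for an atom.
  · have hc0 : c = 0 := by
      by_contra hc
      rcases hF.atom_or_dec with ⟨i, hi⟩ | hFa | hFm
      · have := hfm.nontrivial
        rw [← hvars, hi, vars_atom] at this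
        simp at this
      · apply hFa.not_conn_der
        rw [hvars]
        exact (hfm.conn_der.const_mul ha).congr fun i => (hder i).symm
      · apply hFm.not_conn_lder
        rw [hvars]
        refine (hfm.conn_lder_add_const (div_ne_zero hc ha)).congr fun i => ?_
        rw [← lder_const_mul ha, mul_add, ← const_mul, mul_div_cancel₀ _ ha, h]
    refine ⟨hc0, ?_⟩
    rw [hc0, const_zero, add_zero] at h
    obtain ⟨P, N, hPN, hP⟩ := hf.exists_isFracOf
    obtain ⟨P', N', hPN', -⟩ := hF.exists_isFracOf
    have hl : ∀ i, lder i F = lder i f := fun i => by rw [h, lder_const_mul ha]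
    have hm := hPN.match_const hPN' hl
    have hm' := hPN'.match_const hPN fun i => (hl i).symm
    have hlt : ∀ X ∈ P ∪ N, vars X ⊂ vars f := by
      intro X hX
      refine ⟨by rw [hPN.vars_eq]; exact Set.subset_biUnion_of_mem hX, fun hsub => ?_⟩
      apply (hPN.factor X hX).2
      have huniq : ∀ Y ∈ P ∪ N, Y = X := by
        intro Y hY
        obtain ⟨j, hj⟩ := (hPN.factor Y hY).1.vars_nonempty
        refine hPN.disj.eq_of_mem hY hX hj (hsub ?_)
        rw [hPN.vars_eq]
        exact Set.mem_biUnion hY hj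
      have hP1 : P = {X} := by
        refine Finset.eq_singleton_iff_nonempty_unique_mem.2 ⟨hP, fun Y hY => ?_⟩
        exact huniq Y (Finset.mem_union_left _ hY)
      have hN0 : N = ∅ := by
        refine Finset.eq_empty_of_forall_notMem fun Y hY => ?_
        have := huniq Y (Finset.mem_union_right _ hY)
        refine Finset.disjoint_right.1 hPN.disjoint hY ?_
        rw [hP1, this, Finset.mem_singleton]
      rw [hPN.eq, hP1, hN0] at hfm
      simpa using hfm
    have hsgn : ∀ {X X' : RatFun} {k : ℝ}, X ∈ P ∪ N → X' ∈ P' ∪ N' → k ≠ 0 → X' = const k * X →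
        X' = X ∨ X' = -X := by
      intro X X' k hX hX' hk he
      rcases (ih' (Or.inl (hPN.factor X hX).1) (Or.inl (hPN'.factor X' hX').1) (hlt X hX) hk
        (c := 0) (by rw [he, const_zero, add_zero])).2 with rfl | rfl
      · left; rw [he, const_one, one_mul]
      · right; rw [he, const_neg, const_one, neg_one_mul]
    have hPP := prod_eq_or_eq_neg_of_match
      (hPN.disj.subset Finset.subset_union_left) (hPN'.disj.subset Finset.subset_union_left)
      (fun X hX => (hPN.factor X (Finset.mem_union_left _ hX)).1.vars_nonempty)
      (fun X hX => (hPN'.factor X (Finset.mem_union_left _ hX)).1.vars_nonempty)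
      (fun X hX => by
        obtain ⟨X', hX', -, k, hk, he⟩ := hm.1 X hX
        exact ⟨X', hX', hsgn (Finset.mem_union_left _ hX) (Finset.mem_union_left _ hX') hk he⟩)
      (fun X' hX' => by
        obtain ⟨X, hX, hv, -⟩ := hm'.1 X' hX'
        exact ⟨X, hX, hv⟩)
    have hNN := prod_eq_or_eq_neg_of_match
      (hPN.disj.subset Finset.subset_union_right) (hPN'.disj.subset Finset.subset_union_right)
      (fun X hX => (hPN.factor X (Finset.mem_union_right _ hX)).1.vars_nonempty)
      (fun X hX => (hPN'.factor X (Finset.mem_union_right _ hX)).1.vars_nonempty)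
      (fun X hX => by
        obtain ⟨X', hX', -, k, hk, he⟩ := hm.2 X hX
        exact ⟨X', hX', hsgn (Finset.mem_union_right _ hX) (Finset.mem_union_right _ hX') hk he⟩)
      (fun X' hX' => by
        obtain ⟨X, hX, hv, -⟩ := hm'.2 X' hX'
        exact ⟨X, hX, hv⟩)
    have hFf : F = f ∨ F = -f := by
      rw [hPN'.eq, hPN.eq]
      rcases hPP with h1 | h1 <;> rcases hNN with h2 | h2 <;> rw [h1, h2]
      · exact Or.inl rfl
      · exact Or.inr (div_neg _)
      · exact Or.inr (neg_div _ _)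
      · exact Or.inl (neg_div_neg_eq _ _)
    have h0 := hf.ne_zero
    rcases hFf with h1 | h1
    · left
      apply const_injective
      rw [const_one]
      exact mul_right_cancel₀ h0 (by rw [← h, h1, one_mul])
    · right
      apply const_injective
      rw [const_neg, const_one]
      exact mul_right_cancel₀ h0 (by rw [← h, h1, neg_one_mul])

/-! ### Uniqueness of the decompositions -/

theorem affine_rigid_of_isAE_or_neg {X X' : RatFun} {a c : ℝ} (hX : IsAE X ∨ IsAE (-X))
    (hX' : IsAE X' ∨ IsAE (-X')) (ha : a ≠ 0) (he : X' = const a * X + const c) :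
    c = 0 ∧ (a = 1 ∨ a = -1) := by
  rcases hX with hX | hX <;> rcases hX' with hX' | hX'
  · exact hX.affine_rigid hX' ha he
  · have := hX.affine_rigid hX' (a := -a) (c := -c) (neg_ne_zero.2 ha)
      (by rw [he, const_neg, const_neg]; ring)
    rw [neg_eq_zero, neg_inj, neg_eq_iff_eq_neg] at this
    exact ⟨this.1, this.2.symm⟩
  · have := hX.affine_rigid hX' (a := -a) (c := c) (neg_ne_zero.2 ha)
      (by rw [he, const_neg]; ring)
    rw [neg_inj, neg_eq_iff_eq_neg] at this
    exact ⟨this.1, this.2.symm⟩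
  · have := hX.affine_rigid hX' (a := a) (c := -c) ha
      (by rw [he, const_neg]; ring)
    rwa [neg_eq_zero] at this

/-- Rigidity with a = 1 removes the additive constants left by the matching. -/
theorem IsSumOf.unique {f : RatFun} {S S' : Finset RatFun} (h : IsSumOf f S)
    (h' : IsSumOf f S') : S = S' := by
  have key : ∀ {S S' : Finset RatFun}, IsSumOf f S → IsSumOf f S' → S ⊆ S' := by
    intro S S' h h' X hX
    obtain ⟨X', hX', -, c, he⟩ := h.match h' (a := 1) one_ne_zero
      (fun i => by rw [const_one, one_mul]) X hX
    have hc := (affine_rigid_of_isAE_or_neg (h.summand X hX).1 (h'.summand X' hX').1 one_ne_zero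
      he).1
    rw [hc, const_one, const_zero, one_mul, add_zero] at he
    rwa [← he]
  exact Finset.Subset.antisymm (key h h') (key h' h)

/-- Rigidity reduces the proportionality constants to signs. The signs remain, since X and -X can
both be factors. -/
theorem IsFracOf.match {f F : RatFun} {P N P' N' : Finset RatFun} (h : IsFracOf f P N)
    (h' : IsFracOf F P' N') (hd : ∀ i, lder i F = lder i f) :
    (∀ X ∈ P, ∃ X' ∈ P', X' = X ∨ X' = -X) ∧ ∀ X ∈ N, ∃ X' ∈ N', X' = X ∨ X' = -X := by
  have key : ∀ {X X' : RatFun}, X ∈ P ∪ N → X' ∈ P' ∪ N' →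
      (∃ k, k ≠ 0 ∧ X' = const k * X) → X' = X ∨ X' = -X := by
    rintro X X' hX hX' ⟨k, hk, he⟩
    rcases ((h.factor X hX).1.affine_rigid (h'.factor X' hX').1 hk (c := 0)
      (by rw [he, const_zero, add_zero])).2 with rfl | rfl
    · left; rw [he, const_one, one_mul]
    · right; rw [he, const_neg, const_one, neg_one_mul]
  obtain ⟨h1, h2⟩ := h.match_const h' hd
  constructor
  · intro X hX
    obtain ⟨X', hX', -, hk⟩ := h1 X hX
    exact ⟨X', hX', key (Finset.mem_union_left _ hX) (Finset.mem_union_left _ hX') hk⟩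
  · intro X hX
    obtain ⟨X', hX', -, hk⟩ := h2 X hX
    exact ⟨X', hX', key (Finset.mem_union_right _ hX) (Finset.mem_union_right _ hX') hk⟩

/-! ### Semantic classification by the last operator -/

theorem IsSumOf.nonempty {f : RatFun} {S : Finset RatFun} (h : IsSumOf f S)
    (hf : (vars f).Nonempty) : S.Nonempty := by
  obtain ⟨i, hi⟩ := hf
  rw [h.vars_eq] at hi
  obtain ⟨X, hX, -⟩ := Set.mem_iUnion₂.1 hi
  exact ⟨X, hX⟩

theorem IsFracOf.nonempty {f : RatFun} {P : Finset RatFun} (h : IsFracOf f P ∅)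
    (hf : (vars f).Nonempty) : P.Nonempty := by
  obtain ⟨i, hi⟩ := hf
  rw [h.vars_eq, Finset.union_empty] at hi
  obtain ⟨X, hX, -⟩ := Set.mem_iUnion₂.1 hi
  exact ⟨X, hX⟩

theorem IsSumOf.disjoint_vars {f : RatFun} {S T T' : Finset RatFun} (h : IsSumOf f S) (hT : T ⊆ S)
    (hT' : T' ⊆ S) (hd : Disjoint T T') : Disjoint (vars (∑ X ∈ T, X)) (vars (∑ X ∈ T', X)) := by
  rw [(h.subset hT).vars_eq, (h.subset hT').vars_eq]
  exact disjoint_biUnion_vars (h.disj.subset (Finset.union_subset hT hT')) hd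

theorem IsFracOf.disjoint_vars {f : RatFun} {P N T T' : Finset RatFun} (h : IsFracOf f P N)
    (hT : T ⊆ P ∪ N) (hT' : T' ⊆ P ∪ N) (hd : Disjoint T T') :
    Disjoint (vars (∏ X ∈ T, X)) (vars (∏ X ∈ T', X)) := by
  rw [(h.num hT).vars_eq, (h.num hT').vars_eq, Finset.union_empty, Finset.union_empty]
  exact disjoint_biUnion_vars (h.disj.subset (Finset.union_subset hT hT')) hd

theorem IsSumOf.addDec {f : RatFun} {S : Finset RatFun} (h : IsSumOf f S) {X Y : RatFun}
    (hX : X ∈ S) (hY : Y ∈ S) (hne : X ≠ Y) : AddDec f := by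
  refine ⟨X, ∑ Z ∈ S.erase X, Z, ?_, ?_, (h.summand X hX).vars_nonempty, ?_⟩
  · rw [h.eq, Finset.add_sum_erase S (fun Z => Z) hX]
  · simpa using h.disjoint_vars (T := {X}) (T' := S.erase X) (by simpa using hX)
      (Finset.erase_subset _ _) (by simp)
  · rw [(h.subset (Finset.erase_subset X S)).vars_eq]
    obtain ⟨i, hi⟩ := (h.summand Y hY).vars_nonempty
    exact ⟨i, Set.mem_biUnion (Finset.mem_erase.2 ⟨hne.symm, hY⟩ : Y ∈ S.erase X) hi⟩

/-- All the summands of `f` are arithmetic expressions. -/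
def AllPos (f : RatFun) : Prop := ∃ S, IsSumOf f S ∧ ∀ X ∈ S, IsAE X

/-- `f` is a product of factors. -/
def AllNum (f : RatFun) : Prop := ∃ P, IsFracOf f P ∅

/-- Description of the arithmetic expressions that end with a given operator by means of the
decompositions into summands and into factors. -/
def Cls : Op → RatFun → Prop
  | .plus, f => ∃ S, IsSumOf f S ∧ (∀ X ∈ S, IsAE X) ∧ 2 ≤ S.card
  | .minus, f => ∃ S, IsSumOf f S ∧ (∃ X ∈ S, IsAE X) ∧ ∃ X ∈ S, ¬ IsAE X
  | .times, f => IsAE f ∧ ¬ AddDec f ∧ AllNum f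
  | .divide, f => ∃ P N, IsFracOf f P N ∧ P.Nonempty ∧ N.Nonempty

theorem Cls.isAE {o : Op} {f : RatFun} (h : Cls o f) : IsAE f := by
  cases o
  · obtain ⟨S, hS, hA, hc⟩ := h
    obtain ⟨X, hX⟩ := Finset.card_pos.1 (by omega : 0 < S.card)
    exact hS.isAE hX (hA X hX)
  · obtain ⟨S, hS, ⟨X, hX, hA⟩, -⟩ := h
    exact hS.isAE hX hA
  · exact h.1
  · obtain ⟨P, N, h, hP, -⟩ := h
    exact h.isAE hP

theorem Cls.addDec {o : Op} {f : RatFun} (h : Cls o f) (ho : o = .plus ∨ o = .minus) :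
    AddDec f := by
  rcases ho with rfl | rfl
  · obtain ⟨S, hS, -, hc⟩ := h
    obtain ⟨X, hX, Y, hY, hne⟩ := Finset.one_lt_card.1 hc
    exact hS.addDec hX hY hne
  · obtain ⟨S, hS, ⟨X, hX, hXA⟩, Y, hY, hYA⟩ := h
    exact hS.addDec hX hY fun e => hYA (e ▸ hXA)

theorem Cls.not_addDec {o : Op} {f : RatFun} (h : Cls o f) (ho : o = .times ∨ o = .divide) :
    ¬ AddDec f := by
  rcases ho with rfl | rfl
  · exact h.2.1
  · obtain ⟨P, N, h, hP, hN⟩ := h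
    intro ha
    refine ha.not_mulDec ⟨∏ X ∈ P, X, (∏ X ∈ N, X)⁻¹, ?_, ?_, ?_, ?_⟩
    · rw [h.eq, div_eq_mul_inv]
    · rw [vars_inv]
      exact h.disjoint_vars Finset.subset_union_left Finset.subset_union_right h.disjoint
    · exact ((h.num Finset.subset_union_left).isAE hP).vars_nonempty
    · rw [vars_inv]
      exact ((h.num Finset.subset_union_right).isAE hN).vars_nonempty

theorem allPos_of_not_addDec {f : RatFun} (hf : IsAE f) (h : ¬ AddDec f) : AllPos f :=
  ⟨{f}, IsSumOf.singleton ⟨Or.inl hf, h⟩, by simpa using hf⟩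

theorem allNum_of_not_mulDec {f : RatFun} (hf : IsAE f) (h : ¬ MulDec f) : AllNum f :=
  ⟨{f}, IsFracOf.singleton ⟨hf, h⟩⟩

/-- The clauses for + and - require operands that end with anything but -. This turns that syntactic
condition into one on summands; `Cls.allNum_iff` does the same for × and ÷. -/
theorem Cls.allPos_iff {o : Op} {f : RatFun} (h : Cls o f) : AllPos f ↔ o ≠ .minus := by
  constructor
  · rintro ⟨S, hS, hA⟩ rfl
    obtain ⟨S', hS', -, X, hX, hXA⟩ := h
    rw [← hS.unique hS'] at hX
    exact hXA (hA X hX)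
  · intro ho
    have hA := h.isAE
    cases o
    · obtain ⟨S, hS, hA, -⟩ := h
      exact ⟨S, hS, hA⟩
    · exact absurd rfl ho
    · exact allPos_of_not_addDec hA (h.not_addDec (Or.inl rfl))
    · exact allPos_of_not_addDec hA (h.not_addDec (Or.inr rfl))

theorem IsFracOf.lder_neg_match {f F : RatFun} {P N P' N' : Finset RatFun} (h : IsFracOf f P N)
    (h' : IsFracOf F P' N') (hd : F = f ∨ F = -f) :
    (∀ X ∈ P, ∃ X' ∈ P', X' = X ∨ X' = -X) ∧ ∀ X ∈ N, ∃ X' ∈ N', X' = X ∨ X' = -X := by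
  apply h.match h'
  rcases hd with rfl | rfl
  · exact fun _ => rfl
  · intro i
    simp [lder]

/-- A product of factors is not, even up to sign, a quotient with nontrivial denominator. -/
theorem AllNum.not_divide {f F : RatFun} (h : AllNum f) (hF : F = f ∨ F = -f) :
    ¬ Cls .divide F := by
  rintro ⟨P', N', h', -, ⟨X, hX⟩⟩
  obtain ⟨P, hP⟩ := h
  obtain ⟨X', hX', -⟩ := (h'.lder_neg_match hP (by
    rcases hF with rfl | rfl
    · exact Or.inl rfl
    · exact Or.inr (neg_neg f).symm)).2 X hX
  simp at hX'

theorem Cls.allNum_iff {o : Op} {f : RatFun} (h : Cls o f) : AllNum f ↔ o ≠ .divide := by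
  constructor
  · rintro hn rfl
    exact hn.not_divide (Or.inl rfl) h
  · intro ho
    have hA := h.isAE
    cases o
    · exact allNum_of_not_mulDec hA (h.addDec (Or.inl rfl)).not_mulDec
    · exact allNum_of_not_mulDec hA (h.addDec (Or.inr rfl)).not_mulDec
    · exact h.2.2
    · exact absurd rfl ho

/-- `AddDec` separates + and - from × and ÷, `AllPos` singles out -, and `AllNum` singles out ÷. -/
theorem Cls.unique {o o' : Op} {f : RatFun} (h : Cls o f) (h' : Cls o' f) : o = o' := by
  have h1 : (o = .plus ∨ o = .minus) → ¬ (o' = .times ∨ o' = .divide) :=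
    fun ho ho' => h'.not_addDec ho' (h.addDec ho)
  have h2 : (o' = .plus ∨ o' = .minus) → ¬ (o = .times ∨ o = .divide) :=
    fun ho ho' => h.not_addDec ho' (h'.addDec ho)
  have h3 : o ≠ .minus ↔ o' ≠ .minus := h.allPos_iff.symm.trans h'.allPos_iff
  have h4 : o ≠ .divide ↔ o' ≠ .divide := h.allNum_iff.symm.trans h'.allNum_iff
  cases o <;> cases o' <;> simp at h1 h2 h3 h4 ⊢

theorem not_isAE_neg_atom (i : ℕ) : ¬ IsAE (-atom i) := by
  intro h
  have h1 := h.eq_atom (by rw [vars_neg, vars_atom])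
  have h2 : (2 : RatFun) * atom i = 0 := by
    rw [two_mul]
    nth_rewrite 1 [← h1]
    exact neg_add_cancel _
  exact mul_ne_zero two_ne_zero_ratFun (IsAE.atom i).ne_zero h2

theorem Cls.plus_of {g h : RatFun} (hg : IsAE g) (hh : IsAE h) (hgp : AllPos g) (hhp : AllPos h)
    (hd : Disjoint (vars g) (vars h)) : Cls .plus (g + h) := by
  obtain ⟨S, hS, hSA⟩ := hgp
  obtain ⟨T, hT, hTA⟩ := hhp
  refine ⟨_, hS.add hT hd, fun X hX => ?_, ?_⟩
  · rcases Finset.mem_union.1 hX with h | h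
    exacts [hSA X h, hTA X h]
  · rw [Finset.card_union_of_disjoint (hS.disjoint hT hd)]
    have h1 := (hS.nonempty hg.vars_nonempty).card_pos
    have h2 := (hT.nonempty hh.vars_nonempty).card_pos
    omega

/-- The summands of -f are the negatives of those of f, and a sum of summands is an expression
exactly if one of them is. -/
theorem IsSumOf.isFirstType_iff {f : RatFun} {S : Finset RatFun} (h : IsSumOf f S)
    (hf : IsAE f) : IsFirstType f ↔ ∀ X ∈ S, ¬ IsAE (-X) := by
  constructor
  · intro hf X hX hA
    exact hf.2 (h.neg.isAE (Finset.mem_image_of_mem _ hX) hA)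
  · intro hX
    refine ⟨hf, fun hA => ?_⟩
    obtain ⟨T, hT, Y, hY, hYA⟩ := hA.exists_isSumOf
    rw [← h.neg.unique hT] at hY
    obtain ⟨X, hXS, rfl⟩ := Finset.mem_image.1 hY
    exact hX X hXS hYA

theorem Cls.minus_of {g h : RatFun} (hg : IsAE g) (hh : IsFirstType h) (hgp : AllPos g)
    (hd : Disjoint (vars g) (vars h)) : Cls .minus (g - h) := by
  obtain ⟨S, hS, hSA⟩ := hgp
  obtain ⟨T, hT, -⟩ := hh.1.exists_isSumOf
  obtain ⟨X, hX⟩ := hS.nonempty hg.vars_nonempty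
  obtain ⟨Y, hY⟩ := hT.nonempty hh.1.vars_nonempty
  rw [sub_eq_add_neg]
  exact ⟨_, hS.add hT.neg (by rwa [vars_neg]), ⟨X, Finset.mem_union_left _ hX, hSA X hX⟩,
    -Y, Finset.mem_union_right _ (Finset.mem_image_of_mem _ hY),
    (hT.isFirstType_iff hh.1).1 hh Y hY⟩

theorem Cls.times_of {g h : RatFun} (hg : IsAE g) (hh : IsAE h) (hgp : AllNum g) (hhp : AllNum h)
    (hd : Disjoint (vars g) (vars h)) : Cls .times (g * h) := by
  obtain ⟨P, hP⟩ := hgp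
  obtain ⟨P', hP'⟩ := hhp
  refine ⟨hg.mul hh hd, fun ha => ha.not_mulDec ⟨g, h, rfl, hd, hg.vars_nonempty,
    hh.vars_nonempty⟩, P ∪ P', by simpa using hP.mul hP' hd⟩

theorem Cls.divide_of {g h : RatFun} (hg : IsAE g) (hh : IsAE h) (hgp : AllNum g)
    (hhp : AllNum h) (hd : Disjoint (vars g) (vars h)) : Cls .divide (g / h) := by
  obtain ⟨P, hP⟩ := hgp
  obtain ⟨P', hP'⟩ := hhp
  exact ⟨P, P', by simpa using hP.div hP' hd, hP.nonempty hg.vars_nonempty,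
    hP'.nonempty hh.vars_nonempty⟩

theorem EndsWith.cls {o : Op} {f : RatFun} (h : EndsWith o f) : Cls o f := by
  induction h with
  | atom i => exact ⟨IsAE.atom i, not_addDec_atom i,
      allNum_of_not_mulDec (IsAE.atom i) (not_mulDec_atom i)⟩
  | pair o i j hij =>
    have hi := IsAE.atom i
    have hj := IsAE.atom j
    have hd : Disjoint (vars (ArithExpr.atom i)) (vars (ArithExpr.atom j)) := by
      rw [vars_atom, vars_atom]
      simpa using hij
    have hpi := allPos_of_not_addDec hi (not_addDec_atom i)
    have hpj := allPos_of_not_addDec hj (not_addDec_atom j)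
    have hni := allNum_of_not_mulDec hi (not_mulDec_atom i)
    have hnj := allNum_of_not_mulDec hj (not_mulDec_atom j)
    cases o
    · exact Cls.plus_of hi hj hpi hpj hd
    · exact Cls.minus_of hi ⟨hj, not_isAE_neg_atom j⟩ hpi hd
    · exact Cls.times_of hi hj hni hnj hd
    · exact Cls.divide_of hi hj hni hnj hd
  | plus f g h o₁ o₂ hf hcard hg hh hfgh hV _ _ ho₁ ho₂ ih₁ ih₂ =>
    rw [hfgh]
    exact Cls.plus_of hg hh (ih₁.allPos_iff.2 (by rcases ho₁ with rfl | rfl | rfl <;> simp))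
      (ih₂.allPos_iff.2 (by rcases ho₂ with rfl | rfl | rfl <;> simp)) hV.1
  | minus f g h o₁ o₂ hf hcard hg hh hfgh hV _ _ ho₁ ho₂ hfirst ih₁ ih₂ =>
    rw [hfgh]
    exact Cls.minus_of hg hfirst
      (ih₁.allPos_iff.2 (by rcases ho₁ with rfl | rfl | rfl <;> simp)) hV.1
  | times f g h o₁ o₂ hf hcard hg hh hfgh hV _ _ ho₁ ho₂ ih₁ ih₂ =>
    rw [hfgh]
    exact Cls.times_of hg hh (ih₁.allNum_iff.2 (by rcases ho₁ with rfl | rfl | rfl <;> simp))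
      (ih₂.allNum_iff.2 (by rcases ho₂ with rfl | rfl | rfl <;> simp)) hV.1
  | divide f g h o₁ o₂ hf hcard hg hh hfgh hV _ _ ho₁ ho₂ ih₁ ih₂ =>
    rw [hfgh]
    exact Cls.divide_of hg hh (ih₁.allNum_iff.2 (by rcases ho₁ with rfl | rfl | rfl <;> simp))
      (ih₂.allNum_iff.2 (by rcases ho₂ with rfl | rfl | rfl <;> simp)) hV.1

/-- An arithmetic expression that is not atomic splits according to one of the four recursive
clauses of the definition of the last operator. -/
theorem IsAE.exists_split {f : RatFun} (hf : IsAE f) (hat : ¬ ∃ i, f = ArithExpr.atom i) :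
    ∃ g h : RatFun, IsAE g ∧ IsAE h ∧ Disjoint (vars g) (vars h) ∧
      ((f = g + h ∧ AllPos g ∧ AllPos h) ∨ (f = g - h ∧ AllPos g ∧ AllPos h ∧ IsFirstType h) ∨
        (f = g * h ∧ AllNum g ∧ AllNum h) ∨ (f = g / h ∧ AllNum g ∧ AllNum h)) := by
  rcases hf.atom_or_dec with h | ha | hm
  · exact absurd h hat
  · obtain ⟨S, hS, X, hX, hXA⟩ := hf.exists_isSumOf
    by_cases hall : ∀ Y ∈ S, IsAE Y
    · have hsub := Finset.erase_subset X S
      have hd : Disjoint (vars X) (vars (∑ Z ∈ S.erase X, Z)) := by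
        simpa using hS.disjoint_vars (T := {X}) (by simpa using hX) hsub (by simp)
      have hY : ∃ Y, Y ∈ S.erase X := by
        by_contra hno
        push Not at hno
        apply (hS.summand X hX).2
        rwa [hS.eq, ← Finset.add_sum_erase S _ hX, Finset.eq_empty_of_forall_notMem hno,
          Finset.sum_empty, add_zero] at ha
      obtain ⟨Y, hY⟩ := hY
      refine ⟨X, ∑ Z ∈ S.erase X, Z, hXA,
        (hS.subset hsub).isAE hY (hall Y (Finset.mem_of_mem_erase hY)), hd, Or.inl ⟨?_, ?_, ?_⟩⟩
      · rw [hS.eq, Finset.add_sum_erase S (fun Z => Z) hX]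
      · exact allPos_of_not_addDec hXA (hS.summand X hX).2
      · exact ⟨_, hS.subset hsub, fun Z hZ => hall Z (Finset.mem_of_mem_erase hZ)⟩
    -- The summands that are expressions form g; the negatives of the others form h. No summand of h
    -- has an expression as its negative, so h is of the first type.
    · push Not at hall
      obtain ⟨Y, hY, hYA⟩ := hall
      have hp := hS.subset (Finset.filter_subset IsAE S)
      have hn := hS.subset (Finset.filter_subset (fun X => ¬ IsAE X) S)
      have hd := hS.disjoint_vars (Finset.filter_subset IsAE S)
        (Finset.filter_subset (fun X => ¬ IsAE X) S) (Finset.disjoint_filter_filter_not _ _ _)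
      have hYn : -Y ∈ (S.filter fun X => ¬ IsAE X).image fun X => -X :=
        Finset.mem_image_of_mem _ (Finset.mem_filter.2 ⟨hY, hYA⟩)
      have hhA : IsAE (-∑ X ∈ S.filter fun X => ¬ IsAE X, X) :=
        hn.neg.isAE hYn ((hS.summand Y hY).1.resolve_left hYA)
      refine ⟨∑ X ∈ S.filter IsAE, X, -∑ X ∈ S.filter fun X => ¬ IsAE X, X,
        hp.isAE (Finset.mem_filter.2 ⟨hX, hXA⟩) hXA, hhA, by rwa [vars_neg],
        Or.inr (Or.inl ⟨?_, ⟨_, hp, fun Z hZ => (Finset.mem_filter.1 hZ).2⟩,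
          ⟨_, hn.neg, fun Z hZ => ?_⟩, (hn.neg.isFirstType_iff hhA).2 fun Z hZ => ?_⟩)⟩
      · rw [sub_neg_eq_add, Finset.sum_filter_add_sum_filter_not, ← hS.eq]
      · obtain ⟨W, hW, rfl⟩ := Finset.mem_image.1 hZ
        obtain ⟨hW1, hW2⟩ := Finset.mem_filter.1 hW
        exact (hS.summand W hW1).1.resolve_left hW2
      · obtain ⟨W, hW, rfl⟩ := Finset.mem_image.1 hZ
        rw [neg_neg]
        exact (Finset.mem_filter.1 hW).2
  · obtain ⟨P, N, h, hP⟩ := hf.exists_isFracOf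
    rcases N.eq_empty_or_nonempty with rfl | hN
    · obtain ⟨X, hX⟩ := hP
      have hXf := h.factor X (Finset.mem_union_left _ hX)
      have hsub : P.erase X ⊆ P ∪ ∅ := (Finset.erase_subset X P).trans Finset.subset_union_left
      have hfX : f = X * ∏ Z ∈ P.erase X, Z := by
        rw [h.eq, Finset.prod_empty, div_one, Finset.mul_prod_erase P (fun Z => Z) hX]
      have hd : Disjoint (vars X) (vars (∏ Z ∈ P.erase X, Z)) := by
        simpa using h.disjoint_vars (T := {X}) (by simpa using hX) hsub (by simp)
      have hY : (P.erase X).Nonempty := by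
        rw [Finset.nonempty_iff_ne_empty]
        intro hno
        apply hXf.2
        rwa [hfX, hno, Finset.prod_empty, mul_one] at hm
      exact ⟨X, ∏ Z ∈ P.erase X, Z, hXf.1, (h.num hsub).isAE hY, hd,
        Or.inr (Or.inr (Or.inl ⟨hfX, allNum_of_not_mulDec hXf.1 hXf.2, _, h.num hsub⟩))⟩
    · have h1 := h.num (P' := P) Finset.subset_union_left
      have h2 := h.num (P' := N) Finset.subset_union_right
      exact ⟨_, _, h1.isAE hP, h2.isAE hN,
        h.disjoint_vars Finset.subset_union_left Finset.subset_union_right h.disjoint,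
        Or.inr (Or.inr (Or.inr ⟨h.eq, ⟨P, h1⟩, N, h2⟩))⟩

theorem IsAE.exists_atom_of_ncard {f : RatFun} (hf : IsAE f) (h : (vars f).ncard = 1) :
    ∃ i, f = ArithExpr.atom i := by
  obtain ⟨i, hi⟩ := Set.ncard_eq_one.1 h
  exact ⟨i, hf.eq_atom hi⟩

theorem IsAE.exists_endsWith {f : RatFun} (hf : IsAE f) : ∃ o, EndsWith o f := by
  obtain ⟨n, hn⟩ : ∃ n, (vars f).ncard = n := ⟨_, rfl⟩
  induction n using Nat.strong_induction_on generalizing f with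
  | _ n ih =>
  by_cases hat : ∃ i, f = ArithExpr.atom i
  · obtain ⟨i, rfl⟩ := hat
    exact ⟨_, EndsWith.atom i⟩
  have hpos : ∀ {g : RatFun}, IsAE g → 0 < (vars g).ncard := fun {g} hg =>
    (Set.ncard_pos (vars_finite g)).2 hg.vars_nonempty
  have hcard : ∀ {g h : RatFun}, Disjoint (vars g) (vars h) → vars f = vars g ∪ vars h →
      (vars g).ncard + (vars h).ncard = n := by
    intro g h hd hv
    rw [← hn, hv, Set.ncard_union_eq hd (vars_finite g) (vars_finite h)]
  by_cases h3 : 3 ≤ n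
  · obtain ⟨g, h, hg, hh, hd, hcase⟩ := hf.exists_split hat
    have hv : vars f = vars g ∪ vars h := by
      rcases hcase with hc | hc | hc | hc <;> rw [hc.1]
      exacts [vars_add hd, vars_sub hd, vars_mul hg.ne_zero hh.ne_zero hd,
        vars_div hg.ne_zero hh.ne_zero hd]
    have hc := hcard hd hv
    have h1 := hpos hg
    have h2 := hpos hh
    obtain ⟨o₁, ho₁⟩ := ih _ (by omega) hg rfl
    obtain ⟨o₂, ho₂⟩ := ih _ (by omega) hh rfl
    have hV : IsDisjUnion (vars g) (vars h) (vars f) := ⟨hd, hv.symm⟩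
    rcases hcase with ⟨he, hp, hp'⟩ | ⟨he, hp, hp', hfi⟩ | ⟨he, hp, hp'⟩ | ⟨he, hp, hp'⟩
    · have h4 := ho₁.cls.allPos_iff.1 hp
      have h5 := ho₂.cls.allPos_iff.1 hp'
      exact ⟨_, EndsWith.plus f g h o₁ o₂ hf (hn ▸ h3) hg hh he hV ho₁ ho₂
        (by cases o₁ <;> simp_all) (by cases o₂ <;> simp_all)⟩
    · have h4 := ho₁.cls.allPos_iff.1 hp
      have h5 := ho₂.cls.allPos_iff.1 hp'
      exact ⟨_, EndsWith.minus f g h o₁ o₂ hf (hn ▸ h3) hg hh he hV ho₁ ho₂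
        (by cases o₁ <;> simp_all) (by cases o₂ <;> simp_all) hfi⟩
    · have h4 := ho₁.cls.allNum_iff.1 hp
      have h5 := ho₂.cls.allNum_iff.1 hp'
      exact ⟨_, EndsWith.times f g h o₁ o₂ hf (hn ▸ h3) hg hh he hV ho₁ ho₂
        (by cases o₁ <;> simp_all) (by cases o₂ <;> simp_all)⟩
    · have h4 := ho₁.cls.allNum_iff.1 hp
      have h5 := ho₂.cls.allNum_iff.1 hp'
      exact ⟨_, EndsWith.divide f g h o₁ o₂ hf (hn ▸ h3) hg hh he hV ho₁ ho₂
        (by cases o₁ <;> simp_all) (by cases o₂ <;> simp_all)⟩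
  -- With fewer than three variables both operands have exactly one and are atoms, so the outermost
  -- operation is an instance of the explicit two-variable clause.
  · cases hf with
    | atom i => exact absurd ⟨i, rfl⟩ hat
    | op o g h hg hh hV =>
      have hc := hcard hV.1 hV.2.symm
      have h1 := hpos hg
      have h2 := hpos hh
      obtain ⟨i, rfl⟩ := hg.exists_atom_of_ncard (by omega)
      obtain ⟨j, rfl⟩ := hh.exists_atom_of_ncard (by omega)
      refine ⟨o, EndsWith.pair o i j ?_⟩
      rintro rfl
      simpa [vars_atom] using hV.1

/-- Existence of some last operator and uniqueness of `Cls` together give the converse of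
`EndsWith.cls`. -/
theorem mem_AEop_iff {o : Op} {f : RatFun} : f ∈ AEop o ↔ Cls o f := by
  constructor
  · exact fun h => h.2.cls
  · intro h
    obtain ⟨o', ho'⟩ := h.isAE.exists_endsWith
    rw [h.unique ho'.cls]
    exact ⟨h.isAE, ho'⟩

theorem IsAE.exists_cls {f : RatFun} (hf : IsAE f) : ∃ o, Cls o f :=
  hf.exists_endsWith.imp fun _ h => h.cls

theorem mem_AEop_pos_iff {f : RatFun} :
    f ∈ AEop .plus ∪ AEop .times ∪ AEop .divide ↔ IsAE f ∧ AllPos f := by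
  simp only [Set.mem_union, mem_AEop_iff]
  constructor
  · rintro ((h | h) | h) <;> exact ⟨h.isAE, h.allPos_iff.2 (by simp)⟩
  · rintro ⟨hf, hp⟩
    obtain ⟨o, ho⟩ := hf.exists_cls
    have := ho.allPos_iff.1 hp
    cases o <;> simp_all

theorem mem_AEop_num_iff {f : RatFun} :
    f ∈ AEop .plus ∪ AEop .minus ∪ AEop .times ↔ IsAE f ∧ AllNum f := by
  simp only [Set.mem_union, mem_AEop_iff]
  constructor
  · rintro ((h | h) | h) <;> exact ⟨h.isAE, h.allNum_iff.2 (by simp)⟩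
  · rintro ⟨hf, hp⟩
    obtain ⟨o, ho⟩ := hf.exists_cls
    have := ho.allNum_iff.1 hp
    cases o <;> simp_all

theorem mem_AEop_mul_iff {f : RatFun} :
    f ∈ AEop .times ∪ AEop .divide ↔ IsAE f ∧ ¬ AddDec f := by
  simp only [Set.mem_union, mem_AEop_iff]
  constructor
  · rintro (h | h) <;> exact ⟨h.isAE, h.not_addDec (by simp)⟩
  · rintro ⟨hf, hp⟩
    obtain ⟨o, ho⟩ := hf.exists_cls
    have := mt ho.addDec hp
    cases o <;> simp_all

theorem mem_AEop_add_iff {f : RatFun} :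
    f ∈ AEop .plus ∪ AEop .minus ↔ IsAE f ∧ AddDec f := by
  simp only [Set.mem_union, mem_AEop_iff]
  constructor
  · rintro (h | h) <;> exact ⟨h.isAE, h.addDec (by simp)⟩
  · rintro ⟨hf, hp⟩
    obtain ⟨o, ho⟩ := hf.exists_cls
    have := fun h => ho.not_addDec h hp
    cases o <;> simp_all

theorem isFactor_iff {f : RatFun} :
    IsFactor f ↔ (∃ i, f = atom i) ∨ f ∈ AEop .plus ∪ AEop .minus := by
  rw [mem_AEop_add_iff]
  constructor
  · intro h
    exact h.atom_or_addDec.imp_right fun ha => ⟨h.1, ha⟩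
  · rintro (⟨i, rfl⟩ | ⟨h, ha⟩)
    exacts [isFactor_atom i, ⟨h, ha.not_mulDec⟩]

/-! ### Multilinear forms and monic functions -/

theorem isMultilinear_iff {P : Poly} :
    IsMultilinear P ↔ ∀ i, MvPolynomial.degreeOf i P ≤ 1 := by
  simp only [MvPolynomial.degreeOf_le_iff, IsMultilinear]
  exact ⟨fun h i m hm => h m hm i, fun h m hm i => h i m hm⟩

theorem IsMultilinear.mul {P Q : Poly} (hP : IsMultilinear P) (hQ : IsMultilinear Q)
    (hd : Disjoint P.vars Q.vars) : IsMultilinear (P * Q) := by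
  rw [isMultilinear_iff] at *
  intro i
  refine (MvPolynomial.degreeOf_mul_le i P Q).trans ?_
  by_cases hi : i ∈ P.vars
  · have h := Finset.disjoint_left.1 hd hi
    rw [MvPolynomial.mem_vars_iff_degreeOf_ne_zero, not_not] at h
    rw [h, add_zero]
    exact hP i
  · rw [MvPolynomial.mem_vars_iff_degreeOf_ne_zero, not_not] at hi
    rw [hi, zero_add]
    exact hQ i

theorem IsMultilinear.add {P Q : Poly} (hP : IsMultilinear P) (hQ : IsMultilinear Q) :
    IsMultilinear (P + Q) := by
  rw [isMultilinear_iff] at *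
  exact fun i => (MvPolynomial.degreeOf_add_le i P Q).trans (max_le (hP i) (hQ i))

theorem IsMultilinear.neg {P : Poly} (hP : IsMultilinear P) : IsMultilinear (-P) := by
  intro m hm
  rw [MvPolynomial.support_neg] at hm
  exact hP m hm

/-- Degrees in each variable add under multiplication, so a common divisor contains no variable and
is a nonzero constant. -/
theorem isRelPrime_of_disjoint_vars {P Q : Poly} (hP : P ≠ 0) (hQ : Q ≠ 0)
    (hd : Disjoint P.vars Q.vars) : IsRelPrime P Q := by
  have key : ∀ {R d : Poly}, R ≠ 0 → d ∣ R → d.vars ⊆ R.vars := by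
    rintro R d hR ⟨e, rfl⟩ i hi
    rw [MvPolynomial.mem_vars_iff_degreeOf_ne_zero] at hi ⊢
    rw [MvPolynomial.degreeOf_mul_eq (left_ne_zero_of_mul hR) (right_ne_zero_of_mul hR)]
    omega
  intro d h1 h2
  have h3 : d.vars = ∅ := Finset.subset_empty.1 ((Finset.disjoint_iff_inter_eq_empty.1 hd) ▸
    Finset.subset_inter (key hP h1) (key hQ h2))
  rw [MvPolynomial.vars_eq_empty_iff_eq_C] at h3
  have h4 : d ≠ 0 := by
    rintro rfl
    exact hP (zero_dvd_iff.1 h1)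
  rw [h3] at h4 ⊢
  apply IsUnit.map
  rw [isUnit_iff_ne_zero]
  intro h5
  rw [h5, MvPolynomial.C_0] at h4
  exact h4 rfl

/-- `f = P / Q` in lowest terms, with multilinear `P` and `Q`. -/
structure IsForm (f : RatFun) (P Q : Poly) : Prop where
  num : IsMultilinear P
  den : IsMultilinear Q
  coprime : IsRelPrime P Q
  ne_zero : Q ≠ 0
  eq : f = ofPoly P / ofPoly Q

theorem IsForm.vars_subset {f : RatFun} {P Q : Poly} (h : IsForm f P Q) :
    ↑P.vars ⊆ vars f ∧ ↑Q.vars ⊆ vars f := by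
  have := vars_subset_of_reduced h.coprime h.ne_zero
  rw [← h.eq, Finset.coe_union, Set.union_subset_iff] at this
  exact this

theorem IsForm.num_ne_zero {f : RatFun} {P Q : Poly} (h : IsForm f P Q) (hf : f ≠ 0) : P ≠ 0 := by
  rintro rfl
  apply hf
  rw [h.eq, ofPoly_zero, zero_div]

theorem IsForm.neg {f : RatFun} {P Q : Poly} (h : IsForm f P Q) : IsForm (-f) (-P) Q :=
  ⟨h.num.neg, h.den, h.coprime.neg_left, h.ne_zero, by rw [h.eq, ofPoly_neg, neg_div]⟩

theorem IsForm.inv {f : RatFun} {P Q : Poly} (h : IsForm f P Q) (hf : f ≠ 0) : IsForm f⁻¹ Q P :=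
  ⟨h.den, h.num, h.coprime.symm, h.num_ne_zero hf, by rw [h.eq, inv_div]⟩

theorem disjoint_vars_of_subset {f g : RatFun} (hd : Disjoint (vars f) (vars g)) {P Q : Poly}
    (hP : ↑P.vars ⊆ vars f) (hQ : ↑Q.vars ⊆ vars g) : Disjoint P.vars Q.vars :=
  Finset.disjoint_coe.1 (hd.mono hP hQ)

theorem IsForm.add {f g : RatFun} {P Q P' Q' : Poly} (h : IsForm f P Q) (h' : IsForm g P' Q')
    (hd : Disjoint (vars f) (vars g)) : IsForm (f + g) (P * Q' + P' * Q) (Q * Q') := by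
  obtain ⟨h1, h2⟩ := h.vars_subset
  obtain ⟨h1', h2'⟩ := h'.vars_subset
  have hQQ := disjoint_vars_of_subset hd h2 h2'
  have hrel := isRelPrime_of_disjoint_vars h.ne_zero h'.ne_zero hQQ
  refine ⟨(h.num.mul h'.den (disjoint_vars_of_subset hd h1 h2')).add
    (h'.num.mul h.den (disjoint_vars_of_subset hd h2 h1').symm), h.den.mul h'.den hQQ, ?_,
    mul_ne_zero h.ne_zero h'.ne_zero, ?_⟩
  · apply IsRelPrime.mul_right
    -- Modulo Q the numerator is P * Q', and Q is coprime to P and, having other variables, to Q'.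
    -- The argument modulo Q' is the same.
    · refine IsRelPrime.of_add_mul_right_left (z := -P') ?_
      rw [show P * Q' + P' * Q + -P' * Q = P * Q' by ring]
      exact h.coprime.mul_left hrel.symm
    · refine IsRelPrime.of_add_mul_right_left (z := -P) ?_
      rw [show P * Q' + P' * Q + -P * Q' = P' * Q by ring]
      exact h'.coprime.mul_left hrel
  · have hQ := ofPoly_ne_zero h.ne_zero
    have hQ' := ofPoly_ne_zero h'.ne_zero
    rw [h.eq, h'.eq, ofPoly_add, ofPoly_mul, ofPoly_mul, ofPoly_mul, div_add_div _ _ hQ hQ',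
      mul_comm (ofPoly Q) (ofPoly P')]

theorem IsForm.mul {f g : RatFun} {P Q P' Q' : Poly} (h : IsForm f P Q) (h' : IsForm g P' Q')
    (hf : f ≠ 0) (hg : g ≠ 0) (hd : Disjoint (vars f) (vars g)) :
    IsForm (f * g) (P * P') (Q * Q') := by
  obtain ⟨h1, h2⟩ := h.vars_subset
  obtain ⟨h1', h2'⟩ := h'.vars_subset
  refine ⟨h.num.mul h'.num (disjoint_vars_of_subset hd h1 h1'),
    h.den.mul h'.den (disjoint_vars_of_subset hd h2 h2'), ?_,
    mul_ne_zero h.ne_zero h'.ne_zero, ?_⟩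
  · apply IsRelPrime.mul_right <;> apply IsRelPrime.mul_left
    · exact h.coprime
    · exact (isRelPrime_of_disjoint_vars h.ne_zero (h'.num_ne_zero hg)
        (disjoint_vars_of_subset hd h2 h1')).symm
    · exact isRelPrime_of_disjoint_vars (h.num_ne_zero hf) h'.ne_zero
        (disjoint_vars_of_subset hd h1 h2')
    · exact h'.coprime
  · rw [h.eq, h'.eq, ofPoly_mul, ofPoly_mul, div_mul_div_comm]

/-- All coefficients of `P` are nonnegative. -/
def CoeffNonneg (P : Poly) : Prop := ∀ m, 0 ≤ P.coeff m

theorem CoeffNonneg.add {P Q : Poly} (hP : CoeffNonneg P) (hQ : CoeffNonneg Q) :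
    CoeffNonneg (P + Q) := fun m => by
  rw [MvPolynomial.coeff_add]
  exact add_nonneg (hP m) (hQ m)

theorem CoeffNonneg.mul {P Q : Poly} (hP : CoeffNonneg P) (hQ : CoeffNonneg Q) :
    CoeffNonneg (P * Q) := fun m => by
  rw [MvPolynomial.coeff_mul]
  exact Finset.sum_nonneg fun x _ => mul_nonneg (hP _) (hQ _)

theorem coeffNonneg_X (i : ℕ) : CoeffNonneg (MvPolynomial.X i) := fun m => by
  rw [MvPolynomial.coeff_X]
  split_ifs <;> simp

theorem coeffNonneg_one : CoeffNonneg 1 := fun m => by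
  rw [MvPolynomial.coeff_one]
  split_ifs <;> simp

theorem isForm_atom (i : ℕ) : IsForm (atom i) (MvPolynomial.X i) 1 := by
  refine ⟨?_, ?_, isRelPrime_one_right, one_ne_zero, by rw [ofPoly_one, div_one, atom]⟩ <;>
    rw [isMultilinear_iff] <;> intro j
  · rw [MvPolynomial.degreeOf_X]
    split_ifs <;> simp
  · simp

/-- An arithmetic expression has a multilinear form; if its negative is not an arithmetic
expression, then this form has nonnegative coefficients. -/
theorem IsAE.exists_isForm {f : RatFun} (hf : IsAE f) :
    ∃ P Q, IsForm f P Q ∧ (IsAE (-f) ∨ (CoeffNonneg P ∧ CoeffNonneg Q)) := by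
  induction hf with
  | atom i => exact ⟨_, _, isForm_atom i, Or.inr ⟨coeffNonneg_X i, coeffNonneg_one⟩⟩
  | op o g h hg hh hV ihg ihh =>
    obtain ⟨P, Q, hPQ, hs⟩ := ihg
    obtain ⟨P', Q', hPQ', hs'⟩ := ihh
    have hd := hV.1
    have hdn : Disjoint (vars g) (vars (-h)) := by rwa [vars_neg]
    have hnd : Disjoint (vars (-g)) (vars h) := by rwa [vars_neg]
    cases o <;> simp only [Op.apply]
    · refine ⟨_, _, hPQ.add hPQ' hd, ?_⟩
      rcases hs with hs | ⟨h1, h2⟩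
      · left
        rw [neg_add']
        exact hs.sub hh hnd
      rcases hs' with hs' | ⟨h1', h2'⟩
      · left
        rw [neg_add_rev, ← sub_eq_add_neg]
        exact hs'.sub hg hdn.symm
      exact Or.inr ⟨(h1.mul h2').add (h1'.mul h2), h2.mul h2'⟩
    · rw [sub_eq_add_neg]
      -- The negative of a difference is the reversed difference, so cancellation of signs arises
      -- only where -f is an expression and no coefficient condition is claimed.
      refine ⟨_, _, hPQ.add hPQ'.neg hdn, Or.inl ?_⟩
      rw [← sub_eq_add_neg, neg_sub]
      exact hh.sub hg hd.symm
    · refine ⟨_, _, hPQ.mul hPQ' hg.ne_zero hh.ne_zero hd, ?_⟩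
      rcases hs with hs | ⟨h1, h2⟩
      · left
        rw [← neg_mul]
        exact hs.mul hh hnd
      rcases hs' with hs' | ⟨h1', h2'⟩
      · left
        rw [← mul_neg]
        exact hg.mul hs' hdn
      exact Or.inr ⟨h1.mul h1', h2.mul h2'⟩
    · rw [div_eq_mul_inv]
      refine ⟨_, _, hPQ.mul (hPQ'.inv hh.ne_zero) hg.ne_zero (inv_ne_zero hh.ne_zero)
        (by rwa [vars_inv]), ?_⟩
      rw [← div_eq_mul_inv]
      rcases hs with hs | ⟨h1, h2⟩
      · left
        rw [← neg_div]
        exact hs.div hh hnd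
      rcases hs' with hs' | ⟨h1', h2'⟩
      · left
        rw [← div_neg]
        exact hg.div hs' hdn
      exact Or.inr ⟨h1.mul h2', h2.mul h1'⟩

theorem word_injective {m m' : ℕ →₀ ℕ} (hm : ∀ i, m i ≤ 1) (hm' : ∀ i, m' i ≤ 1)
    (h : word m = word m') : m = m' := by
  have hs : m.support = m'.support := by
    have := congrArg List.toFinset h
    simpa [word] using this
  ext i
  have h1 := hm i
  have h2 := hm' i
  have h3 : m i ≠ 0 ↔ m' i ≠ 0 := by
    rw [← Finsupp.mem_support_iff, hs, Finsupp.mem_support_iff]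
  omega

theorem exists_leading {P : Poly} (hP : IsMultilinear P) (h0 : P ≠ 0) :
    ∃ m ∈ P.support, ∀ m' ∈ P.support, m' ≠ m → word m < word m' := by
  obtain ⟨m, hm, hmin⟩ := Finset.exists_min_image P.support word
    (MvPolynomial.support_nonempty.2 h0)
  refine ⟨m, hm, fun m' hm' hne => lt_of_le_of_ne (hmin m' hm') fun he => ?_⟩
  exact hne (word_injective (hP m' hm') (hP m hm) he.symm)

theorem isMonicPoly_or_neg {P : Poly} (hP : IsMultilinear P) (h0 : P ≠ 0) :
    IsMonicPoly P ∨ IsMonicPoly (-P) := by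
  obtain ⟨m, hm, hmin⟩ := exists_leading hP h0
  rcases lt_or_gt_of_ne (MvPolynomial.mem_support_iff.1 hm) with h | h
  · right
    refine ⟨m, by rwa [MvPolynomial.support_neg], ?_, ?_⟩
    · rwa [MvPolynomial.support_neg]
    · rw [MvPolynomial.coeff_neg]
      linarith
  · exact Or.inl ⟨m, hm, hmin, h⟩

theorem CoeffNonneg.isMonicPoly {P : Poly} (h : CoeffNonneg P) (hP : IsMultilinear P)
    (h0 : P ≠ 0) : IsMonicPoly P := by
  obtain ⟨m, hm, hmin⟩ := exists_leading hP h0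
  exact ⟨m, hm, hmin, lt_of_le_of_ne (h m) (MvPolynomial.mem_support_iff.1 hm).symm⟩

theorem IsMonicPoly.ne_zero {P : Poly} (h : IsMonicPoly P) : P ≠ 0 := by
  rintro rfl
  obtain ⟨m, hm, -⟩ := h
  simp at hm

theorem IsMonicPoly.pos_of_C_mul {P : Poly} {c : ℝ} (h : IsMonicPoly P)
    (h' : IsMonicPoly (MvPolynomial.C c * P)) : 0 < c := by
  have hc : c ≠ 0 := by
    rintro rfl
    exact h'.ne_zero (by simp)
  obtain ⟨m, hm, hmin, hpos⟩ := h
  obtain ⟨m', hm', hmin', hpos'⟩ := h'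
  have hs : (MvPolynomial.C c * P).support = P.support := by
    ext x
    simp [MvPolynomial.mem_support_iff, MvPolynomial.coeff_C_mul, hc]
  rw [hs] at hm' hmin'
  have he : m = m' := by
    by_contra hne
    exact lt_asymm (hmin m' hm' (Ne.symm hne)) (hmin' m hm hne)
  rw [MvPolynomial.coeff_C_mul, ← he] at hpos'
  exact pos_of_mul_pos_left hpos' hpos.le

theorem IsForm.isMonic {f : RatFun} {P Q : Poly} (h : IsForm f P Q) (hP : IsMonicPoly P)
    (hQ : IsMonicPoly Q) : IsMonic f :=
  ⟨P, Q, ⟨h.num, h.den, h.coprime, hQ, h.eq⟩, hP⟩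

theorem IsAE.isMonic_or_neg {f : RatFun} (hf : IsAE f) : IsMonic f ∨ IsMonic (-f) := by
  obtain ⟨P, Q, h, -⟩ := hf.exists_isForm
  -- Changing both signs gives a second form of f; with it and the form of -f every combination of
  -- leading signs can be made monic.
  have hn : IsForm f (-P) (-Q) := ⟨h.num.neg, h.den.neg, h.coprime.neg_neg,
    neg_ne_zero.2 h.ne_zero, by rw [h.eq, ofPoly_neg, ofPoly_neg, neg_div_neg_eq]⟩
  rcases isMonicPoly_or_neg h.num (h.num_ne_zero hf.ne_zero) with hP | hP <;>
    rcases isMonicPoly_or_neg h.den h.ne_zero with hQ | hQ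
  · exact Or.inl (h.isMonic hP hQ)
  · have := hn.neg
    rw [neg_neg] at this
    exact Or.inr (this.isMonic hP hQ)
  · exact Or.inr (h.neg.isMonic hP hQ)
  · exact Or.inl (hn.isMonic hP hQ)

/-- Reduced denominators differ by a constant, which is positive as both are monic. The numerators
of f and -f then differ by a negative constant and cannot both be monic. -/
theorem IsMonic.not_neg {f : RatFun} (hf : IsMonic f) : ¬ IsMonic (-f) := by
  rintro ⟨P', Q', ⟨-, -, hrel', hQ', he'⟩, hP'⟩
  obtain ⟨P, Q, ⟨-, -, hrel, hQ, he⟩, hP⟩ := hf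
  have h1 : P' * Q = -P * Q' := by
    rw [← ofPoly_div_eq_iff hQ'.ne_zero hQ.ne_zero, ← he', he, ofPoly_neg, neg_div]
  have hd1 : Q ∣ Q' := hrel.neg_left.symm.dvd_of_dvd_mul_left (Dvd.intro_left _ h1)
  have hd2 : Q' ∣ Q := hrel'.symm.dvd_of_dvd_mul_left (Dvd.intro_left _ h1.symm)
  obtain ⟨u, hu⟩ := associated_of_dvd_dvd hd1 hd2
  obtain ⟨c, -, hc⟩ := MvPolynomial.isUnit_iff_eq_C_of_isReduced.1 u.isUnit
  rw [hc, mul_comm] at hu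
  have hcpos : 0 < c := hQ.pos_of_C_mul (by rwa [hu])
  have h2 : P' = MvPolynomial.C (-c) * P := by
    apply mul_right_cancel₀ hQ.ne_zero
    rw [h1, ← hu, MvPolynomial.C_neg]
    ring
  have := hP.pos_of_C_mul (h2 ▸ hP')
  linarith

theorem IsFirstType.isMonic {f : RatFun} (hf : IsFirstType f) : IsMonic f := by
  obtain ⟨P, Q, h, hs⟩ := hf.1.exists_isForm
  obtain ⟨hP, hQ⟩ := hs.resolve_left hf.2
  exact h.isMonic (hP.isMonicPoly h.num (h.num_ne_zero hf.1.ne_zero))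
    (hQ.isMonicPoly h.den h.ne_zero)

/-- The monic one of `f` and `-f`. -/
def monicPart (f : RatFun) : RatFun := if IsMonic f then f else -f

theorem monicPart_eq (f : RatFun) : monicPart f = f ∨ monicPart f = -f := by
  unfold monicPart
  split_ifs <;> simp

theorem IsAE.isMonic_monicPart {f : RatFun} (hf : IsAE f) : IsMonic (monicPart f) := by
  unfold monicPart
  split_ifs with h
  exacts [h, hf.isMonic_or_neg.resolve_left h]

/-- If f is not monic, it is not of the first type, so -f is an expression. This is why normalising
to monic parts stays among the arithmetic expressions. -/
theorem IsAE.isAE_monicPart {f : RatFun} (hf : IsAE f) : IsAE (monicPart f) := by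
  unfold monicPart
  split_ifs with h
  · exact hf
  · by_contra hn
    exact h (IsFirstType.isMonic ⟨hf, hn⟩)

theorem IsMonic.eq_of_eq_or_neg {f g : RatFun} (hf : IsMonic f) (hg : IsMonic g)
    (h : g = f ∨ g = -f) : g = f := by
  rcases h with h | rfl
  exacts [h, absurd hg hf.not_neg]

/-! ### Isomorphism classes up to sign -/

/-- Isomorphism up to sign. -/
def signSetoid : Setoid RatFun where
  r X Y := Iso X Y ∨ Iso X (-Y)
  iseqv := by
    refine ⟨fun X => Or.inl (Iso.refl X), ?_, ?_⟩
    · rintro X Y (h | h)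
      exacts [Or.inl h.symm, Or.inr (iso_neg_comm.1 h).symm]
    · rintro X Y Z (h | h) (h' | h')
      · exact Or.inl (h.trans h')
      · exact Or.inr (h.trans h')
      · exact Or.inr (h.trans h'.neg)
      · exact Or.inl (by simpa using h.trans h'.neg)

/-- A representative of the class of `X` for isomorphism up to sign. -/
def signRep (X : RatFun) : RatFun := (Quotient.mk signSetoid X).out

/-- `X` is isomorphic to the representative of its class. -/
def PosSide (X : RatFun) : Prop := Iso X (signRep X)

theorem signRep_spec (X : RatFun) : Iso X (signRep X) ∨ Iso X (-signRep X) :=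
  signSetoid.symm (Quotient.exact (Quotient.out_eq (Quotient.mk signSetoid X)))

theorem signRep_eq {X Y : RatFun} (h : Iso X Y ∨ Iso X (-Y)) : signRep X = signRep Y := by
  unfold signRep
  rw [Quotient.sound (s := signSetoid) h]

theorem Iso.posSide_iff {X Y : RatFun} (h : Iso X Y) : PosSide X ↔ PosSide Y := by
  unfold PosSide
  rw [signRep_eq (Or.inl h)]
  exact ⟨fun h' => h.symm.trans h', fun h' => h.trans h'⟩

/-- X and -X share a representative; one of them is isomorphic to it, and both would be only if X ≅
-X. -/
theorem posSide_neg_iff {X : RatFun} (h : ¬ Iso X (-X)) : PosSide (-X) ↔ ¬ PosSide X := by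
  unfold PosSide
  rw [signRep_eq (X := -X) (Y := X) (Or.inr (Iso.refl _))]
  constructor
  · exact fun h1 h2 => h (h2.trans h1.symm)
  · intro h1
    exact iso_neg_comm.1 ((signRep_spec X).resolve_left h1)

/-- The one of `X` and `-X` that is isomorphic to the representative of their class. -/
def sideSign (X : RatFun) : RatFun := if PosSide X then 1 else -1

theorem sideSign_ne_zero (X : RatFun) : sideSign X ≠ 0 := by
  unfold sideSign
  split_ifs <;> simp

theorem Iso.sideSign_eq {X Y : RatFun} (h : Iso X Y) : sideSign X = sideSign Y := by
  unfold sideSign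
  rw [propext h.posSide_iff]

theorem sideSign_neg_mul {X : RatFun} (h : ¬ Iso X (-X)) :
    sideSign (-X) * -X = sideSign X * X := by
  unfold sideSign
  rw [propext (posSide_neg_iff h)]
  by_cases hX : PosSide X <;> simp [hX]

/-- If `π` exchanges isomorphism classes with their negatives, then the indices `j` with
`X j ≇ -X j` can be grouped into pairs with `X j ≅ -X (τ j)`. -/
theorem exists_pairing {ι : Type*} (X : ι → RatFun) (π : Equiv.Perm ι)
    (h : ∀ j, Iso (X j) (-X (π j))) :
    ∃ τ : ι → ι, ∀ j, ¬ Iso (X j) (-X j) →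
      τ (τ j) = j ∧ τ j ≠ j ∧ Iso (X j) (-X (τ j)) := by
  have h' : ∀ j, Iso (X j) (-X (π.symm j)) := fun j => by
    have := h (π.symm j)
    rw [π.apply_symm_apply, iso_neg_comm] at this
    exact this.symm
  -- π exchanges the two sides of a class, so moving forward by π from the positive side and
  -- backward from the other is an involution, although π itself may have long cycles.
  refine ⟨fun j => if PosSide (X j) then π j else π.symm j, fun j hj => ?_⟩
  have hne : ∀ {k}, Iso (X j) (-X k) → k ≠ j := by
    rintro k hk rfl
    exact hj hk
  have hside : ∀ {k}, Iso (X j) (-X k) → (PosSide (X k) ↔ ¬ PosSide (X j)) := by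
    intro k hk
    rw [← posSide_neg_iff hj]
    exact (iso_neg_comm.1 hk).symm.posSide_iff
  by_cases hp : PosSide (X j)
  · have := hside (h j)
    simp only [hp, if_true]
    rw [if_neg (by tauto)]
    exact ⟨π.symm_apply_apply j, hne (h j), h j⟩
  · have := hside (h' j)
    simp only [hp, if_false]
    rw [if_pos (by tauto)]
    exact ⟨π.apply_symm_apply j, hne (h' j), h' j⟩

theorem exists_permute_pair {f₁ f₂ g₁ g₂ : RatFun} (hf : Disjoint (vars f₁) (vars f₂))
    (hg : Disjoint (vars g₁) (vars g₂)) (h₁ : Iso f₁ g₁) (h₂ : Iso f₂ g₂) :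
    ∃ σ, permute σ f₁ = g₁ ∧ permute σ f₂ = g₂ := by
  obtain ⟨σ, hσ⟩ := exists_permute_family (ι := Bool) (F := fun b => cond b f₁ f₂)
    (G := fun b => cond b g₁ g₂)
    (by intro a b hab; cases a <;> cases b <;> simp_all [disjoint_comm])
    (by intro a b hab; cases a <;> cases b <;> simp_all [disjoint_comm])
    (by intro a; cases a <;> assumption)
  exact ⟨σ, hσ true, hσ false⟩

/-! ### Negatives of products and quotients -/

theorem ne_neg_self {f : RatFun} (hf : f ≠ 0) : f ≠ -f := by
  intro h
  have : (2 : RatFun) * f = 0 := by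
    rw [two_mul]
    nth_rewrite 2 [h]
    exact add_neg_cancel f
  exact mul_ne_zero two_ne_zero_ratFun hf this

/-- It allows one factor X of a product to be replaced by -X. -/
theorem IsFracOf.isAE_mul_erase {f Y : RatFun} {P N : Finset RatFun} (h : IsFracOf f P N)
    {X : RatFun} (hX : X ∈ P ∪ N) {S : Finset RatFun} (hS : S ⊆ P ∪ N) (hXS : X ∈ S) (hY : IsAE Y)
    (hv : vars Y = vars X) : IsAE (Y * ∏ Z ∈ S.erase X, Z) ∧
      vars (Y * ∏ Z ∈ S.erase X, Z) = vars (∏ Z ∈ S, Z) := by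
  have hsub := (Finset.erase_subset X S).trans hS
  have hd : Disjoint (vars X) (vars (∏ Z ∈ S.erase X, Z)) := by
    simpa using h.disjoint_vars (T := {X}) (by simpa using hX) hsub (by simp)
  constructor
  · rcases (S.erase X).eq_empty_or_nonempty with he | hne
    · rwa [he, Finset.prod_empty, mul_one]
    · exact hY.mul ((h.num hsub).isAE hne) (by rwa [hv])
  · rw [vars_mul hY.ne_zero (h.num hsub).prod_ne_zero.1 (by rwa [hv]), hv,
      ← Finset.mul_prod_erase S (fun Z => Z) hXS,
      vars_mul (h.ne_zero X hX) (h.num hsub).prod_ne_zero.1 hd]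

/-- If no -X is an expression, the sign ambiguity in the factors disappears: f and -f would have the
same factors and be equal. Conversely a single factor can absorb the sign. -/
theorem IsFracOf.isAE_neg_iff {f : RatFun} {P N : Finset RatFun} (h : IsFracOf f P N)
    (hP : P.Nonempty) : IsAE (-f) ↔ ∃ X ∈ P ∪ N, IsAE (-X) := by
  constructor
  · intro hA
    by_contra hno
    push Not at hno
    obtain ⟨P', N', h', -⟩ := hA.exists_isFracOf
    have hm := h.lder_neg_match h' (Or.inr rfl)
    have hm' := h'.lder_neg_match h (Or.inr (neg_neg f).symm)
    have h1 : P ⊆ P' := by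
      intro X hX
      obtain ⟨X', hX', rfl | rfl⟩ := hm.1 X hX
      · exact hX'
      · exact absurd (h'.factor _ (Finset.mem_union_left _ hX')).1
          (hno X (Finset.mem_union_left _ hX))
    have h2 : N ⊆ N' := by
      intro X hX
      obtain ⟨X', hX', rfl | rfl⟩ := hm.2 X hX
      · exact hX'
      · exact absurd (h'.factor _ (Finset.mem_union_right _ hX')).1
          (hno X (Finset.mem_union_right _ hX))
    have h3 : P' ⊆ P := by
      intro X' hX'
      obtain ⟨X, hX, rfl | rfl⟩ := hm'.1 X' hX'
      · exact hX
      · refine absurd ?_ (hno _ (Finset.mem_union_left _ hX))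
        rw [neg_neg]
        exact (h'.factor _ (Finset.mem_union_left _ hX')).1
    have h4 : N' ⊆ N := by
      intro X' hX'
      obtain ⟨X, hX, rfl | rfl⟩ := hm'.2 X' hX'
      · exact hX
      · refine absurd ?_ (hno _ (Finset.mem_union_right _ hX))
        rw [neg_neg]
        exact (h'.factor _ (Finset.mem_union_right _ hX')).1
    apply ne_neg_self (h.isAE hP).ne_zero
    rw [h'.eq, h.eq, Finset.Subset.antisymm h1 h3, Finset.Subset.antisymm h2 h4]
  · rintro ⟨X, hX, hA⟩
    have hPs : P ⊆ P ∪ N := Finset.subset_union_left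
    have hNs : N ⊆ P ∪ N := Finset.subset_union_right
    have hd := h.disjoint_vars hPs hNs h.disjoint
    rcases Finset.mem_union.1 hX with hXP | hXN
    · obtain ⟨h1, h2⟩ := h.isAE_mul_erase hX hPs hXP hA (vars_neg X)
      have hf : -f = (-X * ∏ Z ∈ P.erase X, Z) / ∏ Z ∈ N, Z := by
        rw [h.eq, neg_mul, Finset.mul_prod_erase P (fun Z => Z) hXP, neg_div]
      rw [hf]
      rcases N.eq_empty_or_nonempty with rfl | hN
      · rwa [Finset.prod_empty, div_one]
      · exact h1.div ((h.num hNs).isAE hN) (by rwa [h2])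
    · obtain ⟨h1, h2⟩ := h.isAE_mul_erase hX hNs hXN hA (vars_neg X)
      have hf : -f = (∏ Z ∈ P, Z) / (-X * ∏ Z ∈ N.erase X, Z) := by
        rw [h.eq, neg_mul, Finset.mul_prod_erase N (fun Z => Z) hXN, div_neg]
      rw [hf]
      exact ((h.num hPs).isAE hP).div h1 (by rwa [h2])

theorem Iso.inv {f g : RatFun} (h : Iso f g) : Iso f⁻¹ g⁻¹ := by
  obtain ⟨σ, rfl⟩ := h
  exact ⟨σ, map_inv₀ _ _⟩

/-- A permutation taking X to -X can be chosen to leave the remaining quotient unchanged, the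
variables being disjoint. -/
theorem IsFracOf.iso_neg_of_mem_num {f : RatFun} {P N : Finset RatFun} (h : IsFracOf f P N)
    {X : RatFun} (hX : X ∈ P) (hiso : Iso X (-X)) : Iso f (-f) := by
  have hr : IsFracOf ((∏ Z ∈ P.erase X, Z) / ∏ Z ∈ N, Z) (P.erase X) N := by
    have hsub : P.erase X ∪ N ⊆ P ∪ N :=
      Finset.union_subset_union_left (Finset.erase_subset X P)
    exact ⟨h.disj.subset hsub, h.disjoint.mono_left (Finset.erase_subset X P),
      fun Z hZ => h.factor Z (hsub hZ), rfl⟩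
  have hf : f = X * ((∏ Z ∈ P.erase X, Z) / ∏ Z ∈ N, Z) := by
    rw [h.eq, ← mul_div_assoc, Finset.mul_prod_erase P (fun Z => Z) hX]
  have hd : Disjoint (vars X) (vars ((∏ Z ∈ P.erase X, Z) / ∏ Z ∈ N, Z)) := by
    rw [hr.vars_eq]
    simp only [Set.disjoint_iUnion_right]
    intro Y hY
    rcases Finset.mem_union.1 hY with hY | hY
    · exact h.disj.disjoint (Finset.mem_union_left _ hX)
        (Finset.mem_union_left _ (Finset.mem_of_mem_erase hY)) (Finset.ne_of_mem_erase hY).symm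
    · exact h.disj.disjoint (Finset.mem_union_left _ hX) (Finset.mem_union_right _ hY)
        fun e => Finset.disjoint_left.1 h.disjoint hX (e ▸ hY)
  obtain ⟨σ, h1, h2⟩ := exists_permute_pair hd (by rwa [vars_neg]) hiso (Iso.refl _)
  exact ⟨σ, by rw [hf, map_mul, h1, h2, neg_mul]⟩

/-- Weighted by `sideSign`, a factor no longer changes when X is replaced by -X, so the weighted
products over S and over its image agree. The weights themselves are invariant under σ, hence their
common nonzero product cancels. -/
theorem permute_prod_eq {S : Finset RatFun} {σ : Equiv.Perm ℕ} (hS : DisjVars S)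
    (hS' : DisjVars (S.image (permute σ))) (hn : ∀ X ∈ S, (vars X).Nonempty)
    (hno : ∀ X ∈ S, ¬ Iso X (-X)) (h : ∀ X ∈ S, ∃ X' ∈ S.image (permute σ), X' = X ∨ X' = -X)
    (h' : ∀ X' ∈ S.image (permute σ), ∃ X ∈ S, X = X' ∨ X = -X') :
    permute σ (∏ X ∈ S, X) = ∏ X ∈ S, X := by
  have hn' : ∀ X ∈ S.image (permute σ), (vars X).Nonempty := by
    intro X hX
    obtain ⟨Y, hY, rfl⟩ := Finset.mem_image.1 hX
    rw [vars_permute]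
    exact (hn Y hY).image _
  have himg := image_signIn hS' hn' h fun X' hX' => by
    obtain ⟨X, hX, rfl | rfl⟩ := h' X' hX'
    exacts [⟨_, hX, rfl⟩, ⟨_, hX, vars_neg X'⟩]
  have h1 : ∏ X ∈ S.image (permute σ), sideSign X * X = ∏ X ∈ S, sideSign X * X := by
    nth_rewrite 1 [← himg]
    rw [Finset.prod_image (signIn_injOn _ hS hn)]
    refine Finset.prod_congr rfl fun X hX => ?_
    rcases signIn_eq (S.image (permute σ)) X with he | he <;> rw [he]
    exact sideSign_neg_mul (hno X hX)
  have h2 : ∏ X ∈ S.image (permute σ), sideSign X * X =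
      (∏ X ∈ S, sideSign X) * permute σ (∏ X ∈ S, X) := by
    rw [Finset.prod_image (by simp), map_prod, ← Finset.prod_mul_distrib]
    refine Finset.prod_congr rfl fun X _ => ?_
    rw [(Iso.sideSign_eq ⟨σ, rfl⟩ : sideSign X = sideSign (permute σ X))]
  rw [h2, Finset.prod_mul_distrib] at h1
  exact mul_left_cancel₀ (Finset.prod_ne_zero_iff.2 fun X _ => sideSign_ne_zero X) h1

/-- If no factor is isomorphic to its negative, a permutation with f ↦ -f fixes both the numerator
and the denominator, so it fixes f, and f = -f. -/
theorem IsFracOf.iso_neg_iff {f : RatFun} {P N : Finset RatFun} (h : IsFracOf f P N) :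
    Iso f (-f) ↔ ∃ X ∈ P ∪ N, Iso X (-X) := by
  constructor
  · rintro ⟨σ, hσ⟩
    by_contra hno
    push Not at hno
    have h' := h.permute σ
    rw [hσ] at h'
    have hm := h.lder_neg_match h' (Or.inr rfl)
    have hm' := h'.lder_neg_match h (Or.inr (neg_neg f).symm)
    have hn : ∀ X ∈ P ∪ N, (vars X).Nonempty := fun X hX => (h.factor X hX).1.vars_nonempty
    have h1 := permute_prod_eq (h.disj.subset Finset.subset_union_left)
      (h'.disj.subset Finset.subset_union_left) (fun X hX => hn X (Finset.mem_union_left _ hX))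
      (fun X hX => hno X (Finset.mem_union_left _ hX)) hm.1 hm'.1
    have h2 := permute_prod_eq (h.disj.subset Finset.subset_union_right)
      (h'.disj.subset Finset.subset_union_right) (fun X hX => hn X (Finset.mem_union_right _ hX))
      (fun X hX => hno X (Finset.mem_union_right _ hX)) hm.2 hm'.2
    have h3 : f ≠ 0 := by
      rw [h.eq]
      exact div_ne_zero h.prod_ne_zero.1 h.prod_ne_zero.2
    apply ne_neg_self h3
    rw [← hσ, h.eq, map_div₀, h1, h2]
  · rintro ⟨X, hX, hiso⟩
    rcases Finset.mem_union.1 hX with hX | hX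
    · exact h.iso_neg_of_mem_num hX hiso
    · have := (h.inv.iso_neg_of_mem_num hX hiso).inv
      rwa [inv_inv, ← inv_neg, inv_inv] at this

theorem isAE_neg_div_iff {g h : RatFun} (hg : IsAE g) (hh : IsAE h) (hgn : AllNum g)
    (hhn : AllNum h) (hd : Disjoint (vars g) (vars h)) :
    IsAE (-(g / h)) ↔ IsAE (-g) ∨ IsAE (-h) := by
  obtain ⟨P, hP⟩ := hgn
  obtain ⟨N, hN⟩ := hhn
  have hPne := hP.nonempty hg.vars_nonempty
  have hf := hP.div hN hd
  rw [hf.isAE_neg_iff (hPne.mono Finset.subset_union_left), hP.isAE_neg_iff hPne,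
    hN.isAE_neg_iff (hN.nonempty hh.vars_nonempty)]
  simp [or_and_right, exists_or]

theorem iso_neg_div_iff {g h : RatFun} (hgn : AllNum g)
    (hhn : AllNum h) (hd : Disjoint (vars g) (vars h)) :
    Iso (g / h) (-(g / h)) ↔ Iso g (-g) ∨ Iso h (-h) := by
  obtain ⟨P, hP⟩ := hgn
  obtain ⟨N, hN⟩ := hhn
  rw [(hP.div hN hd).iso_neg_iff, hP.iso_neg_iff, hN.iso_neg_iff]
  simp [or_and_right, exists_or]

/-- The types of `±A` in terms of `A`. -/
theorem types_of_sign {A f ε : RatFun} (hA : IsAE A) (hf : IsAE f) (hε : ε = 1 ∨ ε = -1)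
    (he : f = ε * A) :
    (IsFirstType f ↔ ε = 1 ∧ ¬ IsAE (-A)) ∧ (IsSecondType f ↔ IsAE (-A) ∧ ¬ Iso A (-A)) ∧
      (IsThirdType f ↔ Iso A (-A)) := by
  rw [isThirdType_iff, IsFirstType, IsSecondType]
  rcases hε with rfl | rfl
  · rw [one_mul] at he
    subst he
    simp [hA]
  · rw [neg_one_mul] at he
    subst he
    have h1 : (-1 : RatFun) ≠ 1 := fun h => ne_neg_self one_ne_zero h.symm
    have h2 : Iso (-A) A ↔ Iso A (-A) := ⟨Iso.symm, Iso.symm⟩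
    simp [hA, hf, h1, h2]

/-! ### Differences -/

theorem isDiffForm_iff {f g h : RatFun} : IsDiffForm f g h ↔
    f = g - h ∧ Disjoint (vars g) (vars h) ∧ IsAE g ∧ AllPos g ∧ AllPos h ∧ IsFirstType h := by
  rw [IsDiffForm, mem_AEop_pos_iff, mem_AEop_pos_iff]
  constructor
  · rintro ⟨h1, h2, h3, h4, h5⟩
    exact ⟨h1, h2.1, h3.1, h3.2, h4.2, h5⟩
  · rintro ⟨rfl, h2, h3, h4, h5, h6⟩
    exact ⟨rfl, ⟨h2, (vars_sub h2).symm⟩, ⟨h3, h4⟩, ⟨h6.1, h5⟩, h6⟩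

theorem exists_isDiffForm {f : RatFun} (hf : Cls .minus f) : ∃ g h, IsDiffForm f g h := by
  obtain ⟨g, h, hg, hh, hd, hc⟩ := hf.isAE.exists_split (by
    rintro ⟨i, rfl⟩
    exact not_addDec_atom i (hf.addDec (Or.inr rfl)))
  rcases hc with ⟨rfl, h1, h2⟩ | ⟨rfl, h1, h2, h3⟩ | ⟨rfl, h1, h2⟩ | ⟨rfl, h1, h2⟩
  · exact absurd (hf.unique (Cls.plus_of hg hh h1 h2 hd)) (by simp)
  · exact ⟨g, h, isDiffForm_iff.2 ⟨rfl, hd, hg, h1, h2, h3⟩⟩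
  · exact absurd (hf.unique (Cls.times_of hg hh h1 h2 hd)) (by simp)
  · exact absurd (hf.unique (Cls.divide_of hg hh h1 h2 hd)) (by simp)

theorem IsDiffForm.exists_sums {f g h : RatFun} (hf : IsDiffForm f g h) :
    ∃ S T, IsSumOf g S ∧ IsSumOf h T ∧ (∀ X ∈ S, IsAE X) ∧ (∀ X ∈ T, IsAE X) ∧
      (∀ X ∈ T, ¬ IsAE (-X)) ∧ IsSumOf f (S ∪ T.image fun X => -X) := by
  obtain ⟨rfl, hd, hg, ⟨S, hS, hSA⟩, ⟨T, hT, hTA⟩, hfi⟩ := isDiffForm_iff.1 hf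
  refine ⟨S, T, hS, hT, hSA, hTA, (hT.isFirstType_iff hfi.1).1 hfi, ?_⟩
  rw [sub_eq_add_neg]
  exact hS.add hT.neg (by rwa [vars_neg])

/-- Among the unique summands of f, those of g are the ones that are expressions, and the negatives
of those of h are the ones that are not. -/
theorem IsDiffForm.unique {f g h g' h' : RatFun} (hf : IsDiffForm f g h)
    (hf' : IsDiffForm f g' h') : g' = g ∧ h' = h := by
  obtain ⟨S, T, hS, hT, hSA, -, hTn, hu⟩ := hf.exists_sums
  obtain ⟨S', T', hS', hT', hSA', -, hTn', hu'⟩ := hf'.exists_sums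
  have he := hu.unique hu'
  have key : ∀ {S T S' T' : Finset RatFun}, (∀ X ∈ S, IsAE X) → (∀ X ∈ T, ¬ IsAE (-X)) →
      (∀ X ∈ S', IsAE X) → (∀ X ∈ T', ¬ IsAE (-X)) →
      (S ∪ T.image fun X => -X) = (S' ∪ T'.image fun X => -X) → S ⊆ S' ∧ T ⊆ T' := by
    intro S T S' T' hSA hTn hSA' hTn' he
    constructor
    · intro X hX
      have h1 : X ∈ S' ∪ T'.image fun X => -X := he ▸ Finset.mem_union_left _ hX
      refine (Finset.mem_union.1 h1).resolve_right fun h2 => ?_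
      obtain ⟨Y, hY, rfl⟩ := Finset.mem_image.1 h2
      exact hTn' Y hY (hSA _ hX)
    · intro X hX
      have h1 : -X ∈ S' ∪ T'.image fun X => -X :=
        he ▸ Finset.mem_union_right _ (Finset.mem_image_of_mem _ hX)
      rcases Finset.mem_union.1 h1 with h2 | h2
      · exact absurd (hSA' _ h2) (hTn X hX)
      · obtain ⟨Y, hY, hYX⟩ := Finset.mem_image.1 h2
        rwa [← neg_inj.1 hYX]
  obtain ⟨h1, h2⟩ := key hSA hTn hSA' hTn' he
  obtain ⟨h3, h4⟩ := key hSA' hTn' hSA hTn he.symm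
  rw [hS.eq, hS'.eq, hT.eq, hT'.eq, Finset.Subset.antisymm h1 h3, Finset.Subset.antisymm h2 h4]
  exact ⟨rfl, rfl⟩

theorem IsDiffForm.isThirdType_iff {f g h : RatFun} (hf : IsDiffForm f g h) :
    IsThirdType f ↔ Iso g h ∨ ∃ G : RatFun, G ∈ AEop .plus ∪ AEop .times ∪ AEop .divide ∧
      IsThirdType G ∧ vars G ∩ vars h = ∅ ∧ Iso g (G + h) := by
  obtain ⟨hfgh, hd, hg, -, -, hfi⟩ := isDiffForm_iff.1 hf
  have hfA : IsAE f := hfgh ▸ hg.sub hfi.1 hd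
  rw [ArithExpr.isThirdType_iff, and_iff_right hfA]
  constructor
  · rintro ⟨σ, hσ⟩
    obtain ⟨S, T, hS, hT, hSA, hTA, hTn, hu⟩ := hf.exists_sums
    have himg := (hu.permute σ).unique (hσ ▸ hu.neg)
    set S₂ := S.filter fun X => IsAE (-X) with hS₂
    have hS₂S : S₂ ⊆ S := Finset.filter_subset _ _
    have hperm : ∀ X, IsAE (-permute σ X) ↔ IsAE (-X) := fun X => by
      rw [← map_neg, isAE_permute_iff]
    have mem1 : ∀ Y, Y ∈ (S ∪ T.image fun X => -X).image (permute σ) ↔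
        (∃ X ∈ S, permute σ X = Y) ∨ ∃ X ∈ T, -permute σ X = Y := by
      intro Y
      simp [or_and_right, exists_or]
    have mem2 : ∀ Y, Y ∈ (S ∪ T.image fun X => -X).image (fun X => -X) ↔
        (∃ X ∈ S, -X = Y) ∨ Y ∈ T := by
      intro Y
      simp [or_and_right, exists_or]
    -- The summands of permute σ f that are expressions form σ(S). Those of -f are T together with
    -- the negatives of S₂, the summands of g whose negatives are expressions.
    have hSσ : S.image (permute σ) = T ∪ S₂.image fun X => -X := by
      ext Y
      rw [Finset.mem_union, Finset.mem_image, Finset.mem_image]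
      constructor
      · rintro ⟨X, hX, rfl⟩
        have h1 : permute σ X ∈ (S ∪ T.image fun X => -X).image (permute σ) :=
          (mem1 _).2 (Or.inl ⟨X, hX, rfl⟩)
        rw [himg, mem2] at h1
        rcases h1 with ⟨Z, hZ, he⟩ | h1
        · refine Or.inr ⟨Z, Finset.mem_filter.2 ⟨hZ, ?_⟩, he⟩
          rw [he]
          exact (hSA X hX).permute σ
        · exact Or.inl h1
      · intro hY
        have hYA : IsAE Y := by
          rcases hY with h1 | ⟨Z, hZ, rfl⟩
          exacts [hTA Y h1, (Finset.mem_filter.1 hZ).2]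
        have h1 : Y ∈ (S ∪ T.image fun X => -X).image (fun X => -X) := by
          rw [mem2]
          rcases hY with h1 | ⟨Z, hZ, rfl⟩
          exacts [Or.inr h1, Or.inl ⟨Z, hS₂S hZ, rfl⟩]
        rw [← himg, mem1] at h1
        refine h1.resolve_right ?_
        rintro ⟨X, hX, rfl⟩
        exact hTn X hX ((hperm X).1 hYA)
    -- For X in S₂ the negative of its image is an expression, so the image is not in T. This gives
    -- one inclusion, and the cardinalities agree. The sum over S₂ is therefore taken to its
    -- negative and supplies the G of third type.
    have hS₂σ : S₂.image (permute σ) = S₂.image fun X => -X := by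
      apply Finset.eq_of_subset_of_card_le
      · rw [Finset.image_subset_iff]
        intro X hX
        have h1 : permute σ X ∈ T ∪ S₂.image fun X => -X :=
          hSσ ▸ Finset.mem_image_of_mem _ (hS₂S hX)
        refine (Finset.mem_union.1 h1).resolve_left fun h2 => ?_
        exact hTn _ h2 ((hperm X).2 (Finset.mem_filter.1 hX).2)
      · rw [Finset.card_image_of_injective _ (permute σ).injective,
          Finset.card_image_of_injective _ neg_injective]
    have hsum := hS.subset hS₂S
    have hv₂ : Disjoint (vars (∑ X ∈ S₂, X)) (vars h) := by
      refine hd.mono_left ?_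
      rw [hsum.vars_eq, hS.vars_eq]
      exact Set.biUnion_subset_biUnion_left hS₂S
    have hgσ : permute σ g = -(∑ X ∈ S₂, X) + h := by
      rw [(hS.permute σ).eq, hSσ, Finset.sum_union
        (hT.disjoint hsum.neg (by rw [vars_neg]; exact hv₂.symm)), ← hT.eq, ← hsum.neg.eq, add_comm]
    rcases S₂.eq_empty_or_nonempty with he | ⟨X, hX⟩
    · left
      rw [he, Finset.sum_empty, neg_zero, zero_add] at hgσ
      exact ⟨σ, hgσ⟩
    · right
      have hGA : IsAE (-∑ X ∈ S₂, X) :=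
        hsum.neg.isAE (Finset.mem_image_of_mem _ hX) (Finset.mem_filter.1 hX).2
      refine ⟨-∑ X ∈ S₂, X, mem_AEop_pos_iff.2 ⟨hGA, _, hsum.neg, fun Y hY => ?_⟩,
        ArithExpr.isThirdType_iff.2 ⟨hGA, Iso.neg ⟨σ, ?_⟩⟩, ?_, ⟨σ, hgσ⟩⟩
      · obtain ⟨Z, hZ, rfl⟩ := Finset.mem_image.1 hY
        exact (Finset.mem_filter.1 hZ).2
      · rw [(hsum.permute σ).eq, hS₂σ, ← hsum.neg.eq]
      · rw [vars_neg]
        exact Set.disjoint_iff_inter_eq_empty.1 hv₂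
  · rintro (hiso | ⟨G, -, hG3, hGd, σ, hσ⟩)
    · obtain ⟨σ, h1, h2⟩ := exists_permute_pair hd hd.symm hiso hiso.symm
      exact ⟨σ, by rw [hfgh, map_sub, h1, h2, neg_sub]⟩
    · have hGd' : Disjoint (vars G) (vars h) := Set.disjoint_iff_inter_eq_empty.2 hGd
      -- Pulling back gives f = G₁ + (h₁ - h). Negating f amounts to negating G₁, which is of the
      -- third type, and exchanging the isomorphic h₁ and h.
      set G₁ := permute σ⁻¹ G with hG₁
      set h₁ := permute σ⁻¹ h with hh₁
      have hg₁ : g = G₁ + h₁ := by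
        rw [hG₁, hh₁, ← map_add, ← hσ, permute_inv_permute]
      have hd₁ : Disjoint (vars G₁) (vars h₁) := disjoint_vars_permute _ hGd'
      rw [hg₁, vars_add hd₁, Set.disjoint_union_left] at hd
      have hiso1 : Iso h₁ h := ⟨σ, by rw [hh₁, permute_permute_inv]⟩
      obtain ⟨τ, h1, h2⟩ := exists_permute_pair hd.2 hd.2.symm hiso1 hiso1.symm
      have hiso2 : Iso (h₁ - h) (h - h₁) := ⟨τ, by rw [map_sub, h1, h2]⟩
      have hiso3 : Iso G₁ (-G₁) := by
        have h3 : Iso G G₁ := ⟨σ⁻¹, rfl⟩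
        exact (h3.symm.trans hG3.2.2).trans h3.neg
      obtain ⟨ρ, h4, h5⟩ := exists_permute_pair (f₁ := G₁) (f₂ := h₁ - h) (g₁ := -G₁)
        (g₂ := h - h₁) (by rw [vars_sub hd.2]; exact Set.disjoint_union_right.2 ⟨hd₁, hd.1⟩)
        (by
          rw [vars_neg, vars_sub hd.2.symm]
          exact Set.disjoint_union_right.2 ⟨hd.1, hd₁⟩) hiso3 hiso2
      refine ⟨ρ, ?_⟩
      rw [hfgh, hg₁, add_sub_assoc, map_add, h4, h5]
      ring

/-! ### Families indexed by `Fin n` -/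

theorem injective_of_disjoint {n : ℕ} {F : Fin n → RatFun}
    (hd : Pairwise fun i j => Disjoint (vars (F i)) (vars (F j)))
    (hn : ∀ j, (vars (F j)).Nonempty) : Function.Injective F := by
  intro i j hij
  by_contra hne
  obtain ⟨k, hk⟩ := hn i
  exact Set.disjoint_left.1 (hd hne) hk (hij ▸ hk)

theorem disjVars_image_univ {n : ℕ} {F : Fin n → RatFun}
    (hd : Pairwise fun i j => Disjoint (vars (F i)) (vars (F j))) :
    DisjVars (Finset.univ.image F) := by
  intro X hX Y hY hne
  obtain ⟨i, -, rfl⟩ := Finset.mem_image.1 hX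
  obtain ⟨j, -, rfl⟩ := Finset.mem_image.1 hY
  exact hd fun e => hne (by rw [e])

theorem exists_equiv_of_image_eq {n m : ℕ} {F : Fin n → RatFun} {F' : Fin m → RatFun}
    (hF : Function.Injective F) (hF' : Function.Injective F')
    (h : Finset.univ.image F = Finset.univ.image F') :
    ∃ e : Fin m ≃ Fin n, ∀ j, F' j = F (e j) := by
  have h1 : ∀ j, ∃ i, F i = F' j := fun j => by
    have : F' j ∈ Finset.univ.image F := h ▸ Finset.mem_image_of_mem _ (Finset.mem_univ j)
    simpa using this
  have h2 : ∀ i, ∃ j, F' j = F i := fun i => by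
    have : F i ∈ Finset.univ.image F' := h ▸ Finset.mem_image_of_mem _ (Finset.mem_univ i)
    simpa using this
  choose e he using h1
  refine ⟨Equiv.ofBijective e ⟨fun a b hab => hF' (by rw [← he, ← he, hab]), fun i => ?_⟩,
    fun j => (he j).symm⟩
  obtain ⟨j, hj⟩ := h2 i
  exact ⟨j, hF (by rw [he, hj])⟩

theorem exists_enumeration (S : Finset RatFun) :
    ∃ F : Fin S.card → RatFun, Function.Injective F ∧ Finset.univ.image F = S := by
  refine ⟨fun j => S.equivFin.symm j, Subtype.val_injective.comp S.equivFin.symm.injective, ?_⟩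
  ext X
  simp only [Finset.mem_image, Finset.mem_univ, true_and]
  constructor
  · rintro ⟨j, rfl⟩
    exact (S.equivFin.symm j).2
  · exact fun hX => ⟨S.equivFin ⟨X, hX⟩, by simp⟩

theorem isVarPartition_of_image {n : ℕ} {F : Fin n → RatFun} {S : Finset RatFun} {V : Set ℕ}
    (hF : Function.Injective F) (hFS : Finset.univ.image F = S) (hS : DisjVars S)
    (hV : V = ⋃ X ∈ S, vars X) : IsVarPartition F V := by
  subst hFS hV
  refine ⟨fun i j hij => ?_, ?_⟩
  · exact hS.disjoint (Finset.mem_image_of_mem _ (Finset.mem_univ _))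
      (Finset.mem_image_of_mem _ (Finset.mem_univ _)) (hF.ne hij)
  · ext x
    simp

/-! ### Sums -/

theorem IsSumForm.isAE {f : RatFun} {n : ℕ} {F : Fin n → RatFun} (h : IsSumForm f n F) (j : Fin n) :
    IsAE (F j) := (mem_AEop_mul_iff.1 (h.2.2.2 j)).1

theorem IsSumForm.injective {f : RatFun} {n : ℕ} {F : Fin n → RatFun} (h : IsSumForm f n F) :
    Function.Injective F :=
  injective_of_disjoint h.2.2.1.1 fun j => (h.isAE j).vars_nonempty

theorem IsSumForm.isSumOf {f : RatFun} {n : ℕ} {F : Fin n → RatFun} (h : IsSumForm f n F) :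
    IsSumOf f (Finset.univ.image F) := by
  refine ⟨disjVars_image_univ h.2.2.1.1, fun X hX => ?_, ?_⟩
  · obtain ⟨j, -, rfl⟩ := Finset.mem_image.1 hX
    exact ⟨Or.inl (h.isAE j), (mem_AEop_mul_iff.1 (h.2.2.2 j)).2⟩
  · rw [Finset.sum_image h.injective.injOn, ← h.2.1]

theorem exists_isSumForm {f : RatFun} (hf : Cls .plus f) :
    ∃ (n : ℕ) (F : Fin n → RatFun), IsSumForm f n F := by
  obtain ⟨S, hS, hSA, hc⟩ := hf
  obtain ⟨F, hF, hFS⟩ := exists_enumeration S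
  have hmem : ∀ j, F j ∈ S := fun j => by
    rw [← hFS]
    exact Finset.mem_image_of_mem _ (Finset.mem_univ j)
  refine ⟨S.card, F, hc, ?_, isVarPartition_of_image hF hFS hS.disj hS.vars_eq,
    fun j => mem_AEop_mul_iff.2 ⟨hSA _ (hmem j), (hS.summand _ (hmem j)).2⟩⟩
  rw [hS.eq]
  conv_lhs => rw [← hFS]
  rw [Finset.sum_image hF.injOn]

theorem IsSumForm.isFirstType_iff {f : RatFun} {n : ℕ} {F : Fin n → RatFun}
    (h : IsSumForm f n F) (hf : IsAE f) : IsFirstType f ↔ ∀ j, IsFirstType (F j) := by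
  rw [h.isSumOf.isFirstType_iff hf]
  simp [IsFirstType, h.isAE]

theorem IsSumForm.second_or_third {f : RatFun} {n : ℕ} {F : Fin n → RatFun}
    (h : IsSumForm f n F) (j : Fin n) :
    IsSecondType (F j) ∨ IsThirdType (F j) ↔ IsAE (-F j) := by
  have := h.isAE j
  unfold IsSecondType IsThirdType
  tauto

theorem IsSumForm.isThirdType_iff {f : RatFun} {n : ℕ} {F : Fin n → RatFun}
    (h : IsSumForm f n F) (hf : IsAE f) : IsThirdType f ↔
      (∀ j, IsSecondType (F j) ∨ IsThirdType (F j)) ∧ SecondTypesPair F := by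
  rw [ArithExpr.isThirdType_iff, and_iff_right hf]
  simp only [h.second_or_third]
  constructor
  · rintro ⟨σ, hσ⟩
    have himg := (h.isSumOf.permute σ).unique (hσ ▸ h.isSumOf.neg)
    have hex : ∀ j, ∃ k, permute σ (F j) = -F k := fun j => by
      have : permute σ (F j) ∈ (Finset.univ.image F).image (permute σ) :=
        Finset.mem_image_of_mem _ (Finset.mem_image_of_mem _ (Finset.mem_univ j))
      rw [himg] at this
      simpa [eq_comm] using this
    choose π hπ using hex
    have hinj : Function.Injective π := fun a b hab =>
      h.injective ((permute σ).injective (by rw [hπ, hπ, hab]))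
    -- Uniqueness of summands makes σ act on the indices by a permutation with F j ↦ -F (ρ j), from
    -- which `exists_pairing` extracts the pairs.
    set ρ : Equiv.Perm (Fin n) := Equiv.ofBijective π (Finite.injective_iff_bijective.1 hinj)
    have hρ : ∀ j, permute σ (F j) = -F (ρ j) := hπ
    have hneg : ∀ j, IsAE (-F j) := fun j => by
      rw [← ρ.apply_symm_apply j, ← hρ]
      exact (h.isAE _).permute σ
    refine ⟨hneg, ?_⟩
    obtain ⟨τ, hτ⟩ := exists_pairing F ρ fun j => ⟨σ, hρ j⟩
    refine ⟨τ, fun j hj => ?_⟩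
    obtain ⟨h1, h2, h3⟩ := hτ j hj.2.2
    refine ⟨⟨h.isAE _, hneg _, fun h4 => hj.2.2 ?_⟩, h1, h2, h3⟩
    exact (h3.trans h4.symm).trans (iso_neg_comm.1 h3).symm
  · rintro ⟨hneg, τ, hτ⟩
    -- τ is arbitrary outside the second type, so ρ is the identity there: those summands are of the
    -- third type and are isomorphic to their own negatives.
    set ρ : Fin n → Fin n := fun j => if IsSecondType (F j) then τ j else j with hρ
    have hinv : Function.Involutive ρ := by
      intro j
      by_cases hj : IsSecondType (F j)
      · simp only [hρ, if_pos hj, if_pos (hτ j hj).1, (hτ j hj).2.1]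
      · simp only [hρ, if_neg hj]
    have hiso : ∀ j, Iso (F j) (-F (ρ j)) := by
      intro j
      by_cases hj : IsSecondType (F j)
      · simp only [hρ, if_pos hj]
        exact (hτ j hj).2.2.2
      · simp only [hρ, if_neg hj]
        by_contra hni
        exact hj ⟨h.isAE j, hneg j, hni⟩
    obtain ⟨σ, hσ⟩ := exists_permute_family h.2.2.1.1 (G := fun j => -F (ρ j)) (by
      intro i j hij
      simp only [vars_neg]
      exact h.2.2.1.1 (hinv.injective.ne hij)) hiso
    refine ⟨σ, ?_⟩
    rw [h.2.1, map_sum]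
    simp only [hσ]
    rw [Finset.sum_neg_distrib, hinv.bijective.sum_comp F]

/-! ### Products -/

theorem IsProdForm.isFactor {f ε : RatFun} {n : ℕ} {F : Fin n → RatFun}
    (h : IsProdForm f ε n F) (j : Fin n) : IsFactor (F j) :=
  isFactor_iff.2 (h.2.2.2.2 j).2

theorem IsProdForm.injective {f ε : RatFun} {n : ℕ} {F : Fin n → RatFun}
    (h : IsProdForm f ε n F) : Function.Injective F :=
  injective_of_disjoint h.2.2.2.1.1 fun j => (h.isFactor j).1.vars_nonempty

theorem IsProdForm.isFracOf {f ε : RatFun} {n : ℕ} {F : Fin n → RatFun}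
    (h : IsProdForm f ε n F) : IsFracOf (∏ j, F j) (Finset.univ.image F) ∅ := by
  refine ⟨?_, by simp, fun X hX => ?_, ?_⟩
  · rw [Finset.union_empty]
    exact disjVars_image_univ h.2.2.2.1.1
  · rw [Finset.union_empty] at hX
    obtain ⟨j, -, rfl⟩ := Finset.mem_image.1 hX
    exact h.isFactor j
  · rw [Finset.prod_image h.injective.injOn, Finset.prod_empty, div_one]

theorem IsFactor.monicPart {X : RatFun} (hX : IsFactor X) : IsFactor (monicPart X) := by
  refine ⟨hX.1.isAE_monicPart, ?_⟩
  rcases monicPart_eq X with h | h <;> rw [h]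
  exacts [hX.2, by rw [mulDec_neg_iff]; exact hX.2]

theorem vars_monicPart (X : RatFun) : vars (monicPart X) = vars X := by
  rcases monicPart_eq X with h | h <;> rw [h]
  exact vars_neg X

theorem eq_sign_mul {f g : RatFun} (h : g = f ∨ g = -f) :
    ∃ ε : RatFun, (ε = 1 ∨ ε = -1) ∧ f = ε * g := by
  rcases h with rfl | rfl
  · exact ⟨1, Or.inl rfl, (one_mul _).symm⟩
  · exact ⟨-1, Or.inr rfl, by ring⟩

/-- Each factor is replaced by its monic part, which is again a factor, and the accumulated sign
becomes ε. -/
theorem exists_isProdForm {f : RatFun} (hf : Cls .times f) :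
    ∃ (ε : RatFun) (n : ℕ) (F : Fin n → RatFun), IsProdForm f ε n F := by
  obtain ⟨hA, -, P, hP⟩ := hf
  have hdP : DisjVars P := hP.disj.subset Finset.subset_union_left
  have hfac : ∀ X ∈ P, IsFactor X := fun X hX => hP.factor X (Finset.mem_union_left _ hX)
  have hinj : Set.InjOn monicPart (P : Set RatFun) := fun X hX Y hY hXY =>
    hdP.eq_of_vars hX hY (hfac X hX).1.vars_nonempty
      (by rw [← vars_monicPart, hXY, vars_monicPart])
  obtain ⟨F, hF, hFS⟩ := exists_enumeration (P.image monicPart)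
  have hmem : ∀ j, ∃ X ∈ P, monicPart X = F j := fun j => by
    have : F j ∈ P.image monicPart := by
      rw [← hFS]
      exact Finset.mem_image_of_mem _ (Finset.mem_univ j)
    simpa using this
  have hprod : ∏ j, F j = f ∨ ∏ j, F j = -f := by
    have h1 : ∏ j, F j = ∏ X ∈ P, monicPart X := by
      rw [← Finset.prod_image (f := fun X => X) hinj]
      conv_rhs => rw [← hFS]
      rw [Finset.prod_image hF.injOn]
    rw [h1, hP.eq, Finset.prod_empty, div_one]
    exact prod_eq_or_eq_neg fun X _ => monicPart_eq X
  obtain ⟨ε, hε, hfε⟩ := eq_sign_mul hprod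
  have hdisj : DisjVars (P.image monicPart) := by
    intro X hX Y hY hne
    obtain ⟨X, hXP, rfl⟩ := Finset.mem_image.1 hX
    obtain ⟨Y, hYP, rfl⟩ := Finset.mem_image.1 hY
    simp only [Function.onFun, vars_monicPart]
    exact hdP.disjoint hXP hYP fun e => hne (by rw [e])
  refine ⟨ε, _, F, ?_, hε, hfε, isVarPartition_of_image hF hFS hdisj ?_, fun j => ?_⟩
  · exact Finset.card_pos.2 ((hP.nonempty hA.vars_nonempty).image _)
  · rw [hP.vars_eq, Finset.union_empty]
    simp [vars_monicPart]
  · obtain ⟨X, hX, he⟩ := hmem j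
    rw [← he]
    exact ⟨(hfac X hX).1.isMonic_monicPart, isFactor_iff.1 (hfac X hX).monicPart⟩

theorem eq_or_eq_neg_of_signs {a b ε ε' : RatFun} (hε : ε = 1 ∨ ε = -1) (hε' : ε' = 1 ∨ ε' = -1)
    (h : ε * a = ε' * b) : b = a ∨ b = -a := by
  rcases hε with rfl | rfl <;> rcases hε' with rfl | rfl
  · left; linear_combination -h
  · right; linear_combination h
  · right; linear_combination -h
  · left; linear_combination h

/-- Factors are determined up to sign, and monicity leaves one choice for each; equality of the
products then forces ε' = ε. -/
theorem IsProdForm.unique {f ε ε' : RatFun} {n m : ℕ} {F : Fin n → RatFun} {F' : Fin m → RatFun}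
    (h : IsProdForm f ε n F) (h' : IsProdForm f ε' m F') :
    ε' = ε ∧ ∃ e : Fin m ≃ Fin n, ∀ j, F' j = F (e j) := by
  have hs : ∏ j, F' j = ∏ j, F j ∨ ∏ j, F' j = -∏ j, F j :=
    eq_or_eq_neg_of_signs h.2.1 h'.2.1 (h.2.2.1.symm.trans h'.2.2.1)
  have key : ∀ {f ε ε' : RatFun} {n m : ℕ} {F : Fin n → RatFun} {F' : Fin m → RatFun},
      IsProdForm f ε n F → IsProdForm f ε' m F' →
      (∏ j, F' j = ∏ j, F j ∨ ∏ j, F' j = -∏ j, F j) →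
      Finset.univ.image F ⊆ Finset.univ.image F' := by
    intro f ε ε' n m F F' h h' hs X hX
    obtain ⟨X', hX', he⟩ := (h.isFracOf.lder_neg_match h'.isFracOf hs).1 X hX
    obtain ⟨i, -, rfl⟩ := Finset.mem_image.1 hX
    obtain ⟨j, -, rfl⟩ := Finset.mem_image.1 hX'
    rwa [(h.2.2.2.2 i).1.eq_of_eq_or_neg (h'.2.2.2.2 j).1 he] at hX'
  have himg : Finset.univ.image F = Finset.univ.image F' := by
    apply Finset.Subset.antisymm (key h h' hs)
    apply key h' h
    rcases hs with hs | hs <;> rw [hs]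
    exacts [Or.inl rfl, Or.inr (neg_neg _).symm]
  refine ⟨?_, exists_equiv_of_image_eq h.injective h'.injective himg⟩
  have hp : ∏ j, F' j = ∏ j, F j := by
    rw [h.isFracOf.eq, h'.isFracOf.eq, himg]
  have h1 := h.2.2.1.symm.trans h'.2.2.1
  rw [hp] at h1
  refine (mul_right_cancel₀ ?_ h1).symm
  exact Finset.prod_ne_zero_iff.2 fun j _ => (h.isFactor j).1.ne_zero

theorem IsProdForm.types {f ε : RatFun} {n : ℕ} {F : Fin n → RatFun} (h : IsProdForm f ε n F)
    (hf : IsAE f) :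
    (IsFirstType f ↔ ε = 1 ∧ ∀ j, IsFirstType (F j)) ∧
      (IsSecondType f ↔
        (∃ j, IsSecondType (F j)) ∧ ∀ j, IsFirstType (F j) ∨ IsSecondType (F j)) ∧
      (IsThirdType f ↔ ∃ j, IsThirdType (F j)) := by
  have hne : (Finset.univ.image F).Nonempty :=
    ⟨_, Finset.mem_image_of_mem F (Finset.mem_univ ⟨0, h.1⟩)⟩
  have hA := h.isFracOf.isAE hne
  have hneg : IsAE (-∏ j, F j) ↔ ∃ j, IsAE (-F j) := by
    rw [h.isFracOf.isAE_neg_iff hne]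
    simp
  have hiso : Iso (∏ j, F j) (-∏ j, F j) ↔ ∃ j, Iso (F j) (-F j) := by
    rw [h.isFracOf.iso_neg_iff]
    simp
  obtain ⟨h1, h2, h3⟩ := types_of_sign hA hf h.2.1 h.2.2.1
  have hFA : ∀ j, IsAE (F j) := fun j => (h.isFactor j).1
  rw [h1, h2, h3, hneg, hiso]
  refine ⟨by simp [IsFirstType, hFA], ?_, by simp [isThirdType_iff, hFA]⟩
  simp only [IsFirstType, IsSecondType, hFA, true_and]
  constructor
  · rintro ⟨⟨j, hj⟩, hno⟩
    push Not at hno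
    exact ⟨⟨j, hj, hno j⟩, fun k => by
      by_cases hk : IsAE (-F k)
      exacts [Or.inr ⟨hk, hno k⟩, Or.inl hk]⟩
  · rintro ⟨⟨j, hj, -⟩, hall⟩
    refine ⟨⟨j, hj⟩, ?_⟩
    rintro ⟨k, hk⟩
    rcases hall k with h4 | h4
    exacts [h4 (hk.isAE_iff.1 (hFA k)), h4.2 hk]

/-! ### Quotients -/

theorem isQuotForm_iff {f ε g h : RatFun} : IsQuotForm f ε g h ↔
    (ε = 1 ∨ ε = -1) ∧ f = ε * (g / h) ∧ Disjoint (vars g) (vars h) ∧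
      (IsAE g ∧ AllNum g ∧ IsMonic g) ∧ IsAE h ∧ AllNum h ∧ IsMonic h := by
  rw [IsQuotForm, mem_AEop_num_iff, mem_AEop_num_iff]
  constructor
  · rintro ⟨h1, h2, h3, ⟨h4, h5⟩, h6, h7⟩
    exact ⟨h1, h2, h3.1, ⟨h4.1, h4.2, h5⟩, h6.1, h6.2, h7⟩
  · rintro ⟨h1, rfl, h3, ⟨h4, h5, h6⟩, h7, h8, h9⟩
    refine ⟨h1, rfl, ⟨h3, ?_⟩, ⟨⟨h4, h5⟩, h6⟩, ⟨h7, h8⟩, h9⟩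
    have hv := (vars_div h4.ne_zero h7.ne_zero h3).symm
    rcases h1 with rfl | rfl
    · rwa [one_mul]
    · rwa [neg_one_mul, vars_neg]

/-- A change of sign does not move factors into the denominator. -/
theorem AllNum.monicPart {g : RatFun} (hg : IsAE g) (h : AllNum g) : AllNum (monicPart g) := by
  obtain ⟨o, ho⟩ := hg.isAE_monicPart.exists_cls
  rw [ho.allNum_iff]
  rintro rfl
  exact h.not_divide (monicPart_eq g) ho

theorem exists_isQuotForm {f : RatFun} (hf : Cls .divide f) : ∃ ε g h, IsQuotForm f ε g h := by
  obtain ⟨P, N, hPN, hP, hN⟩ := hf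
  have hg := hPN.num (P' := P) Finset.subset_union_left
  have hh := hPN.num (P' := N) Finset.subset_union_right
  have hd := hPN.disjoint_vars Finset.subset_union_left Finset.subset_union_right hPN.disjoint
  have heq := hPN.eq
  have hgA := hg.isAE hP
  have hhA := hh.isAE hN
  have hgn : AllNum (∏ X ∈ P, X) := ⟨P, hg⟩
  have hhn : AllNum (∏ X ∈ N, X) := ⟨N, hh⟩
  generalize ∏ X ∈ P, X = g at *
  generalize ∏ X ∈ N, X = h at *
  have hs : monicPart g / monicPart h = f ∨ monicPart g / monicPart h = -f := by
    rw [heq]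
    rcases monicPart_eq g with h1 | h1 <;> rcases monicPart_eq h with h2 | h2 <;> rw [h1, h2]
    · exact Or.inl rfl
    · exact Or.inr (div_neg _)
    · exact Or.inr (neg_div _ _)
    · exact Or.inl (neg_div_neg_eq _ _)
  obtain ⟨ε, hε, hfε⟩ := eq_sign_mul hs
  exact ⟨ε, _, _, isQuotForm_iff.2 ⟨hε, hfε, by rwa [vars_monicPart, vars_monicPart],
    ⟨hgA.isAE_monicPart, hgn.monicPart hgA, hgA.isMonic_monicPart⟩,
    hhA.isAE_monicPart, hhn.monicPart hhA, hhA.isMonic_monicPart⟩⟩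

theorem IsFracOf.prod_eq_or_neg {P P' : Finset RatFun} {g g' : RatFun} (h : IsFracOf g P ∅)
    (h' : IsFracOf g' P' ∅) (hm : ∀ X ∈ P, ∃ X' ∈ P', X' = X ∨ X' = -X)
    (hm' : ∀ X' ∈ P', ∃ X ∈ P, X = X' ∨ X = -X') : g' = g ∨ g' = -g := by
  rw [h.eq, h'.eq, Finset.prod_empty, div_one, div_one]
  refine prod_eq_or_eq_neg_of_match (h.disj.subset Finset.subset_union_left)
    (h'.disj.subset Finset.subset_union_left)
    (fun X hX => (h.factor X (Finset.mem_union_left _ hX)).1.vars_nonempty)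
    (fun X hX => (h'.factor X (Finset.mem_union_left _ hX)).1.vars_nonempty) hm fun X' hX' => ?_
  obtain ⟨X, hX, rfl | rfl⟩ := hm' X' hX'
  exacts [⟨_, hX, rfl⟩, ⟨_, hX, vars_neg X'⟩]

/-- Numerator factors match numerator factors up to sign, so g' = ±g and h' = ±h; monicity decides
both signs. -/
theorem IsQuotForm.unique {f ε g h ε' g' h' : RatFun} (hf : IsQuotForm f ε g h)
    (hf' : IsQuotForm f ε' g' h') : ε' = ε ∧ g' = g ∧ h' = h := by
  obtain ⟨hε, he, hd, ⟨hgA, ⟨P, hP⟩, hgm⟩, hhA, ⟨N, hN⟩, hhm⟩ := isQuotForm_iff.1 hf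
  obtain ⟨hε', he', hd', ⟨hgA', ⟨P', hP'⟩, hgm'⟩, hhA', ⟨N', hN'⟩, hhm'⟩ := isQuotForm_iff.1 hf'
  have hs : g' / h' = g / h ∨ g' / h' = -(g / h) :=
    eq_or_eq_neg_of_signs hε hε' (he.symm.trans he')
  have hs' : g / h = g' / h' ∨ g / h = -(g' / h') :=
    eq_or_eq_neg_of_signs hε' hε (he'.symm.trans he)
  have hfr := hP.div hN hd
  have hfr' := hP'.div hN' hd'
  have hm := hfr.lder_neg_match hfr' hs
  have hm' := hfr'.lder_neg_match hfr hs'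
  simp only [Finset.union_empty, Finset.empty_union] at hm hm'
  have hgg := hgm.eq_of_eq_or_neg hgm' (hP.prod_eq_or_neg hP' hm.1 hm'.1)
  have hhh := hhm.eq_of_eq_or_neg hhm' (hN.prod_eq_or_neg hN' hm.2 hm'.2)
  refine ⟨?_, hgg, hhh⟩
  have h1 := he.symm.trans he'
  rw [hgg, hhh] at h1
  exact (mul_right_cancel₀ (div_ne_zero hgA.ne_zero hhA.ne_zero) h1).symm

theorem IsQuotForm.types {f ε g h : RatFun} (hq : IsQuotForm f ε g h) (hf : IsAE f) :
    (IsFirstType f ↔ ε = 1 ∧ IsFirstType g ∧ IsFirstType h) ∧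
      (IsSecondType f ↔
        (IsSecondType g ∧ (IsFirstType h ∨ IsSecondType h)) ∨
        (IsSecondType h ∧ (IsFirstType g ∨ IsSecondType g))) ∧
      (IsThirdType f ↔ IsThirdType g ∨ IsThirdType h) := by
  obtain ⟨hε, he, hd, ⟨hg, hgn, -⟩, hh, hhn, -⟩ := isQuotForm_iff.1 hq
  obtain ⟨h1, h2, h3⟩ := types_of_sign (hg.div hh hd) hf hε he
  have hgi : Iso g (-g) → IsAE (-g) := fun h => h.isAE_iff.1 hg
  have hhi : Iso h (-h) → IsAE (-h) := fun h' => h'.isAE_iff.1 hh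
  rw [h1, h2, h3, isAE_neg_div_iff hg hh hgn hhn hd, iso_neg_div_iff hgn hhn hd]
  simp only [isThirdType_iff, IsFirstType, IsSecondType, hg, hh, true_and]
  generalize IsAE (-g) = p at *
  generalize IsAE (-h) = p' at *
  generalize Iso g (-g) = q at *
  generalize Iso h (-h) = q' at *
  clear h1 h2 h3 hq he hd
  refine ⟨by tauto, ?_, trivial⟩
  by_cases p <;> by_cases p' <;> by_cases q <;> by_cases q' <;> simp_all

end ArithExpr

end

/-! ### The fundamental theorem, assembled from the semantic classification and the canonical forms
-/

open ArithExpr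
theorem mainTheorem1 :
    -- every arithmetic expression ends with exactly one operator
    ((∀ f ∈ AE, ∃! o : Op, f ∈ AEop o) ∧
      AE = AEop .plus ∪ AEop .minus ∪ AEop .times ∪ AEop .divide ∧
      Pairwise (fun o₁ o₂ : Op => Disjoint (AEop o₁) (AEop o₂))) ∧
    -- (a) sums
    (∀ f ∈ AEop .plus,
      (∃ (n : ℕ) (F : Fin n → RatFun), IsSumForm f n F) ∧
      (∀ (n m : ℕ) (F : Fin n → RatFun) (F' : Fin m → RatFun),
        IsSumForm f n F → IsSumForm f m F' → ∃ e : Fin m ≃ Fin n, ∀ j, F' j = F (e j)) ∧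
      (∀ (n : ℕ) (F : Fin n → RatFun), IsSumForm f n F →
        (IsFirstType f ↔ ∀ j, IsFirstType (F j)) ∧
        (IsThirdType f ↔
          (∀ j, IsSecondType (F j) ∨ IsThirdType (F j)) ∧ SecondTypesPair F))) ∧
    -- (b) differences
    (∀ f ∈ AEop .minus,
      (∃ g h : RatFun, IsDiffForm f g h) ∧
      (∀ g h g' h' : RatFun, IsDiffForm f g h → IsDiffForm f g' h' → g' = g ∧ h' = h) ∧
      (∀ g h : RatFun, IsDiffForm f g h →
        (IsThirdType f ↔
          Iso g h ∨ ∃ G : RatFun, G ∈ AEop .plus ∪ AEop .times ∪ AEop .divide ∧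
            IsThirdType G ∧ vars G ∩ vars h = ∅ ∧ Iso g (G + h)))) ∧
    -- (c) products
    (∀ f ∈ AEop .times,
      (∃ (ε : RatFun) (n : ℕ) (F : Fin n → RatFun), IsProdForm f ε n F) ∧
      (∀ (ε ε' : RatFun) (n m : ℕ) (F : Fin n → RatFun) (F' : Fin m → RatFun),
        IsProdForm f ε n F → IsProdForm f ε' m F' →
          ε' = ε ∧ ∃ e : Fin m ≃ Fin n, ∀ j, F' j = F (e j)) ∧
      (∀ (ε : RatFun) (n : ℕ) (F : Fin n → RatFun), IsProdForm f ε n F →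
        (IsFirstType f ↔ ε = 1 ∧ ∀ j, IsFirstType (F j)) ∧
        (IsSecondType f ↔
          (∃ j, IsSecondType (F j)) ∧ ∀ j, IsFirstType (F j) ∨ IsSecondType (F j)) ∧
        (IsThirdType f ↔ ∃ j, IsThirdType (F j)))) ∧
    -- (d) quotients
    (∀ f ∈ AEop .divide,
      (∃ ε g h : RatFun, IsQuotForm f ε g h) ∧
      (∀ ε g h ε' g' h' : RatFun, IsQuotForm f ε g h → IsQuotForm f ε' g' h' →
        ε' = ε ∧ g' = g ∧ h' = h) ∧
      (∀ ε g h : RatFun, IsQuotForm f ε g h →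
        (IsFirstType f ↔ ε = 1 ∧ IsFirstType g ∧ IsFirstType h) ∧
        (IsSecondType f ↔
          (IsSecondType g ∧ (IsFirstType h ∨ IsSecondType h)) ∨
          (IsSecondType h ∧ (IsFirstType g ∨ IsSecondType g))) ∧
        (IsThirdType f ↔ IsThirdType g ∨ IsThirdType h))) := by
  refine ⟨⟨fun f hf => ?_, ?_, ?_⟩, fun f hf => ?_, fun f hf => ?_, fun f hf => ?_, fun f hf => ?_⟩
  · obtain ⟨o, ho⟩ := IsAE.exists_cls hf
    exact ⟨o, mem_AEop_iff.2 ho, fun o' ho' => (mem_AEop_iff.1 ho').unique ho⟩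
  · ext f
    simp only [Set.mem_union, mem_AEop_iff]
    constructor
    · intro hf
      obtain ⟨o, ho⟩ := IsAE.exists_cls hf
      cases o <;> simp [ho]
    · rintro (((h | h) | h) | h) <;> exact h.isAE
  · intro o₁ o₂ hne
    rw [Set.disjoint_left]
    exact fun f h₁ h₂ => hne ((mem_AEop_iff.1 h₁).unique (mem_AEop_iff.1 h₂))
  · refine ⟨exists_isSumForm (mem_AEop_iff.1 hf), fun n m F F' h h' => ?_, fun n F h =>
      ⟨h.isFirstType_iff hf.1, h.isThirdType_iff hf.1⟩⟩
    exact exists_equiv_of_image_eq h.injective h'.injective (h.isSumOf.unique h'.isSumOf)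
  · exact ⟨exists_isDiffForm (mem_AEop_iff.1 hf), fun g h g' h' h₁ h₂ => h₁.unique h₂,
      fun g h h₁ => h₁.isThirdType_iff⟩
  · exact ⟨exists_isProdForm (mem_AEop_iff.1 hf), fun ε ε' n m F F' h h' => h.unique h',
      fun ε n F h => h.types hf.1⟩
  · exact ⟨exists_isQuotForm (mem_AEop_iff.1 hf), fun ε g h ε' g' h' h₁ h₂ => h₁.unique h₂,
      fun ε g h h₁ => h₁.types hf.1⟩
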